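/- **Theorem 3.1.** *Model.* For real $T>1$ let $\Omega$ be the set of all $h:\mathbb Z_+^2\to\mathbb Z_+$ ($\mathbb Z_+=\{0,1,2,\dots\}$) that are weakly decreasing in each coordinate and have finite support, and let $h$ be random with probability $\mathbb P_T(h)=Z_T^{-1}(1-1/T)^{V(h)}$, where $V(h)=\sum_{i,j}h(i,j)$ and $Z_T=\sum_{h\in\Omega}(1-1/T)^{V(h)}$. For $\ell\in\mathbb Z_+$ and $t\in\mathbb Z$ let $h_\ell(t)=h(i,j)-\ell$, where $(i,j)$ is the unique point with $j-i=t$ and $\min(i,j)=\ell$. Let $\eta(j,t)=1$ if $h_\ell(t)=j$ for some $\ell$, and $\eta(j,t)=0$ otherwise, for $(j,t)\in\mathbb Z^2$. *Reference point.* Let $\tau_0\in\mathbb R\setminus\{0\}$ and $$-2\ln(1+e^{-|\tau_0|/2})<\zeta_0<-2\ln(1-e^{-|\tau_0|/2}),$$ put $$\rho=\rho(\zeta_0,\tau_0)=\frac1\pi\arccos\Big(\cosh(\tau_0/2)-\tfrac12e^{-\zeta_0+|\tau_0|/2}\Big),$$ and let $\eta_T^{\mathrm{bulk}}(j,t)=\eta(\lfloor\zeta_0T\rfloor+j,\lfloor\tau_0T\rfloor+t)$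 for $(j,t)\in\mathbb Z^2$. *Kernel.* For $j,t,j',t'\in\mathbb Z$ let $$S(j,t;j',t')=\frac{\operatorname{sgn}(t-t')}{2\pi}\int_{I(t,t')}\exp\Big[ik(j-j')+(t-t')\ln\big(1-e^{-|\tau_0|/2}e^{-ik\sigma}\big)\Big]\,dk,$$ where $\sigma=1$ if $\tau_0>0$ and $\sigma=-1$ if $\tau_0<0$, $\ln$ is the principal branch, and $\operatorname{sgn}(t-t')=1$, $I(t,t')=[-\pi\rho,\pi\rho]$ if $t\ge t'$, while $\operatorname{sgn}(t-t')=-1$, $I(t,t')=[\pi\rho,2\pi-\pi\rho]$ if $t<t'$. *Claim.* There is exactly one probability measure on $\{0,1\}^{\mathbb Z^2}$ under which the coordinate field $\eta^{\mathrm{sine}}$ is determinantal with kernel $S$, that is, $$\mathbb E\Big[\prod_{k=1}^n\eta^{\mathrm{sine}}(j_k,t_k)\Big]=\det\big[S(j_k,t_k;j_l,t_l)\big]_{1\le k,l\le n}$$ for all $n$ and all distinct points $(j_1,t_1),\dots,(j_n,t_n)\in\mathbb Z^2$. This measure is invariant under all translations of $\mathbb Z^2$, and as $T\to\infty$ the field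 $\eta_T^{\mathrm{bulk}}$ converges to $\eta^{\mathrm{sine}}$ in the sense of local distributions: for every finite $A\subset\mathbb Z^2$ and every $E\subset\{0,1\}^A$, $$\lim_{T\to\infty}\mathbb P_T\big(\eta_T^{\mathrm{bulk}}|_A\in E\big)=\mathbb P\big(\eta^{\mathrm{sine}}|_A\in E\big).$$ Moreover, at equal times $S$ is the discrete sine kernel of density $\rho$: $S(i,t;i,t)=\rho$ and $$S(i,t;j,t)=\frac{\sin(\pi\rho(i-j))}{\pi(i-j)}\qquad(i\ne j).$$ -/

import Mathlib

open MeasureTheory Filter Topology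

namespace FacetedCrystal

/-- Crystal configurations, described by their height functions over the quadrant `ℕ × ℕ`:
`h (i, j)` atoms are removed from the column at `(i, j)`; `h` is weakly decreasing in each
coordinate (antitone for the product order) and vanishes outside a finite set. -/
def Height : Type := {h : ℕ × ℕ →₀ ℕ // Antitone h}

instance : MeasurableSpace Height := ⊤

/-- The number of removed atoms. -/
def volume (h : Height) : ℕ := h.1.sum fun _ n => n

/-- The Boltzmann weight `q ^ V` with `q = 1 - 1 / T`. -/
noncomputable def weight (T : ℝ) (h : Height) : ENNReal :=
  ENNReal.ofReal ((1 - 1 / T) ^ volume h)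

/-- The law of the crystal: the measure with weights `q ^ V`, divided by the partition function. -/
noncomputable def crystalLaw (T : ℝ) : Measure Height :=
  (∑' h, weight T h)⁻¹ • Measure.sum fun h => weight T h • Measure.dirac h

/-- The gradient line with label `l` at time `t`, that is `h (i, j) - l` for the unique `(i, j)`
with `j - i = t` and `min i j = l`. -/
def gradientLine (h : Height) (l : ℕ) (t : ℤ) : ℤ :=
  (h.1 (l + (-t).toNat, l + t.toNat) : ℤ) - l

/-- A realization of a space-time field of occupation variables; a point of `ℤ × ℤ` is
`(position, time)`, and `true` means occupied. -/
abbrev Field : Type := ℤ × ℤ → Bool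

open Classical in
/-- The occupation field: `(j, t)` is occupied if some gradient line passes through it. -/
noncomputable def occupation (h : Height) : Field :=
  fun p => decide (∃ l : ℕ, gradientLine h l p.2 = p.1)

/-- The occupation field seen from the lattice point `([ζ₀ T], [τ₀ T])`. -/
noncomputable def bulkField (ζ₀ τ₀ T : ℝ) (h : Height) : Field :=
  fun p => occupation h (⌊ζ₀ * T⌋ + p.1, ⌊τ₀ * T⌋ + p.2)

/-- The law of the shifted occupation field. -/
noncomputable def bulkLaw (ζ₀ τ₀ T : ℝ) : Measure Field :=
  (crystalLaw T).map (bulkField ζ₀ τ₀ T)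

/-- The lower boundary of the rounded region. -/
noncomputable def lowerEdge (τ : ℝ) : ℝ := -2 * Real.log (1 + Real.exp (-|τ| / 2))

/-- The upper boundary of the rounded region (for `τ ≠ 0`). -/
noncomputable def upperEdge (τ : ℝ) : ℝ := -2 * Real.log (1 - Real.exp (-|τ| / 2))

/-- The macroscopic density of lines at a point of the rounded region. -/
noncomputable def density (ζ τ : ℝ) : ℝ :=
  Real.arccos (Real.cosh (τ / 2) - Real.exp (-ζ + |τ| / 2) / 2) / Real.pi

/-- The kinetic energy `ln (1 - exp (-|τ₀| / 2 - i k sgn τ₀))`. -/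
noncomputable def kineticEnergy (τ₀ k : ℝ) : ℂ :=
  Complex.log (1 - Complex.exp (((-|τ₀| / 2 : ℝ) : ℂ) - Complex.I * k * (Real.sign τ₀ : ℝ)))

/-- The integrand `exp (i k (j - j') + (t - t') ε(k))` of the bulk kernel, where `x = (j, t)`,
`y = (j', t')` and `ε` is the kinetic energy. -/
noncomputable def bulkWave (τ₀ : ℝ) (x y : ℤ × ℤ) (k : ℝ) : ℂ :=
  Complex.exp (Complex.I * k * ((x.1 - y.1 : ℤ) : ℂ) + ((x.2 - y.2 : ℤ) : ℂ) * kineticEnergy τ₀ k)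

/-- The space-time kernel `S (j, t; j', t')`: the filled states contribute if `t ≥ t'`, and the
empty ones, with a minus sign, if `t < t'`. -/
noncomputable def bulkKernel (ζ₀ τ₀ : ℝ) (x y : ℤ × ℤ) : ℂ :=
  if y.2 ≤ x.2 then
    1 / (2 * (Real.pi : ℂ)) *
      ∫ k in (-(Real.pi * density ζ₀ τ₀))..(Real.pi * density ζ₀ τ₀), bulkWave τ₀ x y k
  else
    -(1 / (2 * (Real.pi : ℂ))) *
      ∫ k in (Real.pi * density ζ₀ τ₀)..(2 * Real.pi - Real.pi * density ζ₀ τ₀), bulkWave τ₀ x y k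

/-- The field with law `μ` is determinantal with kernel `K`: for distinct points `p 1, …, p n`,
the expectation of the product of the occupation variables is `det (K (p k) (p l))`. -/
def IsDeterminantal (K : ℤ × ℤ → ℤ × ℤ → ℂ) (μ : Measure Field) : Prop :=
  ∀ (n : ℕ) (p : Fin n → ℤ × ℤ), Function.Injective p →
    ((∫ ω, ∏ k, ((ω (p k)).toNat : ℝ) ∂μ : ℝ) : ℂ) =
      Matrix.det (Matrix.of fun k l => K (p k) (p l))

/-- Invariance of the law of a field under all translations of space-time. -/
def IsTranslationInvariant (μ : Measure Field) : Prop :=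
  ∀ v : ℤ × ℤ, μ.map (fun ω p => ω (p + v)) = μ

/-- Convergence of local distributions as `T → ∞`: for every finite set `A` of space-time points,
the joint law of the occupation variables in `A` converges. -/
def ConvergesLocally (P : ℝ → Measure Field) (μ : Measure Field) : Prop :=
  ∀ (A : Finset (ℤ × ℤ)) (E : Set (A → Bool)),
    Tendsto (fun T => P T {ω | (fun a : A => ω a) ∈ E}) atTop (𝓝 (μ {ω | (fun a : A => ω a) ∈ E}))

end FacetedCrystal

/-! The gradient lines of a crystal never meet: the values of `h` on neighbouring diagonals
interlace. The occupation field is therefore a system of nonintersecting paths, and its correlations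
are determinants. Put κ = √(1 - 1/T), so that a crystal has weight κ^(2V). Interlacing of two slices
is a 0/1 determinant (`det_staircase`), iterated Cauchy–Binet sums the products of such determinants
over chains of slices (`det_transfer_submatrix`), and the Eynard–Mehta argument
(`det_transfer_markedLayer`) gives a correlation kernel for L lines in a box of size N. It consists
of an inverse Gram matrix between two vectors of one-line weights, minus a one-line weight when the
first point is earlier than the second.

Two limits remove the box. As N → ∞ the one-line weights become Fourier coefficients of explicit
symbols, products of factors 1 - κ^(2m+1) z^(±1) and their inverses (`tendsto_lineWeight`). As L → ∞
the inverse Gram term is read as an orthogonal projection in L² of the circle onto the span of L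
functions (`inner_future_past`). These spans increase to the space of nonpositive frequencies, so
the projections converge strongly (`tendsto_lineKernel`). Since the partition function is finite
(`summable_weights`), the whole crystal is determinantal with the explicit kernel `schurKernel`.

For the bulk limit at τ > 0 the contour is moved to the circle of radius κ^Θ, Θ being the
macroscopic time. Up to a gauge factor, invisible in determinants, the kernel becomes the pairing of
E·f with E⁻¹·g restricted to nonnegative frequencies (`schurKernel_eq_halfSum`), minus a correction
when t < t'. Here E is unimodular with local frequency asymptotic to T·D, where D(z) = -2 ln|1 - cz|
- ζ and c = exp(-τ/2) (`hasLocalFrequency_carrier`). By nonstationary phase, restriction to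
nonnegative frequencies turns into restriction to the set D > 0
(`HasLocalFrequency.tendsto_halfSum_fixed`). That set is the arc |θ| < πρ, and f·g tends to z^(j-j')
(1 - c/z)^(t-t'), which gives the kernel S. The case τ < 0 follows by time reversal.

Thus all moments converge to determinants of S. Compactness of the probability measures on
{0,1}^(ℤ²) provides a field with these moments. Since local probabilities are finite linear
combinations of moments, the field is unique and is the local limit. It is translation invariant
because S depends on differences only. -/

namespace FacetedCrystal

/-- Strictly decreasing families of positions. -/
abbrev Slice (L : ℕ) (P : Type*) [Preorder P] : Type _ := {s : Fin L → P // StrictAnti s}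

noncomputable instance {L : ℕ} {P : Type*} [Fintype P] [Preorder P] : Fintype (Slice L P) :=
  Fintype.ofFinite _

/-! ### Cauchy–Binet over strictly decreasing families -/

section CauchyBinet

variable {L : ℕ} {P R : Type*}

/-- Multilinearity in the rows: row i of the product is the combination of the rows of `B` with
coefficients `A i`. -/
theorem det_mul_eq_sum_functions [Fintype P] [CommRing R] (A : Matrix (Fin L) P R) (B : Matrix P (Fin L) R) :
    (A * B).det = ∑ p : Fin L → P, (∏ i, A i (p i)) * (B.submatrix p id).det := by
  classical
  have h : (A * B) = fun i => ∑ j, A i j • B j := by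
    ext i k
    simp [Matrix.mul_apply, Finset.sum_apply]
  have h2 := (Matrix.detRowAlternating (R := R) (n := Fin L)).toMultilinearMap.map_sum
    (fun i j => A i j • B j)
  have h3 : (A * B).det = Matrix.detRowAlternating (R := R) (fun i => ∑ j, A i j • B j) := by
    rw [h]; rfl
  rw [h3]
  refine h2.trans (Finset.sum_congr rfl fun p _ => ?_)
  rw [MultilinearMap.map_smul_univ]
  rfl

theorem exists_perm_strictAnti [LinearOrder P] {p : Fin L → P} (hp : Function.Injective p) :
    ∃ (s : Slice L P) (σ : Equiv.Perm (Fin L)), p = s.1 ∘ σ := by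
  -- Sorting produces increasing families while slices decrease, so the sorting is done in the dual
  -- order.
  let q : Fin L → Pᵒᵈ := fun i => OrderDual.toDual (p i)
  have hq : Function.Injective q := fun i j h => hp h
  have hm : StrictMono (q ∘ Tuple.sort q) :=
    (Tuple.monotone_sort q).strictMono_of_injective (hq.comp (Equiv.injective _))
  refine ⟨⟨p ∘ Tuple.sort q, fun i j h => hm h⟩, (Tuple.sort q)⁻¹, ?_⟩
  ext i
  simp

theorem Slice.range_injective [LinearOrder P] {s s' : Slice L P} (h : Set.range s.1 = Set.range s'.1) : s = s' := by
  apply Subtype.ext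
  have h1 : StrictMono (fun i => OrderDual.toDual (s.1 i)) := fun i j h => s.2 h
  have h2 : StrictMono (fun i => OrderDual.toDual (s'.1 i)) := fun i j h => s'.2 h
  have h3 := (StrictMono.range_inj h1 h2).1 (by
    ext x; exact Set.ext_iff.1 h x)
  ext i
  exact congrFun h3 i

/-- The Cauchy–Binet formula. -/
theorem det_mul_eq_sum_slices [Fintype P] [LinearOrder P] [CommRing R] (A : Matrix (Fin L) P R) (B : Matrix P (Fin L) R) :
    (A * B).det = ∑ s : Slice L P, (A.submatrix id s.1).det * (B.submatrix s.1 id).det := by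
  classical
  rw [det_mul_eq_sum_functions]
  have h1 : ∀ s : Slice L P, (A.submatrix id s.1).det * (B.submatrix s.1 id).det =
      ∑ σ : Equiv.Perm (Fin L), (∏ i, A i (s.1 (σ i))) * (B.submatrix (s.1 ∘ σ) id).det := by
    intro s
    rw [← Matrix.det_transpose, Matrix.det_apply', Finset.sum_mul]
    refine Finset.sum_congr rfl fun σ _ => ?_
    have := Matrix.det_permute σ (B.submatrix s.1 id)
    rw [Matrix.submatrix_submatrix] at this
    simp only [Function.comp_id] at this
    rw [this]
    simp only [Matrix.transpose_apply, Matrix.submatrix_apply, id]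
    ring
  simp_rw [h1]
  rw [← Finset.sum_product']
  symm
  -- A slice together with a permutation is the same thing as an injective function; every other
  -- function repeats a row of `B` and contributes zero.
  refine Finset.sum_of_injOn (fun x => x.1.1 ∘ x.2) ?_ ?_ ?_ ?_
  · rintro ⟨s, σ⟩ _ ⟨s', σ'⟩ _ h
    simp only at h
    have hs : s = s' := Slice.range_injective (by
      rw [← σ.surjective.range_comp s.1, ← σ'.surjective.range_comp s'.1, h])
    subst hs
    have : σ = σ' := by
      ext i
      exact congrArg Fin.val (s.2.injective (congrFun h i))
    rw [this]
  · intro x _; simp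
  · intro p _ hp
    have : ¬ Function.Injective p := by
      intro hinj
      obtain ⟨s, σ, h⟩ := exists_perm_strictAnti hinj
      exact hp ⟨(s, σ), by simp, h.symm⟩
    rw [Function.Injective] at this
    push Not at this
    obtain ⟨i, j, hij, hne⟩ := this
    rw [Matrix.det_zero_of_row_eq hne (by ext k; simp [hij]), mul_zero]
  · rintro ⟨s, σ⟩ _
    rfl

end CauchyBinet

/-! ### Interlacing as a determinant -/

section Interlacing

variable {L : ℕ} {P : Type*} [LinearOrder P]

theorem mem_iff_lt_card_of_isLowerSet {S : Finset (Fin L)} (hS : IsLowerSet (S : Set (Fin L)))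
    (c : Fin L) : c ∈ S ↔ (c : ℕ) < S.card := by
  constructor
  · intro h
    have h1 : Finset.Iic c ⊆ S := fun x hx => hS (Finset.mem_Iic.1 hx) h
    have := Finset.card_le_card h1
    rw [Fin.card_Iic] at this
    omega
  · intro h
    by_contra hc
    have h1 : S ⊆ Finset.Iio c := fun x hx => by
      rw [Finset.mem_Iio]
      by_contra hxc
      exact hc (hS (not_lt.1 hxc) hx)
    have := Finset.card_le_card h1
    rw [Fin.card_Iio] at this
    omega

/-- `a 0 ≥ b 0 > a 1 ≥ b 1 > …`. -/
def Interlaces (a b : Fin L → P) : Prop :=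
  (∀ i, b i ≤ a i) ∧ ∀ k i, k < i → a i < b k

/-- Each row is a block of zeros followed by ones, and the number of zeros is nondecreasing in the
row index. Under interlacing the matrix is upper triangular with unit diagonal. Otherwise a row
vanishes, or two rows have equally many zeros and coincide. If neither happened, the numbers of
zeros would form a strictly increasing map of `Fin L` into itself, hence the identity, and that is
interlacing. -/
theorem det_staircase {R : Type*} [CommRing R] {a b : Fin L → P} (ha : StrictAnti a)
    (hb : StrictAnti b) [Decidable (Interlaces a b)] :
    (Matrix.of fun i k => if b k ≤ a i then (1 : R) else 0).det =
      if Interlaces a b then 1 else 0 := by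
  classical
  by_cases hab : Interlaces a b
  · rw [if_pos hab, Matrix.det_of_isUpperTriangular]
    · simp [hab.1]
    · intro i k hik
      simp [hab.2 k i hik]
  · rw [if_neg hab]
    let S : Fin L → Finset (Fin L) := fun i => Finset.univ.filter fun c => a i < b c
    have hS : ∀ i, IsLowerSet (S i : Set (Fin L)) := by
      intro i c c' hcc' hc
      simp only [S, Finset.coe_filter, Finset.mem_univ, true_and, Set.mem_ofPred_eq] at hc ⊢
      exact hc.trans_le (hb.antitone hcc')
    have key : ∀ i c, a i < b c ↔ (c : ℕ) < (S i).card := by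
      intro i c
      rw [← mem_iff_lt_card_of_isLowerSet (hS i)]
      simp [S]
    have key' : ∀ i c, b c ≤ a i ↔ (S i).card ≤ c := fun i c => by
      rw [← not_lt, key, not_lt]
    have hmono : Monotone fun i => (S i).card := by
      intro i j hij
      refine Finset.card_le_card fun c hc => ?_
      simp only [S, Finset.mem_filter, Finset.mem_univ, true_and] at hc ⊢
      exact (ha.antitone hij).trans_lt hc
    by_cases h1 : ∃ i, (S i).card = L
    · obtain ⟨i, hi⟩ := h1
      refine Matrix.det_eq_zero_of_row_eq_zero i fun c => ?_
      have : a i < b c := (key i c).2 (by rw [hi]; exact c.2)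
      simp [this]
    by_cases h2 : Function.Injective fun i => (S i).card
    · exfalso
      apply hab
      have hlt : ∀ i, (S i).card < L := fun i =>
        lt_of_le_of_ne ((Finset.card_le_univ _).trans_eq (Fintype.card_fin L)) fun h => h1 ⟨i, h⟩
      let f : Fin L → Fin L := fun i => ⟨(S i).card, hlt i⟩
      have hf : StrictMono f := by
        refine Monotone.strictMono_of_injective (fun i j hij => hmono hij) fun i j hij => h2 ?_
        exact congrArg Fin.val hij
      have hid : f = id := by
        refine (StrictMono.range_inj hf strictMono_id).1 ?_
        rw [(Finite.injective_iff_surjective.1 hf.injective).range_eq, Set.range_id]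
      have hc : ∀ i, (S i).card = i := fun i => congrArg Fin.val (congrFun hid i)
      refine ⟨fun i => (key' i i).2 (hc i).le, fun k i hki => (key i k).2 ?_⟩
      rw [hc]; exact hki
    · rw [Function.Injective] at h2
      push Not at h2
      obtain ⟨i, j, hij, hne⟩ := h2
      refine Matrix.det_zero_of_row_eq hne ?_
      ext c
      have : b c ≤ a i ↔ b c ≤ a j := by rw [key', key', hij]
      simp [this]

end Interlacing

/-! ### The determinant identity behind the Eynard–Mehta theorem -/

section Perturbation

/-- With the indices ordered by `s`, the matrix `1 - W` is block triangular and its diagonal blocks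
are identities. -/
theorem det_one_sub_strictly_triangular {r : ℕ} {R : Type*} [CommRing R] (W : Matrix (Fin r) (Fin r) R)
    (s : Fin r → ℕ) (hW : ∀ i j, s j ≤ s i → W i j = 0) : (1 - W).det = 1 := by
  have h : (1 - W).BlockTriangular s := by
    intro i j hij
    have : i ≠ j := fun h => by simp [h] at hij
    simp [this, hW i j hij.le]
  rw [h.det]
  refine Finset.prod_eq_one fun k _ => ?_
  have : (1 - W).toSquareBlock s k = 1 := by
    ext ⟨i, hi⟩ ⟨j, hj⟩
    simp only [Matrix.toSquareBlock_def, Matrix.of_apply, Matrix.sub_apply]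
    rw [hW i j (by rw [hi, hj])]
    simp [Matrix.one_apply, Subtype.ext_iff]
  rw [this, Matrix.det_one]

/-- After `G` is pulled out, det(1 + AB) = det(1 + BA) reduces the size from `L` to `r`. The vector
`v` is known only through the linear system `v * (1 - c • W) = F`; multiplying by `1 - c • W`, whose
determinant is one, replaces it by the explicit `F`. -/
theorem det_add_perturbation {r L : ℕ} {R : Type*} [_root_.Field R] (G : Matrix (Fin L) (Fin L) R)
    (v F : Matrix (Fin L) (Fin r) R) (H : Matrix (Fin r) (Fin L) R) (W : Matrix (Fin r) (Fin r) R)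
    (hG : G.det ≠ 0) (c : R) (s : Fin r → ℕ) (hW : ∀ i j, s j ≤ s i → W i j = 0)
    (hv : v = F + c • (v * W)) :
    (G + c • (v * H)).det = G.det * (1 + c • (H * G⁻¹ * F - W)).det := by
  have hu : IsUnit G.det := isUnit_iff_ne_zero.2 hG
  have h1 : (1 - c • W).det = 1 := det_one_sub_strictly_triangular _ s fun i j h => by
    simp [hW i j h]
  have h2 : v * (1 - c • W) = F := by
    rw [Matrix.mul_sub, Matrix.mul_one, Matrix.mul_smul]
    nth_rewrite 1 [hv]
    abel
  have h3 : G + c • (v * H) = G * (1 + (c • (G⁻¹ * v)) * H) := by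
    rw [mul_add, mul_one, Matrix.smul_mul, Matrix.mul_smul, ← Matrix.mul_assoc, ← Matrix.mul_assoc,
      Matrix.mul_nonsing_inv _ hu, Matrix.one_mul]
  rw [h3, Matrix.det_mul, Matrix.det_one_add_mul_comm]
  congr 1
  have h4 : 1 + c • (H * G⁻¹ * F - W) = (1 + H * (c • (G⁻¹ * v))) * (1 - c • W) := by
    rw [add_mul, one_mul, ← h2, Matrix.mul_smul, Matrix.smul_mul, smul_sub]
    simp only [Matrix.mul_assoc]
    abel
  rw [h4, Matrix.det_mul, h1, mul_one]

end Perturbation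

end FacetedCrystal

namespace FacetedCrystal

open Classical in
/-- The indicator of a proposition. -/
noncomputable def ind (R : Type*) [Zero R] [One R] (p : Prop) : R := if p then 1 else 0

theorem ind_of {R : Type*} [Zero R] [One R] {p : Prop} (h : p) : ind R p = 1 := if_pos h

theorem ind_of_not {R : Type*} [Zero R] [One R] {p : Prop} (h : ¬ p) : ind R p = 0 := if_neg h

/-! ### Products of transfer matrices, with and without marks -/

section Transfer

variable {P R : Type*} [Fintype P] [CommRing R]

open Classical in
/-- The product of the matrices `X i, …, X (j - 1)`. -/
noncomputable def transfer (X : ℕ → Matrix P P R) (i : ℕ) : ℕ → Matrix P P R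
  | 0 => 1
  | j + 1 => if i ≤ j then transfer X i j * X j else 1

theorem transfer_of_le [DecidableEq P] (X : ℕ → Matrix P P R) {i j : ℕ} (h : j ≤ i) :
    transfer X i j = 1 := by
  cases j with
  | zero => ext a b; simp [transfer, Matrix.one_apply]
  | succ j => ext a b; simp [transfer, Matrix.one_apply, show ¬ i ≤ j by omega]

theorem transfer_succ (X : ℕ → Matrix P P R) {i j : ℕ} (h : i ≤ j) :
    transfer X i (j + 1) = transfer X i j * X j := by
  simp [transfer, h]

theorem transfer_mul_transfer (X : ℕ → Matrix P P R) {i j k : ℕ} (hij : i ≤ j) (hjk : j ≤ k) :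
    transfer X i j * transfer X j k = transfer X i k := by
  classical
  induction k, hjk using Nat.le_induction with
  | base => rw [transfer_of_le X le_rfl, mul_one]
  | succ k hk ih => rw [transfer_succ X hk, transfer_succ X (hij.trans hk), ← mul_assoc, ih]

open Classical in
-- Distinct slices have distinct ranges of the same size, so some position of `a` is missing from
-- `b` and its row is zero.
theorem det_one_submatrix_slice {L : ℕ} {P : Type*} [LinearOrder P] (a b : Slice L P) :
    ((1 : Matrix P P R).submatrix a.1 b.1).det = if a = b then 1 else 0 := by
  split_ifs with h
  · subst h
    rw [Matrix.submatrix_one _ a.2.injective, Matrix.det_one]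
  · have : ¬ Set.range a.1 ⊆ Set.range b.1 := by
      intro hs
      apply h
      refine Slice.range_injective (Set.eq_of_subset_of_ncard_le hs ?_ (Set.finite_range _))
      rw [← Set.image_univ, ← Set.image_univ, Set.ncard_image_of_injective _ a.2.injective,
        Set.ncard_image_of_injective _ b.2.injective]
    rw [Set.not_subset] at this
    obtain ⟨_, ⟨i, rfl⟩, hi⟩ := this
    refine Matrix.det_eq_zero_of_row_eq_zero i fun j => ?_
    rw [Matrix.submatrix_apply, Matrix.one_apply_ne]
    exact fun h => hi ⟨j, h.symm⟩

open Classical in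
-- Cauchy–Binet applied once per layer: the algebraic form of the Lindström–Gessel–Viennot sum over
-- nonintersecting paths.
theorem det_transfer_submatrix {L : ℕ} {P : Type*} [Fintype P] [LinearOrder P]
    (X : ℕ → Matrix P P R) (n : ℕ) (a b : Slice L P) :
    ((transfer X 0 n).submatrix a.1 b.1).det =
      ∑ c : Fin (n + 1) → Slice L P, if c 0 = a ∧ c (Fin.last n) = b then
        ∏ i : Fin n, ((X i).submatrix (c i.castSucc).1 (c i.succ).1).det else 0 := by
  induction n generalizing b with
  | zero =>
    rw [transfer_of_le X le_rfl, det_one_submatrix_slice]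
    have h : ∀ c : Fin 1 → Slice L P, (if c 0 = a ∧ c (Fin.last 0) = b then
        ∏ i : Fin 0, ((X i).submatrix (c i.castSucc).1 (c i.succ).1).det else 0) =
        if c = fun _ => a then (if a = b then (1 : R) else 0) else 0 := by
      intro c
      have h1 : c = (fun _ => a) ↔ c 0 = a := by
        constructor
        · intro h; rw [h]
        · intro h; ext i : 1; rw [Subsingleton.elim i 0, h]
      simp only [h1]
      by_cases h2 : c 0 = a
      · simp [h2]
      · simp [h2]
    simp_rw [h]
    simp
  | succ n ih =>
    have h0 : (transfer X 0 (n + 1)).submatrix a.1 b.1 =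
        (transfer X 0 n).submatrix a.1 id * (X n).submatrix id b.1 := by
      rw [transfer_succ X (Nat.zero_le n)]; rfl
    rw [h0, det_mul_eq_sum_slices]
    have h1 : ∀ s : Slice L P, (((transfer X 0 n).submatrix a.1 id).submatrix id s.1).det *
        (((X n).submatrix id b.1).submatrix s.1 id).det =
        ∑ c : Fin (n + 1) → Slice L P, if c 0 = a ∧ c (Fin.last n) = s then
        (∏ i : Fin n, ((X i).submatrix (c i.castSucc).1 (c i.succ).1).det) *
          ((X n).submatrix s.1 b.1).det else 0 := by
      intro s
      have := ih s
      simp only [Matrix.submatrix_submatrix, Function.comp_id, Function.id_comp]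
      rw [this, Finset.sum_mul]
      refine Finset.sum_congr rfl fun c _ => ?_
      rw [ite_mul, zero_mul]
    simp_rw [h1]
    rw [Finset.sum_comm]
    rw [← (Fin.snocEquiv fun _ : Fin (n + 1 + 1) => Slice L P).sum_comp, Fintype.sum_prod_type_right]
    refine Finset.sum_congr rfl fun c _ => ?_
    -- The endpoint conditions leave a single intermediate slice `s` and a single final slice.
    rw [Finset.sum_eq_single (c (Fin.last n)), Finset.sum_eq_single b]
    · simp only [Fin.snocEquiv, Equiv.coe_fn_mk, Fin.snoc_last, and_true]
      have e0 : (Fin.snoc (α := fun _ : Fin (n + 1 + 1) => Slice L P) c b : _) 0 = c 0 :=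
        Fin.snoc_castSucc (α := fun _ : Fin (n + 1 + 1) => Slice L P) b c 0
      rw [e0]
      by_cases hc : c 0 = a
      · rw [if_pos hc, if_pos hc, Fin.prod_univ_castSucc]
        congr 1
        · refine Finset.prod_congr rfl fun i _ => ?_
          rw [Fin.succ_castSucc, Fin.snoc_castSucc, Fin.snoc_castSucc]
          rfl
        · rw [Fin.snoc_castSucc, Fin.succ_last, Fin.snoc_last]
          simp
      · rw [if_neg hc, if_neg hc]
    · intro s _ hs
      simp [Fin.snocEquiv, hs]
    · simp
    · intro s _ hs
      rw [if_neg]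
      exact fun h => hs h.2.symm
    · simp

variable {r : ℕ} (X : ℕ → Matrix P P R) (c : R) (σ : Fin r → ℕ) (pos : Fin r → P)

/-- The layers `X i`, followed by multiplication by `1 + c * (number of marks)` on slice `i + 1`. -/
noncomputable def markedLayer (i : ℕ) : Matrix P P R :=
  open Classical in
  X i * Matrix.diagonal fun j => 1 + c * ∑ k, ind R (σ k = i ∧ pos k = j)

/-- The marked evolution up to the mark `k`. -/
noncomputable def markedSource (α : P) (k : Fin r) : R :=
  (transfer (markedLayer X c σ pos) 0 (σ k) * X (σ k)) α (pos k)

/-- The half step shared by `transfer_markedLayer` and `markedSource_eq`: layer `n` has been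
crossed, but the marks on slice `n + 1` have not yet acted. -/
theorem transfer_markedLayer_mul (n : ℕ) (α j : P)
    (ih : ∀ j, transfer (markedLayer X c σ pos) 0 n α j = transfer X 0 n α j +
      c * ∑ k, if σ k < n then markedSource X c σ pos α k * transfer X (σ k + 1) n (pos k) j else 0) :
    (transfer (markedLayer X c σ pos) 0 n * X n) α j = transfer X 0 (n + 1) α j +
      c * ∑ k, if σ k < n then
        markedSource X c σ pos α k * transfer X (σ k + 1) (n + 1) (pos k) j else 0 := by
  rw [transfer_succ X (Nat.zero_le n), Matrix.mul_apply, Matrix.mul_apply]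
  simp_rw [ih, add_mul, Finset.sum_add_distrib, mul_assoc, ← Finset.mul_sum, Finset.sum_mul]
  rw [Finset.sum_comm]
  congr 2
  refine Finset.sum_congr rfl fun k _ => ?_
  by_cases hk : σ k < n
  · simp only [hk, if_true]
    rw [transfer_succ X (show σ k + 1 ≤ n by omega), Matrix.mul_apply, Finset.mul_sum]
    exact Finset.sum_congr rfl fun i _ => by ring
  · simp [hk]

/-- Expansion by the last mark whose term `c` is selected. After it the evolution is unmarked; up to
it, `markedSource` collects all that may happen at earlier marks. -/
theorem transfer_markedLayer (n : ℕ) (α j : P) :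
    transfer (markedLayer X c σ pos) 0 n α j = transfer X 0 n α j +
      c * ∑ k, if σ k < n then
        markedSource X c σ pos α k * transfer X (σ k + 1) n (pos k) j else 0 := by
  classical
  induction n generalizing j with
  | zero => simp [transfer]
  | succ n ih =>
    rw [transfer_succ _ (Nat.zero_le n), markedLayer, ← Matrix.mul_assoc, Matrix.mul_diagonal,
      mul_add, mul_one, transfer_markedLayer_mul X c σ pos n α j ih, add_assoc]
    congr 1
    -- The new marks are those with `σ k = n`; the transfer from slice `n + 1` to itself is the
    -- identity, so such a mark contributes only at its own position.
    have h : ∀ k, (if σ k < n + 1 then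
        markedSource X c σ pos α k * transfer X (σ k + 1) (n + 1) (pos k) j else 0) =
        (if σ k < n then
        markedSource X c σ pos α k * transfer X (σ k + 1) (n + 1) (pos k) j else 0) +
        (transfer (markedLayer X c σ pos) 0 n * X n) α j * ind R (σ k = n ∧ pos k = j) := by
      intro k
      rcases lt_trichotomy (σ k) n with h | h | h
      · simp [h, h.ne, show σ k < n + 1 by omega, ind]
      · by_cases hj : pos k = j
        · simp only [h, hj, and_self, if_true, lt_irrefl, if_false, mul_one, zero_add, ind_of,
            show n < n + 1 by omega]
          rw [transfer_of_le X le_rfl, Matrix.one_apply_eq, mul_one, markedSource, h, hj]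
        · simp only [h, hj, and_false, if_false, lt_irrefl, mul_zero, add_zero, ind,
            show n < n + 1 by omega, if_true]
          rw [transfer_of_le X le_rfl, Matrix.one_apply_ne hj, mul_zero]
      · simp [show ¬ σ k < n + 1 by omega, h.ne', show ¬ σ k < n by omega, ind]
    simp_rw [h, Finset.sum_add_distrib, ← Finset.mul_sum]
    rw [transfer_markedLayer_mul X c σ pos n α j ih]
    ring

/-- This is the system v = F + c v W required by `det_add_perturbation`. It is strictly triangular
because only marks on earlier layers enter. -/
theorem markedSource_eq (α : P) (k : Fin r) :
    markedSource X c σ pos α k = transfer X 0 (σ k + 1) α (pos k) +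
      c * ∑ k', if σ k' < σ k then
        markedSource X c σ pos α k' * transfer X (σ k' + 1) (σ k + 1) (pos k') (pos k) else 0 :=
  transfer_markedLayer_mul X c σ pos (σ k) α (pos k) fun j => transfer_markedLayer X c σ pos (σ k) α j

end Transfer

/-! ### The Eynard–Mehta theorem -/

section MarkedDeterminant

variable {P R : Type*} [Fintype P] [_root_.Field R] {r L : ℕ}

/-- The kernel of the layered process with source and sink `vac`, at the points
`(σ k + 1, pos k)`. -/
noncomputable def layerKernel (X : ℕ → Matrix P P R) (n : ℕ) (vac : Fin L → P) (σ : Fin r → ℕ)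
    (pos : Fin r → P) : Matrix (Fin r) (Fin r) R :=
  (Matrix.of fun k m => transfer X (σ k + 1) n (pos k) (vac m)) *
      ((transfer X 0 n).submatrix vac vac)⁻¹ *
      (Matrix.of fun l k => transfer X 0 (σ k + 1) (vac l) (pos k)) -
    Matrix.of fun k k' =>
      if σ k < σ k' then transfer X (σ k + 1) (σ k' + 1) (pos k) (pos k') else 0

/-- By `transfer_markedLayer` the marks perturb the Gram matrix by a product through the `r` marks,
and `det_add_perturbation` turns this into a determinant indexed by the marks. -/
theorem det_transfer_markedLayer (X : ℕ → Matrix P P R) (n : ℕ) (vac : Fin L → P) (σ : Fin r → ℕ)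
    (pos : Fin r → P) (hσ : ∀ k, σ k < n) (hG : ((transfer X 0 n).submatrix vac vac).det ≠ 0)
    (c : R) :
    ((transfer (markedLayer X c σ pos) 0 n).submatrix vac vac).det =
      ((transfer X 0 n).submatrix vac vac).det * (1 + c • layerKernel X n vac σ pos).det := by
  rw [layerKernel, ← det_add_perturbation _
    (Matrix.of fun l k => markedSource X c σ pos (vac l) k) _ _ _ hG c σ]
  · congr 1
    ext l m
    simp [transfer_markedLayer, hσ, Matrix.mul_apply]
  · intro i j h
    simp [h.not_gt]
  · ext l k
    simp only [Matrix.of_apply, Matrix.add_apply, Matrix.smul_apply, smul_eq_mul, Matrix.mul_apply]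
    rw [markedSource_eq]
    simp

end MarkedDeterminant

end FacetedCrystal

/-! ### Gauged one-line steps and weighted chains of slices -/

namespace FacetedCrystal

/-- The positions available to `L` lines of height at most `N`. -/
abbrev Window (L N : ℕ) : Type := ↥(Finset.Ioc (-(L : ℤ)) (N : ℤ))

/-- The gauge factor at slice `i`. -/
noncomputable def gauge (κ : ℝ) (N i : ℕ) (j : ℤ) : ℝ := κ ^ ((2 * ((i : ℤ) - N) + 1) * j)

/-- The admissible single-line steps from slice `i` to slice `i + 1`. -/
def StepRel (N i : ℕ) (j j' : ℤ) : Prop := if i < N then j ≤ j' else j' ≤ j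

open Classical in
/-- The one-line transfer matrix from slice `i` to slice `i + 1`. -/
noncomputable def step (κ : ℝ) (L N i : ℕ) : Matrix (Window L N) (Window L N) ℝ :=
  Matrix.of fun j j' =>
    if StepRel N i j j' then gauge κ N i j * (κ ^ (2 * (j' : ℤ)) / gauge κ N (i + 1) j') else 0

/-- The admissible steps of a slice. -/
def SliceRel {L N : ℕ} (i : ℕ) (s s' : Slice L (Window L N)) : Prop :=
  if i < N then Interlaces s'.1 s.1 else Interlaces s.1 s'.1

open Classical in
-- Row and column factors leave the determinant; what remains is the staircase matrix of the step
-- relation.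
theorem det_step_submatrix (κ : ℝ) (L N i : ℕ) (s s' : Slice L (Window L N)) :
    ((step κ L N i).submatrix s.1 s'.1).det = if SliceRel i s s' then
      (∏ l, gauge κ N i (s.1 l)) * ∏ l, (κ ^ (2 * (s'.1 l : ℤ)) / gauge κ N (i + 1) (s'.1 l))
      else 0 := by
  have h : (step κ L N i).submatrix s.1 s'.1 = Matrix.of fun k m => gauge κ N i (s.1 k) *
      (Matrix.of fun k m => (κ ^ (2 * (s'.1 m : ℤ)) / gauge κ N (i + 1) (s'.1 m)) *
        (Matrix.of fun k m => if StepRel N i (s.1 k) (s'.1 m) then (1 : ℝ) else 0) k m) k m := by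
    ext k m
    simp only [step, Matrix.submatrix_apply, Matrix.of_apply]
    split_ifs <;> ring
  rw [h, Matrix.det_mul_column, Matrix.det_mul_row]
  have h2 : (Matrix.of fun k m => if StepRel N i (s.1 k) (s'.1 m) then (1 : ℝ) else 0).det =
      if SliceRel i s s' then 1 else 0 := by
    by_cases hi : i < N
    · simp only [StepRel, SliceRel, hi, if_true]
      rw [← Matrix.det_transpose, ← det_staircase s'.2 s.2]
      rfl
    · simp only [StepRel, SliceRel, hi, if_false]
      rw [← det_staircase s.2 s'.2]
      rfl
  rw [h2]
  split_ifs <;> ring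

section Marks

variable {r : ℕ} (c : ℝ)

open Classical in
theorem prod_one_add_indicator {ι : Type*} [Fintype ι] (p : ι → Prop)
    (hp : ∀ i j, p i → p j → i = j) :
    ∏ i, (1 + c * ind ℝ (p i)) = 1 + c * ind ℝ (∃ i, p i) := by
  by_cases h : ∃ i, p i
  · obtain ⟨i, hi⟩ := h
    rw [Finset.prod_eq_single i]
    · simp [ind, hi, show ∃ i, p i from ⟨i, hi⟩]
    · intro j _ hj
      have : ¬ p j := fun hpj => hj (hp j i hpj hi)
      simp [ind, this]
    · simp
  · push Not at h
    simp [ind, h]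

open Classical in
theorem one_add_sum_indicator {ι : Type*} [Fintype ι] (p : ι → Prop)
    (hp : ∀ i j, p i → p j → i = j) :
    1 + c * ∑ i, ind ℝ (p i) = ∏ i, (1 + c * ind ℝ (p i)) := by
  rw [prod_one_add_indicator c p hp]
  congr 2
  by_cases h : ∃ i, p i
  · obtain ⟨i, hi⟩ := h
    rw [Finset.sum_eq_single i]
    · simp [ind, hi, show ∃ i, p i from ⟨i, hi⟩]
    · intro j _ hj
      have : ¬ p j := fun hpj => hj (hp j i hpj hi)
      simp [ind, this]
    · simp
  · push Not at h
    simp [ind, h]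

open Classical in
-- The marks are distinct and a slice visits each position at most once, so at most one summand is
-- nonzero in each sum and the product regroups mark by mark.
theorem prod_marks {L n : ℕ} {P : Type*} [Preorder P] (s : ℕ → Slice L P) (σ : Fin r → ℕ)
    (pos : Fin r → P) (hσ : ∀ k, σ k < n) (hinj : Function.Injective fun k => (σ k, pos k)) :
    ∏ i : Fin n, ∏ l, (1 + c * ∑ k, ind ℝ (σ k = i ∧ pos k = (s (i + 1)).1 l)) =
      ∏ k, (1 + c * ind ℝ (∃ l, (s (σ k + 1)).1 l = pos k)) := by
  have h1 : ∀ (i : Fin n) (l : Fin L),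
      (1 + c * ∑ k, ind ℝ (σ k = i ∧ pos k = (s (i + 1)).1 l)) =
      ∏ k, (1 + c * ind ℝ (σ k = i ∧ pos k = (s (i + 1)).1 l)) := fun i l =>
    one_add_sum_indicator c (fun k => σ k = i ∧ pos k = (s (i + 1)).1 l) fun k k' h h' =>
      hinj (Prod.ext (h.1.trans h'.1.symm) (h.2.trans h'.2.symm))
  simp_rw [h1]
  rw [← Fintype.prod_prod_type', Finset.prod_comm]
  refine Finset.prod_congr rfl fun k _ => ?_
  rw [prod_one_add_indicator c
    (fun x : Fin n × Fin L => σ k = x.1 ∧ pos k = (s (x.1 + 1)).1 x.2)]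
  · congr 2
    refine congrArg (ind ℝ) (propext ?_)
    constructor
    · rintro ⟨⟨i, l⟩, h, h'⟩
      simp only at h h'
      exact ⟨l, by rw [h, h']⟩
    · rintro ⟨l, hl⟩
      exact ⟨(⟨σ k, hσ k⟩, l), rfl, hl.symm⟩
  · rintro ⟨i, l⟩ ⟨i', l'⟩ ⟨h, h2⟩ ⟨h', h2'⟩
    simp only at h h' h2 h2'
    have hi : i = i' := Fin.ext (h.symm.trans h')
    subst hi
    rw [Prod.mk.injEq]
    exact ⟨rfl, (s (i + 1)).2.injective (h2.symm.trans h2')⟩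

end Marks

section Vacuum

/-- The slice of the empty crystal. -/
def vacuum (L N : ℕ) : Slice L (Window L N) :=
  ⟨fun l => ⟨-(l : ℤ), by
    have := l.2
    simp only [Finset.mem_Ioc]
    omega⟩, fun a b h => by
    rw [Subtype.mk_lt_mk]
    have : (a : ℕ) < b := h
    omega⟩

theorem vacuum_apply (L N : ℕ) (l : Fin L) : (((vacuum L N).1 l : Window L N) : ℤ) = -(l : ℤ) := rfl

/-- The gauge cancels between consecutive slices. At the two vacuum ends line `l` keeps the factor
κ^((2N-1)l) κ^((2N+1)l) = κ^(4Nl), that is κ^(2l) for each of the `2N` slices, which is exactly the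
shift from positions to heights. -/
theorem prod_gauge_telescope {κ : ℝ} (hκ : κ ≠ 0) {L N : ℕ} (s : ℕ → Slice L (Window L N))
    (h0 : s 0 = vacuum L N) (hn : s (2 * N) = vacuum L N) :
    ∏ i : Fin (2 * N), ((∏ l, gauge κ N i ((s i).1 l)) *
        ∏ l, (κ ^ (2 * ((s (i + 1)).1 l : ℤ)) / gauge κ N (i + 1) ((s (i + 1)).1 l))) =
      ∏ i : Fin (2 * N), ∏ l : Fin L, κ ^ (2 * (((s (i + 1)).1 l : ℤ) + l)) := by
  have hg : ∀ i j, gauge κ N i j ≠ 0 := fun i j => zpow_ne_zero _ hκ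
  let g : ℕ → ℝ := fun i => ∏ l, gauge κ N i ((s i).1 l)
  have hg' : ∀ i, g i ≠ 0 := fun i => Finset.prod_ne_zero_iff.2 fun l _ => hg _ _
  have h1 : ∀ i : ℕ, ((∏ l, gauge κ N i ((s i).1 l)) *
        ∏ l, (κ ^ (2 * ((s (i + 1)).1 l : ℤ)) / gauge κ N (i + 1) ((s (i + 1)).1 l))) =
      (g i / g (i + 1)) * ∏ l, κ ^ (2 * ((s (i + 1)).1 l : ℤ)) := by
    intro i
    rw [Finset.prod_div_distrib]
    simp only [g]
    ring
  have h2 : ∀ i : ℕ, ∏ l : Fin L, κ ^ (2 * (((s (i + 1)).1 l : ℤ) + l)) =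
      (∏ l : Fin L, κ ^ (2 * (l : ℤ))) * ∏ l, κ ^ (2 * ((s (i + 1)).1 l : ℤ)) := by
    intro i
    rw [← Finset.prod_mul_distrib]
    refine Finset.prod_congr rfl fun l _ => ?_
    rw [← zpow_add₀ hκ]
    congr 1
    ring
  have h3 : ∏ i ∈ Finset.range (2 * N), g i / g (i + 1) =
      ∏ _i ∈ Finset.range (2 * N), ∏ l : Fin L, κ ^ (2 * (l : ℤ)) := by
    have h4 : ∏ i ∈ Finset.range (2 * N), g i / g (i + 1) = g 0 / g (2 * N) := by
      generalize 2 * N = n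
      induction n with
      | zero => simp [hg']
      | succ n ih =>
        rw [Finset.prod_range_succ, ih]
        field_simp [hg' n, hg' (n + 1)]
    rw [h4, Finset.prod_const, Finset.card_range, ← Finset.prod_pow]
    simp only [g]
    rw [h0, hn, ← Finset.prod_div_distrib]
    refine Finset.prod_congr rfl fun l _ => ?_
    simp only [gauge, vacuum_apply]
    rw [← zpow_sub₀ hκ, ← zpow_natCast, ← zpow_mul]
    congr 1
    push_cast
    ring
  simp_rw [h1, h2, Finset.prod_mul_distrib]
  congr 1
  rw [Finset.prod_range] at h3
  rw [h3, Finset.prod_range]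

end Vacuum

section Chains

/-- The chains of slices from the empty crystal to itself. -/
structure IsChain {L N : ℕ} (c : Fin (2 * N + 1) → Slice L (Window L N)) : Prop where
  first : c 0 = vacuum L N
  last : c (Fin.last _) = vacuum L N
  rel : ∀ i : Fin (2 * N), SliceRel i (c i.castSucc) (c i.succ)

open Classical in
theorem det_marked_eq_sum_chains {κ : ℝ} (hκ : κ ≠ 0) (L N : ℕ) {r : ℕ} (c : ℝ) (σ : Fin r → ℕ)
    (pos : Fin r → Window L N) (hσ : ∀ k, σ k < 2 * N)
    (hinj : Function.Injective fun k => (σ k, pos k)) :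
    ((transfer (markedLayer (step κ L N) c σ pos) 0 (2 * N)).submatrix
        (vacuum L N).1 (vacuum L N).1).det =
      ∑ s : Fin (2 * N + 1) → Slice L (Window L N), if IsChain s then
        (∏ i : Fin (2 * N), ∏ l : Fin L, κ ^ (2 * (((s i.succ).1 l : ℤ) + l))) *
        ∏ k, (1 + c * ind ℝ (∃ l, (s ⟨σ k + 1, by have := hσ k; omega⟩).1 l = pos k))
        else 0 := by
  rw [det_transfer_submatrix]
  refine Finset.sum_congr rfl fun s _ => ?_
  have hdet : ∀ i : Fin (2 * N), ((markedLayer (step κ L N) c σ pos i).submatrix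
      (s i.castSucc).1 (s i.succ).1).det =
      (∏ l, (1 + c * ∑ k, ind ℝ (σ k = i ∧ pos k = (s i.succ).1 l))) *
      ((step κ L N i).submatrix (s i.castSucc).1 (s i.succ).1).det := by
    intro i
    rw [← Matrix.det_mul_row]
    congr 1
    ext k m
    simp only [markedLayer, Matrix.submatrix_apply, Matrix.mul_diagonal, Matrix.of_apply]
    exact mul_comm _ _
  by_cases hs : IsChain s
  · rw [if_pos hs, if_pos ⟨hs.first, hs.last⟩]
    simp_rw [hdet, det_step_submatrix, if_pos (hs.rel _)]
    rw [Finset.prod_mul_distrib, mul_comm]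
    -- The chain is extended to all of `ℕ` so that neighbouring slices can be written with `i + 1`;
    -- the default value is never used.
    let t : ℕ → Slice L (Window L N) := fun i => if h : i < 2 * N + 1 then s ⟨i, h⟩ else vacuum L N
    have ht : ∀ i (h : i < 2 * N + 1), t i = s ⟨i, h⟩ := fun i h => dif_pos h
    have ht0 : t 0 = vacuum L N := by rw [ht 0 (by omega)]; exact hs.first
    have htn : t (2 * N) = vacuum L N := by rw [ht (2 * N) (by omega)]; exact hs.last
    have e1 : ∀ i : Fin (2 * N), s i.castSucc = t i := fun i => (ht i (by omega)).symm
    have e2 : ∀ i : Fin (2 * N), s i.succ = t (i + 1) := fun i => (ht (i + 1) (by omega)).symm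
    have e3 : ∀ k, s ⟨σ k + 1, by have := hσ k; omega⟩ = t (σ k + 1) := fun k =>
      (ht _ _).symm
    simp_rw [e1, e2, e3]
    rw [prod_gauge_telescope hκ t ht0 htn, prod_marks c t σ pos hσ hinj]
  · rw [if_neg hs]
    by_cases h : s 0 = vacuum L N ∧ s (Fin.last _) = vacuum L N
    · rw [if_pos h]
      have : ∃ i : Fin (2 * N), ¬ SliceRel i (s i.castSucc) (s i.succ) := by
        by_contra hcon
        push Not at hcon
        exact hs ⟨h.1, h.2, hcon⟩
      obtain ⟨i, hi⟩ := this
      refine Finset.prod_eq_zero (Finset.mem_univ i) ?_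
      rw [hdet, det_step_submatrix, if_neg hi, mul_zero]
    · rw [if_neg h]

end Chains

end FacetedCrystal

/-! ### Boxed crystals as chains of interlacing slices -/

namespace FacetedCrystal

/-- The point of the quadrant on the line `l` at time `t`. -/
def linePoint (l : ℕ) (t : ℤ) : ℕ × ℕ := (l + (-t).toNat, l + t.toNat)

theorem linePoint_self (x : ℕ × ℕ) : linePoint (min x.1 x.2) ((x.2 : ℤ) - x.1) = x := by
  ext <;> simp only [linePoint] <;> omega

theorem gradientLine_eq (h : Height) (l : ℕ) (t : ℤ) :
    gradientLine h l t = (h.1 (linePoint l t) : ℤ) - l := rfl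

/-- Crystals confined to a finite box. -/
structure InBox (L N : ℕ) (h : Height) : Prop where
  left : h.1 (0, N) = 0
  right : h.1 (N, 0) = 0
  diag : h.1 (L, L) = 0
  height : h.1 (0, 0) ≤ N

theorem Height.eq_zero_of_le {h : Height} {x y : ℕ × ℕ} (hx : h.1 x = 0) (hxy : x ≤ y) :
    h.1 y = 0 :=
  Nat.eq_zero_of_le_zero (hx ▸ h.2 hxy)

theorem InBox.eq_zero {L N : ℕ} {h : Height} (hb : InBox L N h) {x : ℕ × ℕ}
    (hx : N ≤ x.1 ∨ N ≤ x.2 ∨ (L ≤ x.1 ∧ L ≤ x.2)) : h.1 x = 0 := by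
  rcases hx with hx | hx | hx
  · exact Height.eq_zero_of_le hb.right ⟨hx, Nat.zero_le _⟩
  · exact Height.eq_zero_of_le hb.left ⟨Nat.zero_le _, hx⟩
  · exact Height.eq_zero_of_le hb.diag hx

theorem InBox.le {L N : ℕ} {h : Height} (hb : InBox L N h) (x : ℕ × ℕ) : h.1 x ≤ N :=
  (h.2 (show (0, 0) ≤ x from ⟨Nat.zero_le _, Nat.zero_le _⟩)).trans hb.height

theorem linePoint_mono {l l' : ℕ} (h : l ≤ l') (t : ℤ) : linePoint l t ≤ linePoint l' t :=
  ⟨Nat.add_le_add_right h _, Nat.add_le_add_right h _⟩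

/-- The slice of a boxed crystal at time `t`. -/
def sliceAt {L N : ℕ} (h : {h : Height // InBox L N h}) (t : ℤ) : Slice L (Window L N) :=
  ⟨fun l => ⟨gradientLine h.1 l t, by
    have h1 := h.2.le (linePoint l t)
    have h2 := l.2
    simp only [Finset.mem_Ioc, gradientLine_eq]
    omega⟩, fun a b hab => by
    rw [Subtype.mk_lt_mk, gradientLine_eq, gradientLine_eq]
    have h1 : (a : ℕ) < b := hab
    have h2 := h.1.2 (linePoint_mono h1.le t)
    have h3 : ((h.1).1 (linePoint b t) : ℤ) ≤ (h.1).1 (linePoint a t) := by exact_mod_cast h2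
    omega⟩

theorem sliceAt_apply {L N : ℕ} (h : {h : Height // InBox L N h}) (t : ℤ) (l : Fin L) :
    (((sliceAt h t).1 l : Window L N) : ℤ) = gradientLine h.1 l t := rfl

/-- The chain of slices of a boxed crystal. -/
def toChain {L N : ℕ} (h : {h : Height // InBox L N h}) (i : Fin (2 * N + 1)) :
    Slice L (Window L N) :=
  sliceAt h ((i : ℤ) - N)

theorem sliceAt_eq_vacuum {L N : ℕ} (h : {h : Height // InBox L N h}) {t : ℤ}
    (ht : t ≤ -N ∨ (N : ℤ) ≤ t) : sliceAt h t = vacuum L N := by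
  ext l
  rw [sliceAt_apply, vacuum_apply, gradientLine_eq, h.2.eq_zero]
  · simp
  · simp only [linePoint]; omega

/-- Neighbouring diagonals are joined by unit steps of the quadrant, so interlacing is monotonicity
of the height. The term `-l` in the position makes one of the two inequalities strict. -/
theorem isChain_toChain {L N : ℕ} (h : {h : Height // InBox L N h}) : IsChain (toChain h) := by
  refine ⟨sliceAt_eq_vacuum h (Or.inl (by simp)), sliceAt_eq_vacuum h (Or.inr (by simp; omega)),
    fun i => ?_⟩
  have hle : ∀ (l l' : ℕ) (t t' : ℤ), linePoint l t ≤ linePoint l' t' →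
      (h.1.1 (linePoint l' t') : ℤ) ≤ h.1.1 (linePoint l t) := fun l l' t t' hh => by
    exact_mod_cast h.1.2 hh
  -- Lines rise before time 0 and fall afterwards.
  have key : ∀ t : ℤ, (t < 0 → Interlaces (sliceAt h (t + 1)).1 (sliceAt h t).1) ∧
      (0 ≤ t → Interlaces (sliceAt h t).1 (sliceAt h (t + 1)).1) := by
    intro t
    refine ⟨fun ht => ⟨fun l => ?_, fun k l hkl => ?_⟩, fun ht => ⟨fun l => ?_, fun k l hkl => ?_⟩⟩
    · rw [← Subtype.coe_le_coe, sliceAt_apply, sliceAt_apply, gradientLine_eq, gradientLine_eq]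
      have := hle l l (t + 1) t ⟨by simp only [linePoint]; omega, by simp only [linePoint]; omega⟩
      omega
    · rw [← Subtype.coe_lt_coe, sliceAt_apply, sliceAt_apply, gradientLine_eq, gradientLine_eq]
      have hkl : (k : ℕ) < l := hkl
      have := hle k l t (t + 1)
        ⟨by simp only [linePoint]; omega, by simp only [linePoint]; omega⟩
      omega
    · rw [← Subtype.coe_le_coe, sliceAt_apply, sliceAt_apply, gradientLine_eq, gradientLine_eq]
      have := hle l l t (t + 1) ⟨by simp only [linePoint]; omega, by simp only [linePoint]; omega⟩
      omega
    · rw [← Subtype.coe_lt_coe, sliceAt_apply, sliceAt_apply, gradientLine_eq, gradientLine_eq]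
      have hkl : (k : ℕ) < l := hkl
      have := hle k l (t + 1) t
        ⟨by simp only [linePoint]; omega, by simp only [linePoint]; omega⟩
      omega
  have hs : toChain h i.succ = sliceAt h (((i : ℤ) - N) + 1) := by
    simp only [toChain, Fin.val_succ]
    congr 1
    push_cast
    ring
  have hc : toChain h i.castSucc = sliceAt h ((i : ℤ) - N) := rfl
  rw [hs, hc, SliceRel]
  split_ifs with hi
  · exact (key _).1 (by omega)
  · exact (key _).2 (by omega)

theorem toChain_injective (L N : ℕ) : Function.Injective (toChain (L := L) (N := N)) := by
  intro h h' hh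
  apply Subtype.ext
  apply Subtype.ext
  ext x
  by_cases hx : N ≤ x.1 ∨ N ≤ x.2 ∨ (L ≤ x.1 ∧ L ≤ x.2)
  · rw [h.2.eq_zero hx, h'.2.eq_zero hx]
  · push Not at hx
    have h1 : min x.1 x.2 < L := by omega
    have h2 := congrFun hh ⟨(((x.2 : ℤ) - x.1) + N).toNat, by omega⟩
    have h3 : ((((((x.2 : ℤ) - x.1) + N).toNat : ℕ) : ℤ) - N) = (x.2 : ℤ) - x.1 := by omega
    have h4 := congrArg (fun s : Slice L (Window L N) => ((s.1 ⟨min x.1 x.2, h1⟩ : Window L N) : ℤ)) h2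
    simp only [toChain, sliceAt_apply, h3, gradientLine_eq, linePoint_self] at h4
    omega

theorem antitone_of_steps {f : ℕ × ℕ → ℕ} (h1 : ∀ i j, f (i + 1, j) ≤ f (i, j))
    (h2 : ∀ i j, f (i, j + 1) ≤ f (i, j)) : Antitone f := by
  rintro ⟨i, j⟩ ⟨i', j'⟩ ⟨hi, hj⟩
  have e1 : Antitone fun i => f (i, j') := antitone_nat_of_succ_le fun i => h1 i j'
  have e2 : Antitone fun j => f (i, j) := antitone_nat_of_succ_le fun j => h2 i j
  exact (e1 hi).trans (e2 hj)

/-- The last line lies above `-L` and each earlier line is at least one higher. Hence the `toNat` in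
`chainHeight` loses nothing. -/
theorem slice_ge {L N : ℕ} (s : Slice L (Window L N)) (l : Fin L) : -(l : ℤ) ≤ (s.1 l : ℤ) := by
  have h : ∀ n : ℕ, ∀ l : Fin L, (l : ℕ) + n + 1 = L → -(l : ℤ) ≤ (s.1 l : ℤ) := by
    intro n
    induction n with
    | zero =>
      intro l hl
      have := (Finset.mem_Ioc.1 (s.1 l).2).1
      omega
    | succ n ih =>
      intro l hl
      have h1 := ih ⟨l + 1, by omega⟩ (by simp only; omega)
      have h2 : s.1 ⟨l + 1, by omega⟩ < s.1 l := s.2 (show (l : ℕ) < l + 1 by omega)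
      rw [← Subtype.coe_lt_coe] at h2
      push_cast at h1
      omega
  exact h (L - 1 - l) l (by have := l.2; omega)

open Classical in
/-- The height function with prescribed slices. -/
noncomputable def chainHeight {L N : ℕ} (c : Fin (2 * N + 1) → Slice L (Window L N))
    (x : ℕ × ℕ) : ℕ :=
  if hx : min x.1 x.2 < L ∧ x.1 ≤ x.2 + N ∧ x.2 ≤ x.1 + N then
    (((c ⟨x.2 + N - x.1, by omega⟩).1 ⟨min x.1 x.2, hx.1⟩ : ℤ) + min x.1 x.2).toNat else 0

theorem chainHeight_of {L N : ℕ} (c : Fin (2 * N + 1) → Slice L (Window L N)) (x : ℕ × ℕ)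
    (i : Fin (2 * N + 1)) (l : Fin L) (hi : (i : ℕ) + x.1 = x.2 + N) (hl : (l : ℕ) = min x.1 x.2) :
    (chainHeight c x : ℤ) = (((c i).1 l : Window L N) : ℤ) + l := by
  have hx : min x.1 x.2 < L ∧ x.1 ≤ x.2 + N ∧ x.2 ≤ x.1 + N := by
    have := i.2; have := l.2; omega
  have e1 : (⟨x.2 + N - x.1, by omega⟩ : Fin (2 * N + 1)) = i := Fin.ext (by simp only; omega)
  have e2 : (⟨min x.1 x.2, hx.1⟩ : Fin L) = l := Fin.ext hl.symm
  rw [chainHeight, dif_pos hx, e1, e2]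
  have := slice_ge (c i) l
  rw [← hl]
  omega

theorem chainHeight_of_not {L N : ℕ} (c : Fin (2 * N + 1) → Slice L (Window L N)) {x : ℕ × ℕ}
    (hx : ¬ (min x.1 x.2 < L ∧ x.1 ≤ x.2 + N ∧ x.2 ≤ x.1 + N)) : chainHeight c x = 0 :=
  dif_neg hx

theorem chainHeight_boundary {L N : ℕ} {c : Fin (2 * N + 1) → Slice L (Window L N)}
    (hc : IsChain c) {x : ℕ × ℕ} (hx : x.1 = x.2 + N ∨ x.2 = x.1 + N) : chainHeight c x = 0 := by
  by_cases hl : min x.1 x.2 < L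
  · rcases hx with hx | hx
    · have := chainHeight_of c x 0 ⟨_, hl⟩ (by simp; omega) rfl
      rw [hc.first, vacuum_apply] at this
      simp only at this
      omega
    · have := chainHeight_of c x (Fin.last _) ⟨_, hl⟩ (by simp; omega) rfl
      rw [hc.last, vacuum_apply] at this
      simp only at this
      omega
  · exact chainHeight_of_not c (by tauto)

/-- A unit step of the quadrant leads to a neighbouring diagonal. Either the label is kept and the
weak inequality applies, or the label changes by one and the strict inequality absorbs the change of
`+ l` in the height. -/
theorem antitone_chainHeight {L N : ℕ} {c : Fin (2 * N + 1) → Slice L (Window L N)}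
    (hc : IsChain c) : Antitone (chainHeight c) := by
  have hleft : ∀ (k : ℕ) (hk : k < N) (l m : Fin L), (m : ℕ) = l + 1 ∨ m = l →
      (((c ⟨k, by omega⟩).1 l : Window L N) : ℤ) ≤ (c ⟨k + 1, by omega⟩).1 l ∧
      ((m : ℕ) = l + 1 → (((c ⟨k + 1, by omega⟩).1 m : Window L N) : ℤ) < (c ⟨k, by omega⟩).1 l) := by
    intro k hk l m hm
    have := hc.rel ⟨k, by omega⟩
    simp only [SliceRel, hk, if_true] at this
    refine ⟨Subtype.coe_le_coe.2 (this.1 l), fun h => Subtype.coe_lt_coe.2 (this.2 l m ?_)⟩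
    rw [Fin.lt_def]; omega
  have hright : ∀ (k : ℕ) (hk : N ≤ k) (hk' : k < 2 * N) (l m : Fin L), (m : ℕ) = l + 1 ∨ m = l →
      (((c ⟨k + 1, by omega⟩).1 l : Window L N) : ℤ) ≤ (c ⟨k, by omega⟩).1 l ∧
      ((m : ℕ) = l + 1 → (((c ⟨k, by omega⟩).1 m : Window L N) : ℤ) < (c ⟨k + 1, by omega⟩).1 l) := by
    intro k hk hk' l m hm
    have := hc.rel ⟨k, by omega⟩
    simp only [SliceRel, hk.not_gt, if_false] at this
    refine ⟨Subtype.coe_le_coe.2 (this.1 l), fun h => Subtype.coe_lt_coe.2 (this.2 l m ?_)⟩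
    rw [Fin.lt_def]; omega
  refine antitone_of_steps (fun i j => ?_) (fun i j => ?_)
  · by_cases hx : min (i + 1) j < L ∧ i + 1 ≤ j + N ∧ j ≤ i + 1 + N
    swap
    · rw [chainHeight_of_not c hx]; exact Nat.zero_le _
    obtain ⟨h1, h2, h3⟩ := hx
    by_cases h4 : j = i + 1 + N
    · rw [chainHeight_boundary hc (Or.inr h4)]; exact Nat.zero_le _
    have e1 := chainHeight_of c (i + 1, j) ⟨j + N - (i + 1), by omega⟩ ⟨_, h1⟩
      (by simp only; omega) rfl
    have e2 := chainHeight_of c (i, j) ⟨j + N - (i + 1) + 1, by omega⟩ ⟨min i j, by omega⟩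
      (by simp only; omega) rfl
    by_cases hij : j ≤ i
    · have := (hleft (j + N - (i + 1)) (by omega) ⟨min i j, by omega⟩ ⟨min (i + 1) j, h1⟩
        (Or.inr (Fin.ext (by simp only; omega)))).1
      have e3 : (⟨min i j, by omega⟩ : Fin L) = ⟨min (i + 1) j, h1⟩ := Fin.ext (by simp only; omega)
      rw [e3] at this e2
      omega
    · have := (hright (j + N - (i + 1)) (by omega) (by omega) ⟨min i j, by omega⟩
        ⟨min (i + 1) j, h1⟩ (Or.inl (by simp only; omega))).2 (by simp only; omega)
      simp only at e1 e2
      omega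
  · by_cases hx : min i (j + 1) < L ∧ i ≤ j + 1 + N ∧ j + 1 ≤ i + N
    swap
    · rw [chainHeight_of_not c hx]; exact Nat.zero_le _
    obtain ⟨h1, h2, h3⟩ := hx
    by_cases h4 : i = j + 1 + N
    · rw [chainHeight_boundary hc (Or.inl h4)]; exact Nat.zero_le _
    have e1 := chainHeight_of c (i, j + 1) ⟨j + N - i + 1, by omega⟩ ⟨_, h1⟩
      (by simp only; omega) rfl
    have e2 := chainHeight_of c (i, j) ⟨j + N - i, by omega⟩ ⟨min i j, by omega⟩
      (by simp only; omega) rfl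
    by_cases hij : i ≤ j
    · have := (hright (j + N - i) (by omega) (by omega) ⟨min i j, by omega⟩
        ⟨min i (j + 1), h1⟩ (Or.inr (Fin.ext (by simp only; omega)))).1
      have e3 : (⟨min i j, by omega⟩ : Fin L) = ⟨min i (j + 1), h1⟩ := Fin.ext (by simp only; omega)
      rw [e3] at this e2
      omega
    · have := (hleft (j + N - i) (by omega) ⟨min i j, by omega⟩
        ⟨min i (j + 1), h1⟩ (Or.inl (by simp only; omega))).2 (by simp only; omega)
      simp only at e1 e2
      omega

theorem exists_toChain_eq {L N : ℕ} {c : Fin (2 * N + 1) → Slice L (Window L N)}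
    (hc : IsChain c) : ∃ h, toChain h = c := by
  have hfin : (Function.support (chainHeight c)).Finite := by
    refine (Set.finite_Iic ((L + N, L + N) : ℕ × ℕ)).subset fun x hx => ?_
    by_contra hcon
    refine hx (chainHeight_of_not c fun h => hcon ?_)
    exact ⟨by simp only; omega, by simp only; omega⟩
  let f : ℕ × ℕ →₀ ℕ := Finsupp.ofSupportFinite (chainHeight c) hfin
  have hf : ∀ x, f x = chainHeight c x := fun x => rfl
  refine ⟨⟨⟨f, antitone_chainHeight hc⟩, ⟨?_, ?_, ?_, ?_⟩⟩, ?_⟩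
  · exact chainHeight_boundary hc (Or.inr (by simp))
  · exact chainHeight_boundary hc (Or.inl (by simp))
  · exact chainHeight_of_not c (by simp)
  · by_cases hL : 0 < L
    · have h1 := chainHeight_of c (0, 0) ⟨N, by omega⟩ ⟨0, hL⟩ (by simp) (by simp)
      have h2 := (Finset.mem_Ioc.1 ((c ⟨N, by omega⟩).1 ⟨0, hL⟩).2).2
      have h3 : f (0, 0) = chainHeight c (0, 0) := rfl
      simp only at h1 ⊢
      rw [h3]
      push_cast at h1
      omega
    · have h3 : f (0, 0) = chainHeight c (0, 0) := rfl
      rw [chainHeight_of_not c (by omega)] at h3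
      simp only
      omega
  · ext i l
    rw [toChain, sliceAt_apply, gradientLine_eq]
    have h1 := chainHeight_of c (linePoint l ((i : ℤ) - N)) i l
      (by simp only [linePoint]; omega) (by simp only [linePoint]; omega)
    change ((chainHeight c (linePoint l ((i : ℤ) - N)) : ℕ) : ℤ) - l = _
    omega

noncomputable instance (L N : ℕ) : Fintype {h : Height // InBox L N h} :=
  Fintype.ofInjective _ (toChain_injective L N)

/-- Every point of the support lies on exactly one line at one time. Slice 0 may be left out, since
it is the vacuum, of height zero. -/
theorem volume_eq_sum {L N : ℕ} (h : {h : Height // InBox L N h}) :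
    (volume h.1 : ℤ) = ∑ i : Fin (2 * N), ∑ l : Fin L, ((((toChain h i.succ).1 l : Window L N) : ℤ) + l) := by
  have h1 : ∀ (i : Fin (2 * N)) (l : Fin L), (((toChain h i.succ).1 l : Window L N) : ℤ) + l =
      (h.1.1 (linePoint l ((i : ℤ) + 1 - N)) : ℤ) := by
    intro i l
    rw [toChain, sliceAt_apply, gradientLine_eq]
    simp
  simp_rw [h1]
  rw [← Fintype.sum_prod_type']
  classical
  let e : Fin (2 * N) × Fin L → ℕ × ℕ := fun x => linePoint x.2 ((x.1 : ℤ) + 1 - N)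
  have he : Function.Injective e := by
    rintro ⟨i, l⟩ ⟨i', l'⟩ hh
    simp only [e, linePoint, Prod.mk.injEq] at hh
    ext
    · simp only; omega
    · simp only; omega
  have hs : h.1.1.support ⊆ Finset.univ.image e := by
    intro x hx
    have hx' : ¬ (N ≤ x.1 ∨ N ≤ x.2 ∨ (L ≤ x.1 ∧ L ≤ x.2)) := fun hh =>
      Finsupp.mem_support_iff.1 hx (h.2.eq_zero hh)
    push Not at hx'
    rw [Finset.mem_image]
    refine ⟨(⟨x.2 + N - x.1 - 1, by omega⟩, ⟨min x.1 x.2, by omega⟩), Finset.mem_univ _, ?_⟩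
    refine Eq.trans ?_ (linePoint_self x)
    simp only [e]
    congr 1
    omega
  rw [volume, Finsupp.sum_of_support_subset _ hs _ (fun _ _ => rfl), Finset.sum_image he.injOn]
  push_cast
  rfl

theorem prod_zpow_eq_zpow_sum {κ : ℝ} (hκ : κ ≠ 0) {ι : Type*} (s : Finset ι) (f : ι → ℤ) :
    ∏ i ∈ s, κ ^ f i = κ ^ ∑ i ∈ s, f i := by
  classical
  induction s using Finset.induction_on with
  | empty => simp
  | insert a s ha ih => rw [Finset.prod_insert ha, Finset.sum_insert ha, zpow_add₀ hκ, ih]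

open Classical in
-- Boxed crystals correspond bijectively to chains under `toChain`, so the marked determinant is the
-- generating function of the occupation numbers at the marks.
theorem sum_box_eq_det {κ : ℝ} (hκ : κ ≠ 0) (L N : ℕ) {r : ℕ} (c : ℝ) (σ : Fin r → ℕ)
    (pos : Fin r → Window L N) (hσ : ∀ k, σ k < 2 * N)
    (hinj : Function.Injective fun k => (σ k, pos k)) :
    ∑ h : {h : Height // InBox L N h}, κ ^ (2 * volume h.1) *
        ∏ k, (1 + c * ind ℝ (∃ l : Fin L, gradientLine h.1 l ((σ k : ℤ) + 1 - N) = pos k)) =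
      ((transfer (markedLayer (step κ L N) c σ pos) 0 (2 * N)).submatrix
        (vacuum L N).1 (vacuum L N).1).det := by
  rw [det_marked_eq_sum_chains hκ L N c σ pos hσ hinj]
  refine Finset.sum_of_injOn toChain (toChain_injective L N).injOn (fun _ _ => Finset.mem_coe.2 (Finset.mem_univ _))
    (fun s _ hs => ?_) (fun h _ => ?_)
  · refine if_neg fun hc => hs ?_
    obtain ⟨h, rfl⟩ := exists_toChain_eq hc
    exact ⟨h, by simp, rfl⟩
  · rw [if_pos (isChain_toChain h)]
    congr 1
    · simp_rw [prod_zpow_eq_zpow_sum hκ, ← Finset.mul_sum]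
      rw [← volume_eq_sum h]
      rw [← zpow_natCast]
      norm_cast
    · refine Finset.prod_congr rfl fun k _ => ?_
      congr 2
      refine congrArg (ind ℝ) (propext (exists_congr fun l => ?_))
      rw [← Subtype.coe_inj, toChain, sliceAt_apply]
      simp

end FacetedCrystal

namespace FacetedCrystal

/-! ### Correlation functions in a box -/

section BoxMoments

/-- The partition function of the boxed crystal. -/
noncomputable def boxGram (κ : ℝ) (L N : ℕ) : Matrix (Fin L) (Fin L) ℝ :=
  (transfer (step κ L N) 0 (2 * N)).submatrix (vacuum L N).1 (vacuum L N).1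

theorem sum_box_eq_det_boxGram {κ : ℝ} (hκ : κ ≠ 0) (L N : ℕ) :
    ∑ h : {h : Height // InBox L N h}, κ ^ (2 * volume h.1) = (boxGram κ L N).det := by
  have h := sum_box_eq_det hκ L N (r := 0) 0 Fin.elim0 Fin.elim0 (fun k => k.elim0)
    (fun k => k.elim0)
  simp only [Finset.univ_eq_empty, Finset.prod_empty, mul_one] at h
  rw [h, boxGram]
  congr 3
  ext i a b
  simp [markedLayer]

/-- The empty crystal. -/
def emptyHeight : Height := ⟨0, fun _ _ _ => le_rfl⟩

/-- The empty crystal contributes 1 to a sum of positive terms. The bound is uniform in the box and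
so keeps the Gram matrix invertible in the limit. -/
theorem one_le_det_boxGram {κ : ℝ} (hκ : 0 < κ) (L N : ℕ) : 1 ≤ (boxGram κ L N).det := by
  rw [← sum_box_eq_det_boxGram hκ.ne']
  have h0 : InBox L N emptyHeight := ⟨rfl, rfl, rfl, Nat.zero_le _⟩
  have := Finset.single_le_sum (f := fun h : {h : Height // InBox L N h} => κ ^ (2 * volume h.1))
    (fun h _ => (pow_pos hκ _).le) (Finset.mem_univ ⟨emptyHeight, h0⟩)
  refine le_trans (le_of_eq ?_) this
  simp [volume, emptyHeight]

/-- The marked determinant generates products of 1 + c η. With c = 1/ε and both sides multiplied by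
ε^r, they become continuous functions of ε, and ε → 0 isolates the product of the η. -/
theorem sum_box_prod_eq {κ : ℝ} (hκ : 0 < κ) (L N : ℕ) {r : ℕ} (σ : Fin r → ℕ)
    (pos : Fin r → Window L N) (hσ : ∀ k, σ k < 2 * N)
    (hinj : Function.Injective fun k => (σ k, pos k)) :
    ∑ h : {h : Height // InBox L N h}, κ ^ (2 * volume h.1) *
        ∏ k, ind ℝ (∃ l : Fin L, gradientLine h.1 l ((σ k : ℤ) + 1 - N) = pos k) =
      (boxGram κ L N).det *
        (layerKernel (step κ L N) (2 * N) (vacuum L N).1 σ pos).det := by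
  let η : {h : Height // InBox L N h} → Fin r → ℝ := fun h k =>
    ind ℝ (∃ l : Fin L, gradientLine h.1 l ((σ k : ℤ) + 1 - N) = pos k)
  let K := layerKernel (step κ L N) (2 * N) (vacuum L N).1 σ pos
  have h1 : ∀ ε : ℝ, ε ≠ 0 →
      ∑ h : {h : Height // InBox L N h}, κ ^ (2 * volume h.1) * ∏ k, (ε + η h k) =
      (boxGram κ L N).det * (ε • (1 : Matrix (Fin r) (Fin r) ℝ) + K).det := by
    intro ε hε
    have h2 := sum_box_eq_det hκ.ne' L N ε⁻¹ σ pos hσ hinj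
    rw [det_transfer_markedLayer _ _ _ _ _ hσ
      ((one_le_det_boxGram hκ L N).trans_lt' one_pos).ne'] at h2
    have h3 : ε • (1 : Matrix (Fin r) (Fin r) ℝ) + K = ε • (1 + ε⁻¹ • K) := by
      rw [smul_add, smul_smul, mul_inv_cancel₀ hε, one_smul]
    rw [h3, Matrix.det_smul, Fintype.card_fin, mul_left_comm]
    change _ = ε ^ r * ((boxGram κ L N).det * (1 + ε⁻¹ • K).det)
    rw [show (boxGram κ L N).det * (1 + ε⁻¹ • K).det = _ from h2.symm, Finset.mul_sum]
    refine Finset.sum_congr rfl fun h _ => ?_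
    have h4 : ∏ k, (ε + η h k) = ε ^ r * ∏ k, (1 + ε⁻¹ * η h k) := by
      rw [show ε ^ r = ∏ _k : Fin r, ε by simp, ← Finset.prod_mul_distrib]
      refine Finset.prod_congr rfl fun k _ => ?_
      rw [mul_add, mul_one, ← mul_assoc, mul_inv_cancel₀ hε, one_mul]
    rw [h4]
    ring
  have c1 : Continuous fun ε : ℝ =>
      ∑ h : {h : Height // InBox L N h}, κ ^ (2 * volume h.1) * ∏ k, (ε + η h k) := by fun_prop
  have c2 : Continuous fun ε : ℝ =>
      (boxGram κ L N).det * (ε • (1 : Matrix (Fin r) (Fin r) ℝ) + K).det := by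
    refine continuous_const.mul (Continuous.matrix_det ?_)
    fun_prop
  have h2 := tendsto_nhds_unique_of_eventuallyEq
    ((c1.tendsto 0).mono_left (nhdsWithin_le_nhds (s := {0}ᶜ)))
    ((c2.tendsto 0).mono_left nhdsWithin_le_nhds)
    (by filter_upwards [self_mem_nhdsWithin] with ε hε using h1 ε hε)
  simpa using h2

end BoxMoments

/-! ### One-line transfer matrices as coefficients of power series -/

section Coefficients

/-- The coefficients of a power series, extended by zero to negative indices. -/
noncomputable def zcoeff (A : PowerSeries ℝ) (k : ℤ) : ℝ :=
  if 0 ≤ k then PowerSeries.coeff k.toNat A else 0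

theorem zcoeff_of_neg (A : PowerSeries ℝ) {k : ℤ} (hk : k < 0) : zcoeff A k = 0 :=
  if_neg hk.not_ge

theorem zcoeff_natCast (A : PowerSeries ℝ) (k : ℕ) : zcoeff A k = PowerSeries.coeff k A := by
  simp [zcoeff]

/-- The nonzero terms of the convolution have `w` between `p` and `p'`, hence in the window: on one
side of the corner, truncation costs nothing. -/
theorem sum_window_zcoeff_mul {L N : ℕ} (A B : PowerSeries ℝ) (p p' : Window L N) :
    ∑ w : Window L N, zcoeff A ((w : ℤ) - p) * zcoeff B ((p' : ℤ) - w) =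
      zcoeff (A * B) ((p' : ℤ) - p) := by
  by_cases hp : (p' : ℤ) < p
  · rw [zcoeff_of_neg _ (by omega)]
    refine Finset.sum_eq_zero fun w _ => ?_
    by_cases hw : (w : ℤ) < p
    · rw [zcoeff_of_neg _ (by omega), zero_mul]
    · rw [zcoeff_of_neg B (by omega), mul_zero]
  · obtain ⟨n, hn⟩ := Int.eq_ofNat_of_zero_le (show 0 ≤ (p' : ℤ) - p by omega)
    rw [hn, zcoeff_natCast, PowerSeries.coeff_mul]
    symm
    have hp1 := Finset.mem_Ioc.1 p.2
    have hp2 := Finset.mem_Ioc.1 p'.2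
    have hmem : ∀ x : ℕ × ℕ, x ∈ Finset.HasAntidiagonal.antidiagonal n → (p : ℤ) + x.1 ∈
        Finset.Ioc (-(L : ℤ)) (N : ℤ) := by
      intro x hx
      rw [Finset.HasAntidiagonal.mem_antidiagonal] at hx
      rw [Finset.mem_Ioc]
      omega
    refine Finset.sum_bij_ne_zero (fun x hx _ => ⟨(p : ℤ) + x.1, hmem x hx⟩) (fun _ _ _ => Finset.mem_univ _) ?_ ?_ ?_
    · intro x hx _ y hy _ hxy
      rw [Subtype.mk.injEq] at hxy
      rw [Finset.HasAntidiagonal.mem_antidiagonal] at hx hy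
      ext <;> omega
    · intro w _ hw
      have h1 : 0 ≤ (w : ℤ) - p := by
        by_contra h
        exact hw (by rw [zcoeff_of_neg _ (not_le.1 h), zero_mul])
      have h2 : 0 ≤ (p' : ℤ) - w := by
        by_contra h
        exact hw (by rw [zcoeff_of_neg B (not_le.1 h), mul_zero])
      refine ⟨(((w : ℤ) - p).toNat, ((p' : ℤ) - w).toNat), ?_, ?_, ?_⟩
      · rw [Finset.HasAntidiagonal.mem_antidiagonal]; omega
      · have e1 : ((w : ℤ) - p) = (((w : ℤ) - p).toNat : ℕ) := by omega
        have e2 : ((p' : ℤ) - w) = (((p' : ℤ) - w).toNat : ℕ) := by omega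
        rw [e1, e2, zcoeff_natCast, zcoeff_natCast] at hw
        exact hw
      · ext
        simp only
        omega
    · intro x hx _
      rw [Finset.HasAntidiagonal.mem_antidiagonal] at hx
      have e1 : (p : ℤ) + x.1 - p = (x.1 : ℤ) := by ring
      have e2 : (p' : ℤ) - (p + x.1) = (x.2 : ℤ) := by omega
      rw [e1, e2, zcoeff_natCast, zcoeff_natCast]

/-- The generating function of the complete homogeneous polynomials in `κ ^ (2 i + 1)`,
`a ≤ i < b`. -/
noncomputable def homogeneousSeries (κ : ℝ) (a b : ℕ) : PowerSeries ℝ :=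
  ∏ i ∈ Finset.Ico a b, PowerSeries.mk fun k => (κ ^ (2 * i + 1)) ^ k

theorem homogeneousSeries_self (κ : ℝ) (a : ℕ) : homogeneousSeries κ a a = 1 := by
  simp [homogeneousSeries]

theorem zcoeff_one_sub {L N : ℕ} (p p' : Window L N) :
    zcoeff 1 ((p' : ℤ) - p) = (1 : Matrix (Window L N) (Window L N) ℝ) p p' := by
  by_cases h : p = p'
  · subst h
    simp [zcoeff]
  · rw [Matrix.one_apply_ne h]
    have h' : (p : ℤ) ≠ p' := fun h' => h (Subtype.ext h')
    rw [zcoeff]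
    split_ifs with h2
    · rw [PowerSeries.coeff_one, if_neg]
      omega
    · rfl

/-- This is the purpose of the gauge: the weight κ^(2j') turns into a function of j' - j, so the
steps are Toeplitz and their products are products of power series. -/
theorem step_eq_of_lt {κ : ℝ} (hκ : κ ≠ 0) {L N i : ℕ} (hi : i < N) (p p' : Window L N) :
    step κ L N i p p' =
      zcoeff (PowerSeries.mk fun k => (κ ^ (2 * (N - 1 - i) + 1)) ^ k) ((p' : ℤ) - p) := by
  simp only [step, Matrix.of_apply, StepRel, hi, if_true, zcoeff, sub_nonneg, gauge]
  split_ifs with h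
  · rw [PowerSeries.coeff_mk, ← mul_div_assoc, ← zpow_add₀ hκ, ← zpow_sub₀ hκ, ← pow_mul,
      ← zpow_natCast]
    congr 1
    push_cast
    rw [Int.toNat_of_nonneg (by omega)]
    have : (((N - 1 - i : ℕ) : ℕ) : ℤ) = N - 1 - i := by omega
    rw [this]
    ring
  · rfl

theorem step_eq_of_ge {κ : ℝ} (hκ : κ ≠ 0) {L N i : ℕ} (hi : N ≤ i) (p p' : Window L N) :
    step κ L N i p p' =
      zcoeff (PowerSeries.mk fun k => (κ ^ (2 * (i - N) + 1)) ^ k) ((p : ℤ) - p') := by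
  simp only [step, Matrix.of_apply, StepRel, hi.not_gt, if_false, zcoeff, sub_nonneg, gauge]
  split_ifs with h
  · rw [PowerSeries.coeff_mk, ← mul_div_assoc, ← zpow_add₀ hκ, ← zpow_sub₀ hκ, ← pow_mul,
      ← zpow_natCast]
    congr 1
    push_cast
    rw [Int.toNat_of_nonneg (by omega)]
    have : (((i - N : ℕ) : ℕ) : ℤ) = i - N := by omega
    rw [this]
    ring
  · rfl

theorem transfer_left {κ : ℝ} (hκ : κ ≠ 0) {L N a b : ℕ} (hab : a ≤ b) (hb : b ≤ N)
    (p p' : Window L N) : transfer (step κ L N) (N - b) (N - a) p p' =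
      zcoeff (homogeneousSeries κ a b) ((p' : ℤ) - p) := by
  obtain ⟨n, rfl⟩ := Nat.exists_eq_add_of_le hab
  clear hab
  induction n generalizing a p' with
  | zero => rw [add_zero, transfer_of_le _ le_rfl, homogeneousSeries_self, zcoeff_one_sub]
  | succ n ih =>
    have e1 : N - a = (N - (a + 1)) + 1 := by omega
    have e2 : a + (n + 1) = (a + 1) + n := by ring
    rw [e2] at hb ⊢
    rw [e1, transfer_succ _ (by omega), Matrix.mul_apply]
    simp_rw [fun w => ih w hb, step_eq_of_lt hκ (show N - (a + 1) < N by omega)]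
    rw [sum_window_zcoeff_mul, mul_comm]
    have e3 : N - 1 - (N - (a + 1)) = a := by omega
    rw [e3, homogeneousSeries, homogeneousSeries,
      Finset.prod_eq_prod_Ico_succ_bot (show a < a + 1 + n by omega)]

theorem transfer_right {κ : ℝ} (hκ : κ ≠ 0) {L N a b : ℕ} (hab : a ≤ b)
    (p p' : Window L N) : transfer (step κ L N) (N + a) (N + b) p p' =
      zcoeff (homogeneousSeries κ a b) ((p : ℤ) - p') := by
  induction b, hab using Nat.le_induction generalizing p' with
  | base =>
    rw [transfer_of_le _ le_rfl, homogeneousSeries_self, zcoeff_one_sub, Matrix.one_apply,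
      Matrix.one_apply]
    simp [eq_comm]
  | succ b hb ih =>
    rw [← add_assoc, transfer_succ _ (by omega), Matrix.mul_apply]
    simp_rw [ih, step_eq_of_ge hκ (show N ≤ N + b by omega)]
    have e : homogeneousSeries κ a (b + 1) =
        (PowerSeries.mk fun k => (κ ^ (2 * b + 1)) ^ k) * homogeneousSeries κ a b := by
      rw [homogeneousSeries, Finset.prod_Ico_succ_top hb, mul_comm, ← homogeneousSeries]
    rw [e, ← sum_window_zcoeff_mul]
    refine Finset.sum_congr rfl fun w _ => ?_
    rw [mul_comm, Nat.add_sub_cancel_left]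

/-- Through the central slice the truncation is felt: both factors bound `w` only from below, and
the window cuts the sum off at height `N`. -/
theorem transfer_mixed {κ : ℝ} (hκ : κ ≠ 0) {L N a b : ℕ} (ha : a ≤ N)
    (p p' : Window L N) : transfer (step κ L N) (N - a) (N + b) p p' =
      ∑ w : Window L N, zcoeff (homogeneousSeries κ 0 a) ((w : ℤ) - p) *
        zcoeff (homogeneousSeries κ 0 b) ((w : ℤ) - p') := by
  rw [← transfer_mul_transfer _ (show N - a ≤ N by omega) (show N ≤ N + b by omega),
    Matrix.mul_apply]
  refine Finset.sum_congr rfl fun w _ => ?_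
  have h1 := transfer_left hκ (Nat.zero_le a) ha p w
  have h2 := transfer_right hκ (Nat.zero_le b) w p'
  rw [Nat.sub_zero] at h1
  rw [add_zero] at h2
  rw [h1, h2]

end Coefficients

end FacetedCrystal

namespace FacetedCrystal

/-! ### Fourier coefficients on the unit circle -/

section Fourier

open Real in
instance fact_two_pi_pos : Fact (0 < 2 * π) := ⟨Real.two_pi_pos⟩

/-- The unit circle in the plane. -/
abbrev unitCircle : Set ℂ := Metric.sphere (0 : ℂ) 1

/-- The average over the unit circle. -/
noncomputable def avg (G : ℂ → ℂ) : ℂ := Real.circleAverage G 0 1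

/-- The Fourier coefficients on the unit circle. -/
noncomputable def cf (G : ℂ → ℂ) (n : ℤ) : ℂ := avg fun z => z ^ (-n) * G z

/-- The parametrization of the unit circle by angles. -/
noncomputable def circ (x : AddCircle (2 * Real.pi)) : ℂ := (AddCircle.toCircle x : ℂ)

theorem circ_mem (x : AddCircle (2 * Real.pi)) : circ x ∈ unitCircle := by
  exact mem_sphere_zero_iff_norm.2 (Circle.norm_coe _)

theorem continuous_circ : Continuous circ :=
  continuous_subtype_val.comp AddCircle.continuous_toCircle

theorem circ_coe (θ : ℝ) : circ (θ : AddCircle (2 * Real.pi)) = circleMap 0 1 θ := by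
  have h : 2 * Real.pi / (2 * Real.pi) * θ = θ := by
    rw [div_self Real.two_pi_pos.ne', one_mul]
  simp only [circ, AddCircle.toCircle_apply_mk, h, Circle.coe_exp, circleMap]
  simp

theorem avg_eq_integral (G : ℂ → ℂ) : avg G = ∫ x, G (circ x) ∂AddCircle.haarAddCircle := by
  have h := fourierCoeff_eq_intervalIntegral (T := 2 * Real.pi) (fun x => G (circ x)) 0 0
  rw [fourierCoeff] at h
  simp only [neg_zero, fourier_zero, one_smul, zero_add] at h
  rw [h, avg, Real.circleAverage_def]
  simp only [circ_coe, one_div]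

theorem fourier_eq_circ (n : ℤ) (x : AddCircle (2 * Real.pi)) : fourier n x = circ x ^ n := by
  rw [fourier_apply, circ, AddCircle.toCircle_zsmul]
  simp

theorem cf_eq_fourierCoeff (G : ℂ → ℂ) (n : ℤ) :
    cf G n = fourierCoeff (fun x => G (circ x)) n := by
  rw [cf, avg_eq_integral, fourierCoeff]
  simp only [fourier_eq_circ, smul_eq_mul]

theorem continuous_comp_circ {G : ℂ → ℂ} (hG : ContinuousOn G unitCircle) :
    Continuous fun x => G (circ x) :=
  hG.comp_continuous continuous_circ circ_mem

theorem integrable_comp_circ {G : ℂ → ℂ} (hG : ContinuousOn G unitCircle) :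
    Integrable (fun x => G (circ x)) AddCircle.haarAddCircle :=
  (continuous_comp_circ hG).integrable_of_hasCompactSupport
    (HasCompactSupport.of_compactSpace _)

theorem avg_congr {G H : ℂ → ℂ} (h : ∀ z ∈ unitCircle, G z = H z) : avg G = avg H := by
  rw [avg_eq_integral, avg_eq_integral]
  exact integral_congr_ae (ae_of_all _ fun x => h _ (circ_mem x))

theorem cf_congr {G H : ℂ → ℂ} (h : ∀ z ∈ unitCircle, G z = H z) (n : ℤ) : cf G n = cf H n :=
  avg_congr fun z hz => by rw [h z hz]

theorem ne_zero_of_mem_unitCircle {z : ℂ} (hz : z ∈ unitCircle) : z ≠ 0 := by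
  rintro rfl
  simp at hz

theorem norm_of_mem_unitCircle {z : ℂ} (hz : z ∈ unitCircle) : ‖z‖ = 1 := by simpa using hz

theorem conj_of_mem_unitCircle {z : ℂ} (hz : z ∈ unitCircle) : (starRingEnd ℂ) z = z⁻¹ := by
  rw [Complex.inv_def, Complex.normSq_eq_norm_sq, norm_of_mem_unitCircle hz]
  simp

theorem continuousOn_zpow_unitCircle (n : ℤ) : ContinuousOn (fun z : ℂ => z ^ n) unitCircle :=
  fun z hz => (continuousAt_zpow₀ z n (Or.inl (ne_zero_of_mem_unitCircle hz))).continuousWithinAt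

theorem cf_zpow_mul (G : ℂ → ℂ) (m n : ℤ) : cf (fun z => z ^ m * G z) n = cf G (n - m) := by
  refine avg_congr fun z hz => ?_
  rw [← mul_assoc, ← zpow_add₀ (ne_zero_of_mem_unitCircle hz)]
  congr 2
  ring

theorem avg_sub {G H : ℂ → ℂ} (hG : ContinuousOn G unitCircle) (hH : ContinuousOn H unitCircle) :
    avg (fun z => G z - H z) = avg G - avg H := by
  simp only [avg_eq_integral]
  exact integral_sub (integrable_comp_circ hG) (integrable_comp_circ hH)

theorem avg_add {G H : ℂ → ℂ} (hG : ContinuousOn G unitCircle) (hH : ContinuousOn H unitCircle) :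
    avg (fun z => G z + H z) = avg G + avg H := by
  simp only [avg_eq_integral]
  exact integral_add (integrable_comp_circ hG) (integrable_comp_circ hH)

theorem cf_sub {G H : ℂ → ℂ} (hG : ContinuousOn G unitCircle) (hH : ContinuousOn H unitCircle)
    (n : ℤ) : cf (fun z => G z - H z) n = cf G n - cf H n := by
  simp only [cf, mul_sub]
  exact avg_sub ((continuousOn_zpow_unitCircle _).mul hG) ((continuousOn_zpow_unitCircle _).mul hH)

theorem cf_add {G H : ℂ → ℂ} (hG : ContinuousOn G unitCircle) (hH : ContinuousOn H unitCircle)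
    (n : ℤ) : cf (fun z => G z + H z) n = cf G n + cf H n := by
  simp only [cf, mul_add]
  exact avg_add ((continuousOn_zpow_unitCircle _).mul hG) ((continuousOn_zpow_unitCircle _).mul hH)

theorem cf_const_mul (c : ℂ) (G : ℂ → ℂ) (n : ℤ) : cf (fun z => c * G z) n = c * cf G n := by
  simp only [cf, avg_eq_integral]
  rw [← integral_const_mul]
  refine integral_congr_ae (ae_of_all _ fun x => ?_)
  simp only
  ring

theorem norm_avg_le {G : ℂ → ℂ} {C : ℝ} (h : ∀ z ∈ unitCircle, ‖G z‖ ≤ C) : ‖avg G‖ ≤ C := by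
  rw [avg_eq_integral]
  refine (norm_integral_le_of_norm_le_const (ae_of_all _ fun x => h _ (circ_mem x))).trans ?_
  simp

theorem norm_cf_le {G : ℂ → ℂ} {C : ℝ} (h : ∀ z ∈ unitCircle, ‖G z‖ ≤ C) (n : ℤ) :
    ‖cf G n‖ ≤ C := by
  refine norm_avg_le fun z hz => ?_
  rw [norm_mul, norm_zpow, norm_of_mem_unitCircle hz, one_zpow, one_mul]
  exact h z hz

/-- Square-integrable functions on the circle. -/
abbrev L2Circle : Type := Lp ℂ 2 (AddCircle.haarAddCircle (T := 2 * Real.pi))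

/-- A continuous function on the unit circle as a square-integrable function. -/
noncomputable def toL2 (G : ℂ → ℂ) (hG : ContinuousOn G unitCircle) : L2Circle :=
  ContinuousMap.toLp 2 AddCircle.haarAddCircle ℂ ⟨fun x => G (circ x), continuous_comp_circ hG⟩

theorem inner_toL2 {G H : ℂ → ℂ} (hG : ContinuousOn G unitCircle) (hH : ContinuousOn H unitCircle) :
    inner ℂ (toL2 G hG) (toL2 H hH) = avg fun z => (starRingEnd ℂ) (G z) * H z := by
  rw [toL2, toL2, ContinuousMap.inner_toLp, avg_eq_integral]
  refine integral_congr_ae (ae_of_all _ fun x => ?_)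
  simp only [ContinuousMap.coe_mk]
  ring

theorem repr_toL2 {G : ℂ → ℂ} (hG : ContinuousOn G unitCircle) (n : ℤ) :
    fourierBasis.repr (toL2 G hG) n = cf G n := by
  rw [fourierBasis_repr, toL2, fourierCoeff_toLp, cf_eq_fourierCoeff]
  rfl

theorem parseval {G H : ℂ → ℂ} (hG : ContinuousOn G unitCircle) (hH : ContinuousOn H unitCircle) :
    HasSum (fun n => (starRingEnd ℂ) (cf G n) * cf H n)
      (avg fun z => (starRingEnd ℂ) (G z) * H z) := by
  have h := fourierBasis.hasSum_inner_mul_inner (toL2 G hG) (toL2 H hH)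
  rw [inner_toL2] at h
  refine h.congr_fun fun n => ?_
  rw [← inner_conj_symm, ← HilbertBasis.repr_apply_apply, ← HilbertBasis.repr_apply_apply, repr_toL2,
    repr_toL2]

theorem norm_toL2_sub_le {G H : ℂ → ℂ} (hG : ContinuousOn G unitCircle)
    (hH : ContinuousOn H unitCircle) {C : ℝ} (hC : 0 ≤ C) (h : ∀ z ∈ unitCircle, ‖G z - H z‖ ≤ C) :
    ‖toL2 G hG - toL2 H hH‖ ≤ C := by
  have e : toL2 G hG - toL2 H hH = toL2 (fun z => G z - H z) (hG.sub hH) := by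
    rw [toL2, toL2, ← map_sub]
    rfl
  have h2 : ‖toL2 (fun z => G z - H z) (hG.sub hH)‖ ^ 2 ≤ C ^ 2 := by
    rw [← inner_self_eq_norm_sq (𝕜 := ℂ), inner_toL2]
    refine (RCLike.re_le_norm _).trans (norm_avg_le fun z hz => ?_)
    rw [norm_mul, RCLike.norm_conj, ← sq]
    exact pow_le_pow_left₀ (norm_nonneg _) (h z hz) 2
  rw [e]
  exact le_of_sq_le_sq h2 hC

end Fourier

/-! ### The q-logarithm from which all symbols are built -/

section Potential

/-- The logarithm of `∏ (1 - κ ^ (2 m + 1) z)⁻¹`. -/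
noncomputable def potential (κ : ℝ) (z : ℂ) : ℂ :=
  ∑' k : ℕ, ((κ ^ (k + 1) / ((k + 1) * (1 - κ ^ (2 * (k + 1)))) : ℝ) : ℂ) * z ^ (k + 1)

variable {κ : ℝ}

theorem norm_potential_coeff_le (h0 : 0 < κ) (h1 : κ < 1) (k : ℕ) :
    ‖((κ ^ (k + 1) / ((k + 1) * (1 - κ ^ (2 * (k + 1)))) : ℝ) : ℂ)‖ ≤
      κ ^ (k + 1) / (1 - κ ^ 2) := by
  have h2 : κ ^ (2 * (k + 1)) ≤ κ ^ 2 := pow_le_pow_of_le_one h0.le h1.le (by omega)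
  have h3 : κ ^ 2 < 1 := pow_lt_one₀ h0.le h1 two_ne_zero
  rw [Complex.norm_real, Real.norm_of_nonneg (by
    apply div_nonneg (pow_nonneg h0.le _) (mul_nonneg (by positivity) (by linarith)))]
  refine div_le_div_of_nonneg_left (pow_nonneg h0.le _) (by linarith) ?_
  have h4 : (0 : ℝ) ≤ k := Nat.cast_nonneg k
  nlinarith

theorem norm_potential_term_le (h0 : 0 < κ) (h1 : κ < 1) {R : ℝ} {z : ℂ} (hz : ‖z‖ ≤ R) (k : ℕ) :
    ‖((κ ^ (k + 1) / ((k + 1) * (1 - κ ^ (2 * (k + 1)))) : ℝ) : ℂ) * z ^ (k + 1)‖ ≤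
      (κ * R) ^ (k + 1) / (1 - κ ^ 2) := by
  rw [norm_mul, norm_pow]
  have h3 : κ ^ 2 < 1 := pow_lt_one₀ h0.le h1 two_ne_zero
  refine (mul_le_mul (norm_potential_coeff_le h0 h1 k)
    (pow_le_pow_left₀ (norm_nonneg _) hz _) (by positivity) ?_).trans (le_of_eq ?_)
  · exact div_nonneg (pow_nonneg h0.le _) (by linarith)
  · rw [mul_pow]; ring

theorem summable_potential_bound (h0 : 0 < κ) {R : ℝ} (hR0 : 0 ≤ R) (hR : κ * R < 1) :
    Summable fun k : ℕ => (κ * R) ^ (k + 1) / (1 - κ ^ 2) :=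
  ((summable_nat_add_iff 1).2
    (summable_geometric_of_lt_one (mul_nonneg h0.le hR0) hR)).div_const _

theorem summable_potential (h0 : 0 < κ) (h1 : κ < 1) {z : ℂ} (hz : κ * ‖z‖ < 1) :
    Summable fun k : ℕ =>
      ((κ ^ (k + 1) / ((k + 1) * (1 - κ ^ (2 * (k + 1)))) : ℝ) : ℂ) * z ^ (k + 1) :=
  Summable.of_norm_bounded (summable_potential_bound h0 (norm_nonneg z) hz)
    fun k => norm_potential_term_le h0 h1 le_rfl k

theorem differentiableAt_potential (h0 : 0 < κ) (h1 : κ < 1) {z : ℂ} (hz : κ * ‖z‖ < 1) :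
    DifferentiableAt ℂ (potential κ) z := by
  have h2 : ‖z‖ < 1 / κ := by rw [lt_div_iff₀ h0, mul_comm]; exact hz
  obtain ⟨R, hR1, hR2⟩ := exists_between h2
  have hR0 : 0 ≤ R := (norm_nonneg z).trans hR1.le
  have hR3 : κ * R < 1 := by rw [lt_div_iff₀ h0, mul_comm] at hR2; exact hR2
  have := Complex.differentiableOn_tsum_of_summable_norm (summable_potential_bound h0 hR0 hR3)
    (U := Metric.ball (0 : ℂ) R) (F := fun (k : ℕ) (z : ℂ) =>
      ((κ ^ (k + 1) / ((k + 1) * (1 - κ ^ (2 * (k + 1)))) : ℝ) : ℂ) * z ^ (k + 1))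
    (fun k => by fun_prop) Metric.isOpen_ball
    (fun k w hw => norm_potential_term_le h0 h1 (by simpa using (Metric.mem_ball.1 hw).le) k)
  exact this.differentiableAt (Metric.isOpen_ball.mem_nhds (by simpa using hR1))

theorem potential_zero (κ : ℝ) : potential κ 0 = 0 := by
  simp [potential]

theorem potential_conj (κ : ℝ) (z : ℂ) :
    potential κ ((starRingEnd ℂ) z) = (starRingEnd ℂ) (potential κ z) := by
  rw [potential, potential, Complex.conj_tsum]
  refine tsum_congr fun k => ?_
  rw [map_mul, map_pow, Complex.conj_ofReal]

/-- `potential` is a q-analogue of the logarithm. -/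
theorem potential_sub (h0 : 0 < κ) (h1 : κ < 1) {z : ℂ} (hz : κ * ‖z‖ < 1) :
    potential κ z - potential κ ((κ : ℂ) ^ 2 * z) = -Complex.log (1 - κ * z) := by
  have h3 : κ ^ 2 < 1 := pow_lt_one₀ h0.le h1 two_ne_zero
  have hz2 : κ * ‖(κ : ℂ) ^ 2 * z‖ < 1 := by
    rw [norm_mul, norm_pow, Complex.norm_real, Real.norm_of_nonneg h0.le]
    have : κ ^ 2 * ‖z‖ ≤ ‖z‖ := mul_le_of_le_one_left (norm_nonneg z) h3.le
    exact (mul_le_mul_of_nonneg_left this h0.le).trans_lt hz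
  have hn : ‖(κ : ℂ) * z‖ < 1 := by
    rwa [norm_mul, Complex.norm_real, Real.norm_of_nonneg h0.le]
  have h4 := (hasSum_nat_add_iff' 1).2 (Complex.hasSum_taylorSeries_neg_log hn)
  have h5 := (summable_potential h0 h1 hz).hasSum.sub (summable_potential h0 h1 hz2).hasSum
  refine h5.unique ?_
  simp only [Finset.range_one, Finset.sum_singleton, pow_zero, Nat.cast_zero, div_zero,
    sub_zero] at h4
  -- The factor 1 - κ^(2(k+1)) produced by the difference cancels the denominator of the potential
  -- and leaves the Taylor series of -log(1 - κz).
  refine h4.congr_fun fun k => ?_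
  have h6 : (1 : ℂ) - (κ : ℂ) ^ (2 * (k + 1)) ≠ 0 := by
    have : κ ^ (2 * (k + 1)) < 1 := pow_lt_one₀ h0.le h1 (by omega)
    have h7 : (1 : ℝ) - κ ^ (2 * (k + 1)) ≠ 0 := by linarith
    exact_mod_cast h7
  have h8 : ((k : ℂ) + 1) ≠ 0 := by exact_mod_cast Nat.succ_ne_zero k
  push_cast
  rw [mul_pow, mul_pow, ← pow_mul]
  field_simp

theorem exp_potential_sub (h0 : 0 < κ) (h1 : κ < 1) {z : ℂ} (hz : κ * ‖z‖ < 1) :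
    Complex.exp (potential κ z - potential κ ((κ : ℂ) ^ 2 * z)) = (1 - κ * z)⁻¹ := by
  rw [potential_sub h0 h1 hz, Complex.exp_neg, Complex.exp_log]
  intro h
  have : (κ : ℂ) * z = 1 := (sub_eq_zero.1 h).symm
  have h2 := congrArg norm this
  rw [norm_mul, Complex.norm_real, Real.norm_of_nonneg h0.le, norm_one] at h2
  exact hz.ne h2

end Potential

end FacetedCrystal

namespace FacetedCrystal

/-! ### Symbols with real Fourier coefficients -/

section FourierReality

theorem tendsto_cf_of_dominated {F : ℕ → ℂ → ℂ} {G : ℂ → ℂ} (C : ℝ)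
    (hF : ∀ᶠ i in atTop, ContinuousOn (F i) unitCircle)
    (hC : ∀ᶠ i in atTop, ∀ z ∈ unitCircle, ‖F i z‖ ≤ C)
    (h : ∀ z ∈ unitCircle, Tendsto (fun i => F i z) atTop (𝓝 (G z))) (n : ℤ) :
    Tendsto (fun i => cf (F i) n) atTop (𝓝 (cf G n)) := by
  simp only [cf, avg_eq_integral]
  refine tendsto_integral_filter_of_dominated_convergence (fun _ => C) ?_ ?_
    (integrable_const _) (ae_of_all _ fun x => (h _ (circ_mem x)).const_mul _)
  · filter_upwards [hF] with i hi
    exact (integrable_comp_circ ((continuousOn_zpow_unitCircle _).mul hi)).aestronglyMeasurable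
  · filter_upwards [hC] with i hi
    refine ae_of_all _ fun x => ?_
    rw [norm_mul, norm_zpow, norm_of_mem_unitCircle (circ_mem x), one_zpow, one_mul]
    exact hi _ (circ_mem x)

theorem avg_inv (G : ℂ → ℂ) : avg (fun z => G z⁻¹) = avg G :=
  Real.circleAverage_zero_one_congr_inv

theorem conj_avg (G : ℂ → ℂ) : (starRingEnd ℂ) (avg G) = avg fun z => (starRingEnd ℂ) (G z) := by
  rw [avg_eq_integral, avg_eq_integral, integral_conj]

theorem inv_mem_unitCircle {z : ℂ} (hz : z ∈ unitCircle) : z⁻¹ ∈ unitCircle := by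
  rw [mem_sphere_zero_iff_norm] at hz ⊢
  rw [norm_inv, hz, inv_one]

theorem cf_inv (G : ℂ → ℂ) (n : ℤ) : cf (fun z => G z⁻¹) n = cf G (-n) := by
  rw [cf, cf, ← avg_inv]
  refine avg_congr fun z hz => ?_
  simp

/-- Symbols with real Fourier coefficients. -/
def IsRealSymbol (G : ℂ → ℂ) : Prop := ∀ z ∈ unitCircle, G z⁻¹ = (starRingEnd ℂ) (G z)

/-- On the circle both conjugation and inversion of the symbol have the same effect, and the average
is invariant under inversion. -/
theorem IsRealSymbol.conj_cf {G : ℂ → ℂ} (hG : IsRealSymbol G) (n : ℤ) :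
    (starRingEnd ℂ) (cf G n) = cf G n := by
  rw [cf, conj_avg, ← avg_inv]
  refine avg_congr fun z hz => ?_
  rw [map_mul, hG z hz, Complex.conj_conj, inv_zpow, map_inv₀, map_zpow₀, conj_of_mem_unitCircle hz,
    inv_zpow, inv_inv]

theorem IsRealSymbol.cf_eq {G : ℂ → ℂ} (hG : IsRealSymbol G) (n : ℤ) :
    cf G n = ((cf G n).re : ℂ) := (Complex.conj_eq_iff_re.1 (hG.conj_cf n)).symm

end FourierReality

/-! ### Multiplication by a geometric series -/

section Geometric

theorem coeff_mk_pow_mul (x : ℝ) (A : PowerSeries ℝ) :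
    (PowerSeries.mk fun k => x ^ k) * A =
      A + PowerSeries.C x * (PowerSeries.X * ((PowerSeries.mk fun k => x ^ k) * A)) := by
  have h : (PowerSeries.mk fun k => x ^ k) =
      1 + PowerSeries.C x * (PowerSeries.X * (PowerSeries.mk fun k => x ^ k)) := by
    ext n
    cases n with
    | zero => simp
    | succ n => simp [PowerSeries.coeff_succ_X_mul, PowerSeries.coeff_one, pow_succ']
  nth_rewrite 1 [h]
  ring

theorem zcoeff_geometric_mul (x : ℝ) (A : PowerSeries ℝ) (k : ℤ) :
    zcoeff ((PowerSeries.mk fun k => x ^ k) * A) k =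
      zcoeff A k + x * zcoeff ((PowerSeries.mk fun k => x ^ k) * A) (k - 1) := by
  rcases lt_or_ge k 0 with hk | hk
  · rw [zcoeff_of_neg _ hk, zcoeff_of_neg _ hk, zcoeff_of_neg _ (by omega)]
    ring
  · obtain ⟨n, rfl⟩ := Int.eq_ofNat_of_zero_le hk
    rw [zcoeff_natCast, zcoeff_natCast]
    cases n with
    | zero =>
      rw [zcoeff_of_neg _ (by omega)]
      simp [PowerSeries.coeff_mul]
    | succ n =>
      have : ((n + 1 : ℕ) : ℤ) - 1 = (n : ℕ) := by push_cast; ring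
      rw [this, zcoeff_natCast]
      nth_rewrite 1 [coeff_mk_pow_mul]
      rw [map_add, PowerSeries.coeff_C_mul, PowerSeries.coeff_succ_X_mul]

/-- Both sides solve u(k) = a(k) + x u(k-1), so their difference satisfies d(k) = x^n d(k-n). At
very negative indices the power series side vanishes and the Fourier coefficients stay bounded,
hence d = 0. -/
theorem cf_geometric {G : ℂ → ℂ} (hG : ContinuousOn G unitCircle) {A : PowerSeries ℝ}
    (hA : ∀ k, cf G k = zcoeff A k) {x : ℝ} (hx : |x| < 1) (k : ℤ) :
    cf (fun z => G z * (1 - x * z)⁻¹) k = zcoeff ((PowerSeries.mk fun k => x ^ k) * A) k := by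
  have hne : ∀ z ∈ unitCircle, (1 : ℂ) - x * z ≠ 0 := by
    intro z hz h
    have h2 := congrArg norm (sub_eq_zero.1 h)
    rw [norm_mul, norm_of_mem_unitCircle hz, Complex.norm_real, norm_one, mul_one,
      Real.norm_eq_abs] at h2
    exact hx.ne' h2
  have hc : ContinuousOn (fun z => G z * (1 - x * z)⁻¹) unitCircle :=
    hG.mul (ContinuousOn.inv₀ (by fun_prop) hne)
  have hrec : ∀ k, cf (fun z => G z * (1 - x * z)⁻¹) k =
      cf G k + x * cf (fun z => G z * (1 - x * z)⁻¹) (k - 1) := by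
    intro k
    have h1 : cf G k = cf (fun z => G z * (1 - x * z)⁻¹ -
        x * (z ^ (1 : ℤ) * (G z * (1 - x * z)⁻¹))) k := by
      refine cf_congr (fun z hz => ?_) k
      have := hne z hz
      rw [zpow_one]
      field_simp
    have hc2 : ContinuousOn (fun z => (x : ℂ) * (z ^ (1 : ℤ) * (G z * (1 - x * z)⁻¹))) unitCircle :=
      continuousOn_const.mul ((continuousOn_zpow_unitCircle 1).mul hc)
    rw [h1, cf_sub hc hc2, cf_const_mul, cf_zpow_mul]
    ring
  let d : ℤ → ℂ := fun k => cf (fun z => G z * (1 - x * z)⁻¹) k -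
    zcoeff ((PowerSeries.mk fun k => x ^ k) * A) k
  have hd : ∀ k, d k = x * d (k - 1) := by
    intro k
    simp only [d]
    rw [hrec k, zcoeff_geometric_mul, hA]
    push_cast
    ring
  have hdn : ∀ (n : ℕ) k, d k = x ^ n * d (k - n) := by
    intro n
    induction n with
    | zero => intro k; simp
    | succ n ih =>
      intro k
      rw [ih k, hd (k - n), pow_succ, mul_assoc]
      congr 3
      push_cast
      ring
  obtain ⟨C, hC⟩ := (isCompact_sphere (0 : ℂ) 1).exists_bound_of_continuousOn hc
  have hlim : Tendsto (fun n : ℕ => |x| ^ n * C) atTop (𝓝 0) := by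
    simpa using (tendsto_pow_atTop_nhds_zero_of_lt_one (abs_nonneg x) hx).mul_const C
  have hzero : ‖d k‖ ≤ 0 := by
    refine ge_of_tendsto hlim ?_
    filter_upwards [eventually_gt_atTop k.toNat] with n hn
    rw [hdn n k, norm_mul, norm_pow, Complex.norm_real, Real.norm_eq_abs]
    refine mul_le_mul_of_nonneg_left ?_ (pow_nonneg (abs_nonneg x) n)
    simp only [d]
    rw [zcoeff_of_neg _ (by omega)]
    simpa using norm_cf_le hC (k - n)
  exact sub_eq_zero.1 (norm_le_zero_iff.1 hzero)

end Geometric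

/-! ### Symbols of one-line transfers -/

section Symbols

variable {κ : ℝ}

/-- A bound for the potential on the unit disc. -/
noncomputable def potentialBound (κ : ℝ) : ℝ := ∑' k : ℕ, (κ * 1) ^ (k + 1) / (1 - κ ^ 2)

theorem norm_potential_le (h0 : 0 < κ) (h1 : κ < 1) {z : ℂ} (hz : ‖z‖ ≤ 1) :
    ‖potential κ z‖ ≤ potentialBound κ :=
  tsum_of_norm_bounded (summable_potential_bound h0 zero_le_one (by simpa using h1)).hasSum
    fun k => norm_potential_term_le h0 h1 hz k

theorem continuousAt_potential (h0 : 0 < κ) (h1 : κ < 1) {z : ℂ} (hz : ‖z‖ ≤ 1) :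
    ContinuousAt (potential κ) z :=
  (differentiableAt_potential h0 h1 ((mul_le_of_le_one_right h0.le hz).trans_lt h1)).continuousAt

/-- The two-sided product of one-line transfer symbols. -/
noncomputable def symbol (κ α β γ δ : ℝ) (z : ℂ) : ℂ :=
  Complex.exp (potential κ (α * z) - potential κ (β * z) +
    (potential κ (γ * z⁻¹) - potential κ (δ * z⁻¹)))

theorem norm_ofReal_mul_le {α : ℝ} (hα : α ∈ Set.Icc (0 : ℝ) 1) {z : ℂ} (hz : z ∈ unitCircle) :
    ‖(α : ℂ) * z‖ ≤ 1 := by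
  rw [norm_mul, norm_of_mem_unitCircle hz, Complex.norm_real, Real.norm_of_nonneg hα.1, mul_one]
  exact hα.2

theorem continuousOn_potential_mul (h0 : 0 < κ) (h1 : κ < 1) {α : ℝ} (hα : α ∈ Set.Icc (0 : ℝ) 1) :
    ContinuousOn (fun z => potential κ (α * z)) unitCircle := fun z hz =>
  (ContinuousAt.comp (f := fun z : ℂ => (α : ℂ) * z)
    (continuousAt_potential h0 h1 (norm_ofReal_mul_le hα hz)) (by fun_prop)).continuousWithinAt

theorem continuousOn_potential_mul_inv (h0 : 0 < κ) (h1 : κ < 1) {α : ℝ}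
    (hα : α ∈ Set.Icc (0 : ℝ) 1) :
    ContinuousOn (fun z => potential κ (α * z⁻¹)) unitCircle :=
  (continuousOn_potential_mul h0 h1 hα).comp (f := fun z : ℂ => z⁻¹)
    (continuousOn_inv₀.mono fun _ hz => ne_zero_of_mem_unitCircle hz)
    fun _ hz => inv_mem_unitCircle hz

theorem continuousOn_symbol (h0 : 0 < κ) (h1 : κ < 1) {α β γ δ : ℝ} (hα : α ∈ Set.Icc (0 : ℝ) 1)
    (hβ : β ∈ Set.Icc (0 : ℝ) 1) (hγ : γ ∈ Set.Icc (0 : ℝ) 1) (hδ : δ ∈ Set.Icc (0 : ℝ) 1) :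
    ContinuousOn (symbol κ α β γ δ) unitCircle :=
  Complex.continuous_exp.comp_continuousOn
    (((continuousOn_potential_mul h0 h1 hα).sub (continuousOn_potential_mul h0 h1 hβ)).add
    ((continuousOn_potential_mul_inv h0 h1 hγ).sub (continuousOn_potential_mul_inv h0 h1 hδ)))

theorem norm_symbol_le (h0 : 0 < κ) (h1 : κ < 1) {α β γ δ : ℝ} (hα : α ∈ Set.Icc (0 : ℝ) 1)
    (hβ : β ∈ Set.Icc (0 : ℝ) 1) (hγ : γ ∈ Set.Icc (0 : ℝ) 1) (hδ : δ ∈ Set.Icc (0 : ℝ) 1)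
    {z : ℂ} (hz : z ∈ unitCircle) :
    ‖symbol κ α β γ δ z‖ ≤ Real.exp (4 * potentialBound κ) := by
  rw [symbol, Complex.norm_exp, Real.exp_le_exp]
  refine (Complex.re_le_norm _).trans ((norm_add_le _ _).trans ?_)
  have e1 := norm_potential_le h0 h1 (norm_ofReal_mul_le hα hz)
  have e2 := norm_potential_le h0 h1 (norm_ofReal_mul_le hβ hz)
  have e3 := norm_potential_le h0 h1 (norm_ofReal_mul_le hγ (inv_mem_unitCircle hz))
  have e4 := norm_potential_le h0 h1 (norm_ofReal_mul_le hδ (inv_mem_unitCircle hz))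
  have e5 := norm_sub_le (potential κ (α * z)) (potential κ (β * z))
  have e6 := norm_sub_le (potential κ (γ * z⁻¹)) (potential κ (δ * z⁻¹))
  linarith

theorem isRealSymbol_symbol (κ α β γ δ : ℝ) : IsRealSymbol (symbol κ α β γ δ) := by
  intro z hz
  have h : ∀ (a : ℝ) (w : ℂ), w ∈ unitCircle →
      potential κ (a * w⁻¹) = (starRingEnd ℂ) (potential κ (a * w)) := by
    intro a w hw
    rw [← potential_conj, map_mul, Complex.conj_ofReal, conj_of_mem_unitCircle hw]
  simp only [symbol]
  rw [← Complex.exp_conj, map_add, map_sub, map_sub, h _ _ hz, h _ _ hz,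
    h _ _ (inv_mem_unitCircle hz), h _ _ (inv_mem_unitCircle hz)]

theorem tendsto_potential_mul (h0 : 0 < κ) (h1 : κ < 1) {α : ℕ → ℝ} {a : ℝ}
    (ha : a ∈ Set.Icc (0 : ℝ) 1) (hα : Tendsto α atTop (𝓝 a)) {z : ℂ} (hz : z ∈ unitCircle) :
    Tendsto (fun n => potential κ (α n * z)) atTop (𝓝 (potential κ (a * z))) :=
  (continuousAt_potential h0 h1 (norm_ofReal_mul_le ha hz)).tendsto.comp
    (((Complex.continuous_ofReal.tendsto a).comp hα).mul_const z)

theorem tendsto_cf_symbol (h0 : 0 < κ) (h1 : κ < 1) {α β γ δ : ℕ → ℝ} {a b c d : ℝ}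
    (hα : ∀ n, α n ∈ Set.Icc (0 : ℝ) 1) (hβ : ∀ n, β n ∈ Set.Icc (0 : ℝ) 1)
    (hγ : ∀ n, γ n ∈ Set.Icc (0 : ℝ) 1) (hδ : ∀ n, δ n ∈ Set.Icc (0 : ℝ) 1)
    (ha : Tendsto α atTop (𝓝 a)) (hb : Tendsto β atTop (𝓝 b))
    (hc : Tendsto γ atTop (𝓝 c)) (hd : Tendsto δ atTop (𝓝 d)) (n : ℤ) :
    Tendsto (fun i => cf (symbol κ (α i) (β i) (γ i) (δ i)) n) atTop
      (𝓝 (cf (symbol κ a b c d) n)) := by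
  have hmem : ∀ {f : ℕ → ℝ} {x : ℝ}, (∀ n, f n ∈ Set.Icc (0 : ℝ) 1) → Tendsto f atTop (𝓝 x) →
      x ∈ Set.Icc (0 : ℝ) 1 := fun hf hx => isClosed_Icc.mem_of_tendsto hx (Eventually.of_forall hf)
  refine tendsto_cf_of_dominated (Real.exp (4 * potentialBound κ))
    (Eventually.of_forall fun i => continuousOn_symbol h0 h1 (hα i) (hβ i) (hγ i) (hδ i))
    (Eventually.of_forall fun i z hz => norm_symbol_le h0 h1 (hα i) (hβ i) (hγ i) (hδ i) hz)
    (fun z hz => ?_) n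
  exact (Complex.continuous_exp.tendsto _).comp
    (((tendsto_potential_mul h0 h1 (hmem hα ha) ha hz).sub
      (tendsto_potential_mul h0 h1 (hmem hβ hb) hb hz)).add
    ((tendsto_potential_mul h0 h1 (hmem hγ hc) hc (inv_mem_unitCircle hz)).sub
      (tendsto_potential_mul h0 h1 (hmem hδ hd) hd (inv_mem_unitCircle hz))))

theorem pow_mem_Icc (h0 : 0 < κ) (h1 : κ < 1) (n : ℕ) : κ ^ n ∈ Set.Icc (0 : ℝ) 1 :=
  ⟨pow_nonneg h0.le n, pow_le_one₀ h0.le h1.le⟩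

/-- By `exp_potential_sub` each factor (1 - κ^(2m+1) z)⁻¹ is the exponential of a difference of
potentials, so the product over a ≤ m < b telescopes. In this form the infinite product is simply
the value 0 of the second parameter. -/
theorem cf_symbol_pow (h0 : 0 < κ) (h1 : κ < 1) {a b : ℕ} (hab : a ≤ b) (k : ℤ) :
    cf (symbol κ (κ ^ (2 * a)) (κ ^ (2 * b)) 0 0) k = zcoeff (homogeneousSeries κ a b) k := by
  have hz0 : (0 : ℝ) ∈ Set.Icc (0 : ℝ) 1 := ⟨le_rfl, zero_le_one⟩
  induction b, hab using Nat.le_induction generalizing k with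
  | base =>
    have h2 : ∀ z ∈ unitCircle, symbol κ (κ ^ (2 * a)) (κ ^ (2 * a)) 0 0 z = 1 := by
      intro z _
      simp [symbol]
    rw [cf_congr h2, homogeneousSeries_self, cf_eq_fourierCoeff]
    have h3 := congrFun (fourierCoeff_fourier (T := 2 * Real.pi) 0) k
    have h4 : (fun _ : AddCircle (2 * Real.pi) => (1 : ℂ)) = fourier 0 := by
      ext x; simp
    rw [h4, h3, Pi.single_apply, zcoeff]
    by_cases hk : k = 0
    · simp [hk]
    · rw [if_neg hk]
      split_ifs with h5
      · rw [PowerSeries.coeff_one, if_neg (by omega)]; simp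
      · simp
  | succ b hb ih =>
    have e : homogeneousSeries κ a (b + 1) =
        (PowerSeries.mk fun k => (κ ^ (2 * b + 1)) ^ k) * homogeneousSeries κ a b := by
      rw [homogeneousSeries, Finset.prod_Ico_succ_top hb, mul_comm, ← homogeneousSeries]
    have hlt : |κ ^ (2 * b + 1)| < 1 := by
      rw [abs_of_pos (pow_pos h0 _)]
      exact pow_lt_one₀ h0.le h1 (by omega)
    rw [e, ← cf_geometric (continuousOn_symbol h0 h1 (pow_mem_Icc h0 h1 _) (pow_mem_Icc h0 h1 _)
      hz0 hz0) ih hlt]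
    refine cf_congr (fun z hz => ?_) k
    have h2 : κ * ‖((κ ^ (2 * b) : ℝ) : ℂ) * z‖ < 1 :=
      (mul_le_of_le_one_right h0.le (norm_ofReal_mul_le (pow_mem_Icc h0 h1 _) hz)).trans_lt h1
    have h3 := exp_potential_sub h0 h1 h2
    have e1 : (κ : ℂ) ^ 2 * (((κ ^ (2 * b) : ℝ) : ℂ) * z) = ((κ ^ (2 * (b + 1)) : ℝ) : ℂ) * z := by
      push_cast; ring
    have e2 : (κ : ℂ) * (((κ ^ (2 * b) : ℝ) : ℂ) * z) = ((κ ^ (2 * b + 1) : ℝ) : ℂ) * z := by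
      push_cast; ring
    rw [e1, e2] at h3
    rw [← h3]
    simp only [symbol]
    rw [← Complex.exp_add]
    congr 1
    ring

theorem zcoeff_homogeneousSeries_nonneg (h0 : 0 < κ) {a b : ℕ} (hab : a ≤ b) (k : ℤ) :
    0 ≤ zcoeff (homogeneousSeries κ a b) k := by
  induction b, hab using Nat.le_induction generalizing k with
  | base =>
    rw [homogeneousSeries_self, zcoeff]
    split_ifs
    · rw [PowerSeries.coeff_one]; split_ifs <;> norm_num
    · exact le_rfl
  | succ b hb ih =>
    have e : homogeneousSeries κ a (b + 1) =
        (PowerSeries.mk fun k => (κ ^ (2 * b + 1)) ^ k) * homogeneousSeries κ a b := by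
      rw [homogeneousSeries, Finset.prod_Ico_succ_top hb, mul_comm, ← homogeneousSeries]
    rw [e, zcoeff]
    split_ifs with hk
    · rw [PowerSeries.coeff_mul]
      refine Finset.sum_nonneg fun x _ => mul_nonneg ?_ ?_
      · rw [PowerSeries.coeff_mk]; positivity
      · rw [← zcoeff_natCast]; exact ih _
    · exact le_rfl

/-- Each further factor has nonnegative coefficients and constant term one. Together with the limit
of the coefficients this supplies the dominating functions used below. -/
theorem zcoeff_homogeneousSeries_mono (h0 : 0 < κ) {a b c : ℕ} (hab : a ≤ b) (hbc : b ≤ c) (k : ℤ) :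
    zcoeff (homogeneousSeries κ a b) k ≤ zcoeff (homogeneousSeries κ a c) k := by
  induction c, hbc using Nat.le_induction with
  | base => exact le_rfl
  | succ c hc ih =>
    refine ih.trans ?_
    have e : homogeneousSeries κ a (c + 1) =
        (PowerSeries.mk fun k => (κ ^ (2 * c + 1)) ^ k) * homogeneousSeries κ a c := by
      rw [homogeneousSeries, Finset.prod_Ico_succ_top (hab.trans hc), mul_comm,
        ← homogeneousSeries]
    rw [e, zcoeff_geometric_mul, ← e]
    have := zcoeff_homogeneousSeries_nonneg (κ := κ) h0 (show a ≤ c + 1 by omega) (k - 1)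
    have h2 : 0 ≤ κ ^ (2 * c + 1) := by positivity
    nlinarith

end Symbols

end FacetedCrystal

namespace FacetedCrystal

/-! ### One-line weights without height restriction -/

section OneLineLimits

variable {κ : ℝ}

theorem zero_mem_Icc : (0 : ℝ) ∈ Set.Icc (0 : ℝ) 1 := ⟨le_rfl, zero_le_one⟩

theorem one_mem_Icc : (1 : ℝ) ∈ Set.Icc (0 : ℝ) 1 := ⟨zero_le_one, le_rfl⟩

theorem tendsto_pow_two_mul (h0 : 0 < κ) (h1 : κ < 1) {b : ℕ → ℕ} (hb : Tendsto b atTop atTop) :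
    Tendsto (fun n => κ ^ (2 * b n)) atTop (𝓝 0) :=
  (tendsto_pow_atTop_nhds_zero_of_lt_one h0.le h1).comp (hb.const_mul_atTop' two_pos)

/-- The limit of the coefficients of `homogeneousSeries κ a b`, where `β` is the limit of
`κ ^ (2 b)`. -/
theorem tendsto_zcoeff (h0 : 0 < κ) (h1 : κ < 1) {a : ℕ} {b : ℕ → ℕ} (hab : ∀ᶠ n in atTop, a ≤ b n)
    {β : ℝ} (hb : Tendsto (fun n => κ ^ (2 * b n)) atTop (𝓝 β)) (k : ℤ) :
    Tendsto (fun n => zcoeff (homogeneousSeries κ a (b n)) k) atTop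
      (𝓝 (cf (symbol κ (κ ^ (2 * a)) β 0 0) k).re) := by
  have h := tendsto_cf_symbol h0 h1 (α := fun _ => κ ^ (2 * a)) (β := fun n => κ ^ (2 * b n))
    (γ := fun _ => 0) (δ := fun _ => 0) (fun _ => pow_mem_Icc h0 h1 _)
    (fun _ => pow_mem_Icc h0 h1 _) (fun _ => zero_mem_Icc) (fun _ => zero_mem_Icc)
    tendsto_const_nhds hb tendsto_const_nhds tendsto_const_nhds k
  refine ((Complex.continuous_re.tendsto _).comp h).congr' ?_
  filter_upwards [hab] with n hn
  rw [Function.comp_apply, cf_symbol_pow h0 h1 hn, Complex.ofReal_re]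

theorem zcoeff_le_limit (h0 : 0 < κ) (h1 : κ < 1) {a b : ℕ} (hab : a ≤ b) (k : ℤ) :
    zcoeff (homogeneousSeries κ a b) k ≤ (cf (symbol κ (κ ^ (2 * a)) 0 0 0) k).re := by
  refine ge_of_tendsto (tendsto_zcoeff h0 h1 (b := id) (eventually_ge_atTop a)
    (tendsto_pow_two_mul h0 h1 tendsto_id) k) ?_
  filter_upwards [eventually_ge_atTop b] with n hn
  exact zcoeff_homogeneousSeries_mono h0 hab hn k

/-- Parseval's identity: summing over the central position multiplies the two symbols, one of them
taken at 1/z. -/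
theorem hasSum_symbol_coeff_mul (h0 : 0 < κ) (h1 : κ < 1) {α β : ℝ} (hα : α ∈ Set.Icc (0 : ℝ) 1)
    (hβ : β ∈ Set.Icc (0 : ℝ) 1) (p p' : ℤ) :
    HasSum (fun w => (cf (symbol κ 1 α 0 0) (w - p)).re * (cf (symbol κ 1 β 0 0) (w - p')).re)
      (cf (symbol κ 1 α 1 β) (p' - p)).re := by
  have hA := continuousOn_symbol h0 h1 one_mem_Icc hα zero_mem_Icc zero_mem_Icc
  have hB := continuousOn_symbol h0 h1 one_mem_Icc hβ zero_mem_Icc zero_mem_Icc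
  have hB' : ContinuousOn (fun z => z ^ p' * symbol κ 1 β 0 0 z) unitCircle :=
    (continuousOn_zpow_unitCircle p').mul hB
  have hA' : ContinuousOn (fun z => z ^ p * symbol κ 1 α 0 0 z) unitCircle :=
    (continuousOn_zpow_unitCircle p).mul hA
  have h := parseval hB' hA'
  have h2 : avg (fun z => (starRingEnd ℂ) (z ^ p' * symbol κ 1 β 0 0 z) *
      (z ^ p * symbol κ 1 α 0 0 z)) = cf (symbol κ 1 α 1 β) (p' - p) := by
    refine avg_congr fun z hz => ?_
    rw [map_mul, map_zpow₀, conj_of_mem_unitCircle hz, ← isRealSymbol_symbol _ _ _ _ _ z hz,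
      show z⁻¹ ^ p' * symbol κ 1 β 0 0 z⁻¹ * (z ^ p * symbol κ 1 α 0 0 z) =
        (z⁻¹ ^ p' * z ^ p) * (symbol κ 1 β 0 0 z⁻¹ * symbol κ 1 α 0 0 z) by ring,
      inv_zpow', ← zpow_add₀ (ne_zero_of_mem_unitCircle hz)]
    congr 1
    · congr 1; ring
    · simp only [symbol]
      rw [← Complex.exp_add, inv_inv]
      congr 1
      simp only [Complex.ofReal_zero, zero_mul, potential_zero, sub_zero, add_zero]
      ring
  have h3 := Complex.hasSum_re h
  rw [h2] at h3
  refine h3.congr_fun fun w => ?_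
  rw [show cf (fun z => z ^ p' * symbol κ 1 β 0 0 z) w = _ from cf_zpow_mul _ _ _,
    show cf (fun z => z ^ p * symbol κ 1 α 0 0 z) w = _ from cf_zpow_mul _ _ _,
    (isRealSymbol_symbol _ _ _ _ _).conj_cf, (isRealSymbol_symbol κ 1 β 0 0).cf_eq,
    (isRealSymbol_symbol κ 1 α 0 0).cf_eq, ← Complex.ofReal_mul, Complex.ofReal_re,
    Complex.ofReal_re, Complex.ofReal_re, mul_comm]

/-- The one-line weights through the central slice, with positions confined to a window. -/
noncomputable def windowSum (κ : ℝ) (L N a b : ℕ) (p p' : ℤ) : ℝ :=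
  ∑ w ∈ Finset.Ioc (-(L : ℤ)) (N : ℤ), zcoeff (homogeneousSeries κ 0 a) (w - p) *
    zcoeff (homogeneousSeries κ 0 b) (w - p')

/-- Dominated convergence, with the coefficients at infinite times as majorant. The upper end of the
window recedes; the lower end is harmless because the first factor vanishes for `w < p`. -/
theorem tendsto_windowSum (h0 : 0 < κ) (h1 : κ < 1) {a b : ℕ → ℕ} {α β : ℝ}
    (ha : Tendsto (fun n => κ ^ (2 * a n)) atTop (𝓝 α))
    (hb : Tendsto (fun n => κ ^ (2 * b n)) atTop (𝓝 β)) {L : ℕ} {p p' : ℤ} (hp : -(L : ℤ) < p) :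
    Tendsto (fun N => windowSum κ L N (a N) (b N) p p') atTop
      (𝓝 (cf (symbol κ 1 α 1 β) (p' - p)).re) := by
  have hα : α ∈ Set.Icc (0 : ℝ) 1 :=
    isClosed_Icc.mem_of_tendsto ha (Eventually.of_forall fun _ => pow_mem_Icc h0 h1 _)
  have hβ : β ∈ Set.Icc (0 : ℝ) 1 :=
    isClosed_Icc.mem_of_tendsto hb (Eventually.of_forall fun _ => pow_mem_Icc h0 h1 _)
  rw [← (hasSum_symbol_coeff_mul h0 h1 hα hβ p p').tsum_eq]
  have hsum := hasSum_symbol_coeff_mul h0 h1 zero_mem_Icc zero_mem_Icc p p'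
  have hA : ∀ k, Tendsto (fun n => zcoeff (homogeneousSeries κ 0 (a n)) k) atTop
      (𝓝 (cf (symbol κ 1 α 0 0) k).re) := fun k => by
    simpa using tendsto_zcoeff h0 h1 (Eventually.of_forall fun n => Nat.zero_le (a n)) ha k
  have hB : ∀ k, Tendsto (fun n => zcoeff (homogeneousSeries κ 0 (b n)) k) atTop
      (𝓝 (cf (symbol κ 1 β 0 0) k).re) := fun k => by
    simpa using tendsto_zcoeff h0 h1 (Eventually.of_forall fun n => Nat.zero_le (b n)) hb k
  have hle : ∀ (n : ℕ) k, zcoeff (homogeneousSeries κ 0 n) k ≤ (cf (symbol κ 1 0 0 0) k).re :=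
    fun n k => by simpa using zcoeff_le_limit h0 h1 (Nat.zero_le n) k
  have hnn : ∀ (n : ℕ) k, 0 ≤ zcoeff (homogeneousSeries κ 0 n) k :=
    fun n k => zcoeff_homogeneousSeries_nonneg h0 (Nat.zero_le n) k
  have heq : ∀ N, windowSum κ L N (a N) (b N) p p' =
      ∑' w : ℤ, (Finset.Ioc (-(L : ℤ)) (N : ℤ) : Set ℤ).indicator (fun w =>
        zcoeff (homogeneousSeries κ 0 (a N)) (w - p) *
          zcoeff (homogeneousSeries κ 0 (b N)) (w - p')) w := by
    intro N
    rw [windowSum, sum_eq_tsum_indicator]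
  simp_rw [heq]
  refine tendsto_tsum_of_dominated_convergence hsum.summable (fun w => ?_)
    (Eventually.of_forall fun N w => ?_)
  · have hlim := (hA (w - p)).mul (hB (w - p'))
    refine hlim.congr' ?_
    filter_upwards [eventually_ge_atTop w.toNat] with N hN
    by_cases hw : -(L : ℤ) < w
    · rw [Set.indicator_of_mem]
      rw [Finset.mem_coe, Finset.mem_Ioc]
      exact ⟨hw, by omega⟩
    · rw [Set.indicator_of_notMem, zcoeff_of_neg _ (by omega), zero_mul]
      rw [Finset.mem_coe, Finset.mem_Ioc]
      exact fun h => hw h.1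
  · refine (norm_indicator_le_norm_self _ w).trans ?_
    rw [Real.norm_of_nonneg (mul_nonneg (hnn _ _) (hnn _ _))]
    exact mul_le_mul (hle _ _) (hle _ _) (hnn _ _) ((hnn 0 _).trans (hle 0 _))

/-- The entries of the transfer matrices between the times `s ≤ t`. -/
noncomputable def lineWeight (κ : ℝ) (L N : ℕ) (s t : ℤ) (p p' : ℤ) : ℝ :=
  if t ≤ 0 then zcoeff (homogeneousSeries κ (-t).toNat (-s).toNat) (p' - p)
  else if 0 ≤ s then zcoeff (homogeneousSeries κ s.toNat t.toNat) (p - p')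
  else windowSum κ L N (-s).toNat t.toNat p p'

theorem transfer_eq_lineWeight (hκ : κ ≠ 0) {L N : ℕ} {s t : ℤ} (hs : -(N : ℤ) ≤ s) (hst : s ≤ t)
    {i j : ℕ} (hi : (i : ℤ) = s + N) (hj : (j : ℤ) = t + N) (p p' : Window L N) :
    transfer (step κ L N) i j p p' = lineWeight κ L N s t p p' := by
  rw [lineWeight]
  split_ifs with h1 h2
  · have e1 : i = N - (-s).toNat := by omega
    have e2 : j = N - (-t).toNat := by omega
    rw [e1, e2, transfer_left hκ (by omega) (by omega)]
  · have e1 : i = N + s.toNat := by omega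
    have e2 : j = N + t.toNat := by omega
    rw [e1, e2, transfer_right hκ (by omega)]
  · have e1 : i = N - (-s).toNat := by omega
    have e2 : j = N + t.toNat := by omega
    rw [e1, e2, transfer_mixed hκ (by omega), windowSum]
    exact Finset.sum_coe_sort _ fun w => zcoeff (homogeneousSeries κ 0 (-s).toNat) (w - p) *
      zcoeff (homogeneousSeries κ 0 t.toNat) (w - p')

/-- A possibly infinite initial time, in a chain of size `N`. -/
def startTime (s : Option ℤ) (N : ℕ) : ℤ := s.elim (-(N : ℤ)) id

/-- A possibly infinite final time, in a chain of size `N`. -/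
def endTime (t : Option ℤ) (N : ℕ) : ℤ := t.elim (N : ℤ) id

/-- The symbol of the transfer between two possibly infinite times. -/
noncomputable def transferSymbol (κ : ℝ) (s t : Option ℤ) : ℂ → ℂ :=
  symbol κ (t.elim 1 fun t => κ ^ (2 * (-t).toNat)) (s.elim 0 fun s => κ ^ (2 * (-s).toNat))
    (s.elim 1 fun s => κ ^ (2 * s.toNat)) (t.elim 0 fun t => κ ^ (2 * t.toNat))

theorem symbol_one_cancel (κ α β : ℝ) : symbol κ α β 1 1 = symbol κ α β 0 0 := by
  ext z; simp [symbol]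

/-- The three cases of `lineWeight`. When both times lie on the same side of the corner, the
parameters of the other side are equal and their potentials cancel. -/
theorem tendsto_lineWeight (h0 : 0 < κ) (h1 : κ < 1) (s t : Option ℤ)
    (hst : ∀ s' ∈ s, ∀ t' ∈ t, s' ≤ t') {L : ℕ} {p p' : ℤ} (hp : -(L : ℤ) < p) :
    Tendsto (fun N => lineWeight κ L N (startTime s N) (endTime t N) p p') atTop
      (𝓝 (cf (transferSymbol κ s t) (p' - p)).re) := by
  have hs : Tendsto (fun N => κ ^ (2 * (-(startTime s N)).toNat)) atTop
      (𝓝 (s.elim 0 fun s => κ ^ (2 * (-s).toNat))) := by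
    cases s with
    | none =>
      refine tendsto_pow_two_mul h0 h1 ?_
      simp only [startTime, Option.elim, neg_neg, Int.toNat_natCast]
      exact tendsto_id
    | some s => exact tendsto_const_nhds
  have ht : Tendsto (fun N => κ ^ (2 * (endTime t N).toNat)) atTop
      (𝓝 (t.elim 0 fun t => κ ^ (2 * t.toNat))) := by
    cases t with
    | none =>
      refine tendsto_pow_two_mul h0 h1 ?_
      simp only [endTime, Option.elim, Int.toNat_natCast]
      exact tendsto_id
    | some t => exact tendsto_const_nhds
  by_cases hl : ∃ t', t = some t' ∧ t' ≤ 0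
  · obtain ⟨t', rfl, ht'⟩ := hl
    have e1 : (s.elim 1 fun s => κ ^ (2 * s.toNat)) = 1 := by
      cases s with
      | none => rfl
      | some s =>
        have : s.toNat = 0 := by have := hst s rfl t' rfl; omega
        simp [this]
    have e2 : t'.toNat = 0 := by omega
    simp only [transferSymbol, Option.elim_some, e1, e2, mul_zero, pow_zero, symbol_one_cancel]
    have h := tendsto_zcoeff h0 h1 (a := (-t').toNat) (b := fun N => (-(startTime s N)).toNat) (by
      cases s with
      | none =>
        filter_upwards [eventually_ge_atTop (-t').toNat] with N hN
        simp only [startTime, Option.elim]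
        omega
      | some s =>
        refine Eventually.of_forall fun N => ?_
        have := hst s rfl t' rfl
        simp only [startTime, Option.elim, id]
        omega) hs (p' - p)
    refine h.congr fun N => ?_
    simp only [lineWeight, endTime, Option.elim, id, ht', if_true]
  by_cases hr : ∃ s', s = some s' ∧ 0 ≤ s'
  · obtain ⟨s', rfl, hs'⟩ := hr
    have hpos : ∀ t', t = some t' → 0 < t' := fun t' h => by
      by_contra h'; exact hl ⟨t', h, not_lt.1 h'⟩
    have e1 : (t.elim 1 fun t => κ ^ (2 * (-t).toNat)) = 1 := by
      cases t with
      | none => rfl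
      | some t =>
        have : (-t).toNat = 0 := by have := hpos t rfl; omega
        simp [this]
    have e2 : (-s').toNat = 0 := by omega
    simp only [transferSymbol, Option.elim_some, e1, e2, mul_zero, pow_zero]
    have h := tendsto_zcoeff h0 h1 (a := s'.toNat) (b := fun N => (endTime t N).toNat) (by
      cases t with
      | none =>
        filter_upwards [eventually_ge_atTop s'.toNat] with N hN
        simp only [endTime, Option.elim]
        omega
      | some t =>
        refine Eventually.of_forall fun N => ?_
        have := hst s' rfl t rfl
        simp only [endTime, Option.elim, id]
        omega) ht (p - p')
    -- After time 0 the lines move down, so the symbol is a function of 1/z and the frequency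
    -- changes sign.
    have e3 : cf (symbol κ 1 1 (κ ^ (2 * s'.toNat)) (t.elim 0 fun t => κ ^ (2 * t.toNat))) (p' - p) =
        cf (symbol κ (κ ^ (2 * s'.toNat)) (t.elim 0 fun t => κ ^ (2 * t.toNat)) 0 0) (p - p') := by
      rw [show p - p' = -(p' - p) by ring, ← cf_inv]
      refine cf_congr (fun z _ => ?_) _
      simp [symbol]
    change Tendsto _ _ (𝓝 (cf (symbol κ 1 1 (κ ^ (2 * s'.toNat))
      (t.elim 0 fun t => κ ^ (2 * t.toNat))) (p' - p)).re)
    rw [e3]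
    refine h.congr' ?_
    filter_upwards [eventually_gt_atTop 0] with N hN
    have e4 : ¬ endTime t N ≤ 0 := by
      cases t with
      | none => simp only [endTime, Option.elim]; omega
      | some t => have := hpos t rfl; simp only [endTime, Option.elim, id]; omega
    simp only [lineWeight, e4, if_false, startTime, Option.elim, id, hs', if_true]
  · have hpos : ∀ t', t = some t' → 0 < t' := fun t' h => by
      by_contra h'; exact hl ⟨t', h, not_lt.1 h'⟩
    have hneg : ∀ s', s = some s' → s' < 0 := fun s' h => by
      by_contra h'; exact hr ⟨s', h, not_lt.1 h'⟩
    have e1 : (t.elim 1 fun t => κ ^ (2 * (-t).toNat)) = 1 := by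
      cases t with
      | none => rfl
      | some t =>
        have : (-t).toNat = 0 := by have := hpos t rfl; omega
        simp [this]
    have e2 : (s.elim 1 fun s => κ ^ (2 * s.toNat)) = 1 := by
      cases s with
      | none => rfl
      | some s =>
        have : s.toNat = 0 := by have := hneg s rfl; omega
        simp [this]
    simp only [transferSymbol, e1, e2]
    refine (tendsto_windowSum h0 h1 hs ht hp).congr' ?_
    filter_upwards [eventually_gt_atTop 0] with N hN
    have e4 : ¬ endTime t N ≤ 0 := by
      cases t with
      | none => simp only [endTime, Option.elim]; omega
      | some t => have := hpos t rfl; simp only [endTime, Option.elim, id]; omega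
    have e5 : ¬ 0 ≤ startTime s N := by
      cases s with
      | none => simp only [startTime, Option.elim]; omega
      | some s => have := hneg s rfl; simp only [startTime, Option.elim, id]; omega
    simp only [lineWeight, e4, e5, if_false]

end OneLineLimits

end FacetedCrystal

namespace FacetedCrystal

/-! ### The kernel of finitely many lines -/

section BoxLimit

variable {κ : ℝ}

/-- The Fourier coefficients of the transfer between two possibly infinite times. -/
noncomputable def lineCoeff (κ : ℝ) (s t : Option ℤ) (d : ℤ) : ℝ := (cf (transferSymbol κ s t) d).re

/-- The kernel built from one-line weights `w` and the Gram matrix of `L` lines. -/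
noncomputable def gramKernel {L : ℕ} (G : Matrix (Fin L) (Fin L) ℝ)
    (w : Option ℤ → Option ℤ → ℤ → ℤ → ℝ) (x y : ℤ × ℤ) : ℝ :=
  ∑ l, (∑ m, w (some x.2) none x.1 (-((m : Fin L) : ℤ)) * G⁻¹ m l) *
    w none (some y.2) (-((l : Fin L) : ℤ)) y.1 -
    if x.2 < y.2 then w (some x.2) (some y.2) x.1 y.1 else 0

/-- The one-line weights in a box. -/
noncomputable def boxWeight (κ : ℝ) (L N : ℕ) (s t : Option ℤ) (p p' : ℤ) : ℝ :=
  lineWeight κ L N (startTime s N) (endTime t N) p p'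

/-- The Gram matrix of `L` lines without height restriction. -/
noncomputable def lineGram (κ : ℝ) (L : ℕ) : Matrix (Fin L) (Fin L) ℝ :=
  Matrix.of fun l m => lineCoeff κ none none ((l : ℤ) - m)

/-- The kernel of `L` lines without height restriction. -/
noncomputable def lineKernel (κ : ℝ) (L : ℕ) : ℤ × ℤ → ℤ × ℤ → ℝ :=
  gramKernel (lineGram κ L) fun s t p p' => lineCoeff κ s t (p' - p)

theorem boxGram_apply (hκ : κ ≠ 0) (L N : ℕ) (l m : Fin L) :
    boxGram κ L N l m = boxWeight κ L N none none (-(l : ℤ)) (-(m : ℤ)) := by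
  rw [boxGram, Matrix.submatrix_apply, transfer_eq_lineWeight hκ (s := -(N : ℤ)) (t := N) le_rfl
    (by omega) (by simp) (by push_cast; ring)]
  rfl

open Classical in
theorem sum_box_prod_eq_det (h0 : 0 < κ) {L N r : ℕ} {p : Fin r → ℤ × ℤ}
    (hp : Function.Injective p) (hL : ∀ k, -(L : ℤ) < (p k).1) (hN : ∀ k, (p k).1 ≤ N)
    (ht : ∀ k, -(N : ℤ) < (p k).2) (ht' : ∀ k, (p k).2 ≤ N) :
    ∑ h : {h : Height // InBox L N h}, κ ^ (2 * volume h.1) *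
        ∏ k, ind ℝ (∃ l : Fin L, gradientLine h.1 l (p k).2 = (p k).1) =
      (boxGram κ L N).det *
        (Matrix.of fun k k' => gramKernel (boxGram κ L N) (boxWeight κ L N) (p k) (p k')).det := by
  -- A mark in layer `σ k` acts on slice `σ k + 1`, which is time `σ k + 1 - N`.
  let σ : Fin r → ℕ := fun k => ((p k).2 + N - 1).toNat
  let pos : Fin r → Window L N := fun k => ⟨(p k).1, Finset.mem_Ioc.2 ⟨hL k, hN k⟩⟩
  have hσ : ∀ k, ((σ k : ℕ) : ℤ) = (p k).2 + N - 1 := fun k =>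
    Int.toNat_of_nonneg (by have := ht k; omega)
  have h := sum_box_prod_eq h0 L N σ pos (fun k => by have := hσ k; have := ht' k; omega)
    (fun k k' hk => by
      rw [Prod.mk.injEq] at hk
      refine hp (Prod.ext ?_ ?_)
      · exact congrArg Subtype.val hk.2
      · have e1 := hσ k
        have e2 := hσ k'
        rw [hk.1] at e1
        omega)
  have e : ∀ k, ((σ k : ℕ) : ℤ) + 1 - N = (p k).2 := fun k => by rw [hσ k]; ring
  simp only [e] at h
  refine h.trans ?_
  congr 2
  ext k k'
  have hk := ht k; have hk' := ht' k; have hl := ht k'; have hl' := ht' k'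
  have sk := hσ k; have sk' := hσ k'
  simp only [layerKernel, gramKernel, Matrix.sub_apply, Matrix.of_apply, Matrix.mul_apply]
  congr 1
  · refine Finset.sum_congr rfl fun l _ => ?_
    congr 1
    · refine Finset.sum_congr rfl fun m _ => ?_
      congr 1
      rw [transfer_eq_lineWeight h0.ne' (s := (p k).2) (t := N) (by omega)
        (by omega) (by push_cast; omega) (by push_cast; ring)]
      rfl
    · rw [transfer_eq_lineWeight h0.ne' (s := -(N : ℤ)) (t := (p k').2) (by omega)
        (by omega) (by push_cast; omega) (by push_cast; omega)]
      rfl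
  · have e3 : σ k < σ k' ↔ (p k).2 < (p k').2 := by omega
    simp only [e3]
    split_ifs with hlt
    · rw [transfer_eq_lineWeight h0.ne' (s := (p k).2) (t := (p k').2) (by omega)
        (by omega) (by push_cast; omega) (by push_cast; omega)]
      rfl
    · rfl

theorem tendsto_boxWeight (h0 : 0 < κ) (h1 : κ < 1) (s t : Option ℤ)
    (hst : ∀ s' ∈ s, ∀ t' ∈ t, s' ≤ t') {L : ℕ} {p p' : ℤ} (hp : -(L : ℤ) < p) :
    Tendsto (fun N => boxWeight κ L N s t p p') atTop (𝓝 (lineCoeff κ s t (p' - p))) :=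
  tendsto_lineWeight h0 h1 s t hst hp

theorem tendsto_boxGram (h0 : 0 < κ) (h1 : κ < 1) (L : ℕ) :
    Tendsto (fun N => boxGram κ L N) atTop (𝓝 (lineGram κ L)) := by
  refine tendsto_pi_nhds.2 fun l => tendsto_pi_nhds.2 fun m => ?_
  simp_rw [boxGram_apply h0.ne']
  have h := tendsto_boxWeight h0 h1 none none (by simp) (L := L) (p := -(l : ℤ)) (p' := -(m : ℤ))
    (by have := l.2; omega)
  rwa [show -(m : ℤ) - -(l : ℤ) = l - m by ring] at h

theorem tendsto_det_boxGram (h0 : 0 < κ) (h1 : κ < 1) (L : ℕ) :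
    Tendsto (fun N => (boxGram κ L N).det) atTop (𝓝 (lineGram κ L).det) :=
  ((continuous_id.matrix_det).tendsto _).comp (tendsto_boxGram h0 h1 L)

theorem one_le_det_lineGram (h0 : 0 < κ) (h1 : κ < 1) (L : ℕ) : 1 ≤ (lineGram κ L).det :=
  ge_of_tendsto (tendsto_det_boxGram h0 h1 L)
    (Eventually.of_forall fun N => one_le_det_boxGram h0 L N)

theorem tendsto_inv_boxGram (h0 : 0 < κ) (h1 : κ < 1) (L : ℕ) :
    Tendsto (fun N => (boxGram κ L N)⁻¹) atTop (𝓝 (lineGram κ L)⁻¹) := by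
  simp_rw [Matrix.inv_def, Ring.inverse_eq_inv']
  exact ((tendsto_det_boxGram h0 h1 L).inv₀
    ((one_le_det_lineGram h0 h1 L).trans_lt' one_pos).ne').smul
    (((continuous_id.matrix_adjugate).tendsto _).comp (tendsto_boxGram h0 h1 L))

theorem tendsto_boxKernel (h0 : 0 < κ) (h1 : κ < 1) (L : ℕ) {x y : ℤ × ℤ} (hx : -(L : ℤ) < x.1) :
    Tendsto (fun N => gramKernel (boxGram κ L N) (boxWeight κ L N) x y) atTop
      (𝓝 (lineKernel κ L x y)) := by
  have hinv' := fun m => tendsto_pi_nhds.1 (tendsto_pi_nhds.1 (tendsto_inv_boxGram h0 h1 L) m)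
  unfold lineKernel gramKernel
  refine Tendsto.sub (tendsto_finsetSum _ fun l _ => Tendsto.mul (tendsto_finsetSum _ fun m _ =>
    Tendsto.mul ?_ (hinv' m l)) ?_) ?_
  · exact tendsto_boxWeight h0 h1 _ _ (by simp) hx
  · exact tendsto_boxWeight h0 h1 _ _ (by simp) (by have := l.2; omega)
  · split_ifs with h
    · exact tendsto_boxWeight h0 h1 _ _ (by simpa using h.le) hx
    · exact tendsto_const_nhds

end BoxLimit

/-! ### Crystals with finitely many nontrivial lines -/

section DiagonalSums

variable {κ : ℝ}

/-- The crystals with at most `L` nontrivial lines. -/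
def fewLines (L : ℕ) : Set Height := {h | h.1 (L, L) = 0}

theorem eventually_inBox {L : ℕ} {h : Height} (hL : h ∈ fewLines L) : ∀ᶠ N in atTop, InBox L N h := by
  have key : ∀ f : ℕ → ℕ × ℕ, Function.Injective f → ∀ᶠ N in atTop, h.1 (f N) = 0 := by
    intro f hf
    have h2 : ∀ᶠ x in cofinite, h.1 x = 0 := h.1.hasFiniteSupport
    rw [← Nat.cofinite_eq_atTop]
    exact hf.tendsto_cofinite.eventually h2
  filter_upwards [key (fun N => (0, N)) (fun a b hab => (Prod.mk.inj hab).2),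
    key (fun N => (N, 0)) (fun a b hab => (Prod.mk.inj hab).1),
    eventually_ge_atTop (h.1 (0, 0))] with N hN hN' hN''
  exact ⟨hN, hN', hL, hN''⟩

theorem hasSum_box (L N : ℕ) (f : Height → ℝ) :
    HasSum ({h | InBox L N h}.indicator f) (∑ h : {h : Height // InBox L N h}, f h.1) :=
  hasSum_subtype_iff_indicator.1
    (hasSum_fintype fun h : {h : Height // InBox L N h} => f h.1)

/-- A finite set of such crystals eventually fits into the boxes, so its total weight is at most the
limit of the box partition functions. -/
theorem summable_fewLines (h0 : 0 < κ) (h1 : κ < 1) (L : ℕ) :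
    Summable ((fewLines L).indicator fun h => κ ^ (2 * volume h)) := by
  have hnn : ∀ (s : Set Height) h, 0 ≤ s.indicator (fun h => κ ^ (2 * volume h)) h := fun s h =>
    Set.indicator_nonneg (fun h _ => (pow_pos h0 _).le) h
  refine summable_of_sum_le (c := (lineGram κ L).det) (hnn _) fun u => ?_
  refine ge_of_tendsto (tendsto_det_boxGram h0 h1 L) ?_
  have hu : ∀ᶠ N in atTop, ∀ h ∈ u, h ∈ fewLines L → InBox L N h := by
    rw [Filter.eventually_all_finset]
    intro h _
    by_cases hh : h ∈ fewLines L
    · exact (eventually_inBox hh).mono fun N hN _ => hN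
    · exact Eventually.of_forall fun N h' => absurd h' hh
  filter_upwards [hu] with N hN
  rw [← sum_box_eq_det_boxGram h0.ne']
  refine le_trans (Finset.sum_le_sum fun h hh => ?_)
    (sum_le_hasSum u (fun h _ => hnn _ h) (hasSum_box L N fun h => κ ^ (2 * volume h)))
  by_cases hl : h ∈ fewLines L
  · rw [Set.indicator_of_mem hl,
      Set.indicator_of_mem (show h ∈ {h | InBox L N h} from hN h hh hl)]
  · rw [Set.indicator_of_notMem hl]
    exact hnn _ h

theorem tendsto_box_sum (h0 : 0 < κ) (h1 : κ < 1) (L : ℕ) {f : Height → ℝ}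
    (hf : ∀ h, |f h| ≤ 1) :
    Tendsto (fun N => ∑ h : {h : Height // InBox L N h}, κ ^ (2 * volume h.1) * f h.1) atTop
      (𝓝 (∑' h, (fewLines L).indicator (fun h => κ ^ (2 * volume h) * f h) h)) := by
  have e : ∀ N, ∑ h : {h : Height // InBox L N h}, κ ^ (2 * volume h.1) * f h.1 =
      ∑' h, {h | InBox L N h}.indicator (fun h => κ ^ (2 * volume h) * f h) h := fun N =>
    (hasSum_box L N fun h => κ ^ (2 * volume h) * f h).tsum_eq.symm
  simp_rw [e]
  refine tendsto_tsum_of_dominated_convergence (summable_fewLines h0 h1 L) (fun h => ?_)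
    (Eventually.of_forall fun N h => ?_)
  · refine tendsto_const_nhds.congr' ?_
    by_cases hl : h ∈ fewLines L
    · filter_upwards [eventually_inBox hl] with N hN
      rw [Set.indicator_of_mem hl, Set.indicator_of_mem (show h ∈ {h | InBox L N h} from hN)]
    · refine Eventually.of_forall fun N => ?_
      simp only
      rw [Set.indicator_of_notMem hl, Set.indicator_of_notMem]
      exact fun hb => hl hb.diag
  · by_cases hb : InBox L N h
    · rw [Set.indicator_of_mem (show h ∈ {h | InBox L N h} from hb),
        Set.indicator_of_mem (show h ∈ fewLines L from hb.diag), norm_mul, Real.norm_eq_abs,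
        Real.norm_eq_abs, abs_of_pos (pow_pos h0 _)]
      exact mul_le_of_le_one_right (pow_pos h0 _).le (hf h)
    · rw [Set.indicator_of_notMem (show h ∉ {h | InBox L N h} from hb), norm_zero]
      exact Set.indicator_nonneg (fun h _ => (pow_pos h0 _).le) h

theorem tsum_fewLines (h0 : 0 < κ) (h1 : κ < 1) (L : ℕ) :
    ∑' h, (fewLines L).indicator (fun h => κ ^ (2 * volume h)) h = (lineGram κ L).det := by
  have h := tendsto_box_sum h0 h1 L (f := fun _ => 1) (by simp)
  simp only [mul_one] at h
  simp_rw [sum_box_eq_det_boxGram h0.ne'] at h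
  exact tendsto_nhds_unique h (tendsto_det_boxGram h0 h1 L)

theorem ind_nonneg (p : Prop) : 0 ≤ ind ℝ p := by
  by_cases h : p
  · rw [ind_of h]; exact zero_le_one
  · rw [ind_of_not h]

theorem ind_le_one (p : Prop) : ind ℝ p ≤ 1 := by
  by_cases h : p
  · rw [ind_of h]
  · rw [ind_of_not h]; exact zero_le_one

theorem abs_prod_ind_le {r : ℕ} (q : Fin r → Prop) : |∏ k, ind ℝ (q k)| ≤ 1 := by
  rw [abs_of_nonneg (Finset.prod_nonneg fun k _ => ind_nonneg _)]
  exact Finset.prod_le_one (fun k _ => ind_nonneg _) fun k _ => ind_le_one _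

/-- Lines with label `l ≥ L` rest at `-l`, below every position considered here. -/
theorem occupied_iff {L : ℕ} {h : Height} (hL : h ∈ fewLines L) {p : ℤ × ℤ} (hp : -(L : ℤ) < p.1) :
    (∃ l : Fin L, gradientLine h l p.2 = p.1) ↔ ∃ l : ℕ, gradientLine h l p.2 = p.1 := by
  refine ⟨fun ⟨l, hl⟩ => ⟨l, hl⟩, fun ⟨l, hl⟩ => ?_⟩
  by_cases hlL : l < L
  · exact ⟨⟨l, hlL⟩, hl⟩
  · exfalso
    have h2 : h.1 (linePoint l p.2) = 0 := by
      refine Height.eq_zero_of_le (x := (L, L)) hL ⟨?_, ?_⟩ <;> simp only [linePoint] <;> omega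
    rw [gradientLine_eq, h2] at hl
    omega

/-- The correlation functions of the crystals with at most `L` nontrivial lines. -/
theorem tsum_fewLines_prod (h0 : 0 < κ) (h1 : κ < 1) {L r : ℕ} {p : Fin r → ℤ × ℤ}
    (hp : Function.Injective p) (hL : ∀ k, -(L : ℤ) < (p k).1) :
    ∑' h, (fewLines L).indicator (fun h => κ ^ (2 * volume h) *
        ∏ k, ind ℝ (∃ l : ℕ, gradientLine h l (p k).2 = (p k).1)) h =
      (lineGram κ L).det * (Matrix.of fun k k' => lineKernel κ L (p k) (p k')).det := by
  have h := tendsto_box_sum h0 h1 L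
    (f := fun h => ∏ k, ind ℝ (∃ l : ℕ, gradientLine h l (p k).2 = (p k).1))
    fun h => abs_prod_ind_le _
  refine tendsto_nhds_unique h ?_
  have hdet : Tendsto (fun N => (Matrix.of fun k k' =>
      gramKernel (boxGram κ L N) (boxWeight κ L N) (p k) (p k')).det) atTop
      (𝓝 (Matrix.of fun k k' => lineKernel κ L (p k) (p k')).det) := by
    refine ((continuous_id.matrix_det).tendsto _).comp ?_
    refine tendsto_pi_nhds.2 fun k => tendsto_pi_nhds.2 fun k' => ?_
    exact tendsto_boxKernel h0 h1 L (hL k)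
  refine ((tendsto_det_boxGram h0 h1 L).mul hdet).congr' ?_
  have hev : ∀ᶠ N : ℕ in atTop, ∀ k, (p k).1 ≤ N ∧ -(N : ℤ) < (p k).2 ∧ (p k).2 ≤ N := by
    rw [Filter.eventually_all]
    intro k
    filter_upwards [eventually_gt_atTop ((p k).1.natAbs + (p k).2.natAbs)] with N hN
    omega
  filter_upwards [hev] with N hN
  rw [← sum_box_prod_eq_det h0 hp hL (fun k => (hN k).1) (fun k => (hN k).2.1)
    fun k => (hN k).2.2]
  refine Finset.sum_congr rfl fun h _ => ?_
  congr 1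
  refine Finset.prod_congr rfl fun k _ => ?_
  rw [occupied_iff (show h.1 ∈ fewLines L from h.2.diag) (hL k)]

end DiagonalSums

end FacetedCrystal

namespace FacetedCrystal

/-! ### Finiteness of the partition function -/

section PartitionFunction

variable {κ : ℝ}

theorem exists_mem_fewLines (h : Height) : ∃ L, h ∈ fewLines L := by
  have hf : Function.Injective fun N : ℕ => (N, N) := fun a b hab => (Prod.mk.inj hab).1
  have h2 : ∀ᶠ x in cofinite, h.1 x = 0 := h.1.hasFiniteSupport
  have h3 := hf.tendsto_cofinite.eventually h2
  rw [Nat.cofinite_eq_atTop] at h3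
  exact h3.exists

open Classical in
/-- The number of nontrivial lines. -/
noncomputable def lineCount (h : Height) : ℕ := Nat.find (exists_mem_fewLines h)

theorem mem_fewLines_lineCount (h : Height) : h ∈ fewLines (lineCount h) := by
  classical
  exact Nat.find_spec (exists_mem_fewLines h)

theorem mem_fewLines_mono {h : Height} {L L' : ℕ} (hL : h ∈ fewLines L) (hLL : L ≤ L') :
    h ∈ fewLines L' :=
  Height.eq_zero_of_le (x := (L, L)) hL ⟨hLL, hLL⟩

/-- The square of side `lineCount h` lies in the support of `h`, and each of its points has height
at least one. -/
theorem lineCount_sq_le_volume (h : Height) : lineCount h ^ 2 ≤ volume h := by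
  classical
  have hsub : Finset.range (lineCount h) ×ˢ Finset.range (lineCount h) ⊆ h.1.support := by
    rintro ⟨i, j⟩ hx
    rw [Finset.mem_product, Finset.mem_range, Finset.mem_range] at hx
    rw [Finsupp.mem_support_iff]
    intro h0
    have hm := Nat.find_min (exists_mem_fewLines h) (m := max i j) (max_lt hx.1 hx.2)
    exact hm (Height.eq_zero_of_le h0 ⟨le_max_left _ _, le_max_right _ _⟩)
  have hcard := Finset.card_le_card hsub
  rw [Finset.card_product, Finset.card_range, ← sq] at hcard
  refine hcard.trans ?_
  rw [volume, Finsupp.sum, Finset.card_eq_sum_ones]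
  exact Finset.sum_le_sum fun x hx => Nat.one_le_iff_ne_zero.2 (Finsupp.mem_support_iff.1 hx)

theorem det_lineGram_le (h0 : 0 < κ) (h1 : κ < 1) (L : ℕ) :
    (lineGram κ L).det ≤ L.factorial * Real.exp (4 * potentialBound κ) ^ L := by
  have hb : ∀ i j, |lineGram κ L i j| ≤ Real.exp (4 * potentialBound κ) := fun i j =>
    (Complex.abs_re_le_norm _).trans (norm_cf_le (fun z hz => norm_symbol_le h0 h1
      one_mem_Icc zero_mem_Icc one_mem_Icc zero_mem_Icc hz) _)
  have h := Matrix.det_le (abv := IsAbsoluteValue.toAbsoluteValue (abs : ℝ → ℝ)) hb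
  rw [Fintype.card_fin, nsmul_eq_mul] at h
  exact (le_abs_self _).trans h

theorem summable_factorial_mul_pow (h0 : 0 < κ) (h1 : κ < 1) {C : ℝ} (hC : 0 < C) :
    Summable fun L : ℕ => κ ^ L ^ 2 * ((L.factorial : ℝ) * C ^ L) := by
  have hpos : ∀ L : ℕ, 0 < κ ^ L ^ 2 * ((L.factorial : ℝ) * C ^ L) := fun L => by positivity
  refine summable_of_ratio_test_tendsto_lt_one (l := 0) zero_lt_one
    (Eventually.of_forall fun L => (hpos L).ne') ?_
  have e : ∀ L : ℕ, ‖κ ^ (L + 1) ^ 2 * (((L + 1).factorial : ℝ) * C ^ (L + 1))‖ /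
      ‖κ ^ L ^ 2 * ((L.factorial : ℝ) * C ^ L)‖ =
      κ ^ (L + 1) * (κ⁻¹ * C * (((L : ℝ) + 1) * κ ^ (L + 1))) := by
    intro L
    rw [Real.norm_of_nonneg (hpos _).le, Real.norm_of_nonneg (hpos _).le, div_eq_iff (hpos _).ne',
      Nat.factorial_succ, show (L + 1) ^ 2 = L + 1 + (L + L ^ 2) by ring]
    push_cast
    field_simp
    ring
  simp_rw [e]
  have h2 : Tendsto (fun L : ℕ => κ ^ (L + 1)) atTop (𝓝 0) :=
    (tendsto_pow_atTop_nhds_zero_of_lt_one h0.le h1).comp (tendsto_add_atTop_nat 1)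
  have h3 : Tendsto (fun L : ℕ => ((L : ℝ) + 1) * κ ^ (L + 1)) atTop (𝓝 0) := by
    have := (tendsto_self_mul_const_pow_of_lt_one h0.le h1).comp (tendsto_add_atTop_nat 1)
    refine this.congr fun L => ?_
    simp
  simpa using h2.mul (h3.const_mul (κ⁻¹ * C))

/-- The weight κ^(2V) is split into two factors κ^V. A crystal with L nontrivial lines has V ≥ L²,
which bounds one factor by κ^(L²). The other is the weight for the parameter √κ, whose sum over
crystals with at most L lines is a Gram determinant, at most L! C^L. The series of κ^(L²) L! C^L
converges. -/
theorem summable_weights (h0 : 0 < κ) (h1 : κ < 1) : Summable fun h : Height => κ ^ (2 * volume h) := by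
  classical
  have hs0 : 0 < √κ := Real.sqrt_pos.2 h0
  have hs1 : √κ < 1 := by rw [Real.sqrt_lt' one_pos]; simpa using h1
  have hsq : ∀ n : ℕ, √κ ^ (2 * n) = κ ^ n := fun n => by rw [pow_mul, Real.sq_sqrt h0.le]
  have hC := Real.exp_pos (4 * potentialBound √κ)
  have hsum := summable_factorial_mul_pow h0 h1 hC
  refine summable_of_sum_le (fun h => (pow_pos h0 _).le) (c := ∑' L : ℕ, κ ^ L ^ 2 *
    ((L.factorial : ℝ) * Real.exp (4 * potentialBound √κ) ^ L)) fun u => ?_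
  rw [← Finset.sum_fiberwise_of_maps_to (t := u.image lineCount)
    (fun h hh => Finset.mem_image_of_mem _ hh)]
  refine le_trans (Finset.sum_le_sum fun L _ => ?_)
    (hsum.sum_le_tsum (u.image lineCount) fun L _ => by positivity)
  have hfib : ∑ h ∈ u with lineCount h = L, κ ^ (2 * volume h) ≤
      κ ^ L ^ 2 * ∑ h ∈ u with lineCount h = L,
        (fewLines L).indicator (fun h => √κ ^ (2 * volume h)) h := by
    rw [Finset.mul_sum]
    refine Finset.sum_le_sum fun h hh => ?_
    have hl : lineCount h = L := (Finset.mem_filter.1 hh).2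
    rw [Set.indicator_of_mem (hl ▸ mem_fewLines_lineCount h), hsq, two_mul, pow_add]
    refine mul_le_mul_of_nonneg_right (pow_le_pow_of_le_one h0.le h1.le ?_) (pow_pos h0 _).le
    exact hl ▸ lineCount_sq_le_volume h
  refine hfib.trans (mul_le_mul_of_nonneg_left ?_ (pow_pos h0 _).le)
  refine le_trans ?_ (det_lineGram_le hs0 hs1 L)
  rw [← tsum_fewLines hs0 hs1 L]
  exact (summable_fewLines hs0 hs1 L).sum_le_tsum _ fun h _ =>
    Set.indicator_nonneg (fun h _ => (pow_pos hs0 _).le) h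

/-- Every crystal has finitely many nontrivial lines, and `summable_weights` dominates. -/
theorem tendsto_fewLines_sum (h0 : 0 < κ) (h1 : κ < 1) {f : Height → ℝ} (hf : ∀ h, |f h| ≤ 1) :
    Tendsto (fun L => ∑' h, (fewLines L).indicator (fun h => κ ^ (2 * volume h) * f h) h) atTop
      (𝓝 (∑' h, κ ^ (2 * volume h) * f h)) := by
  have hb : ∀ h, ‖κ ^ (2 * volume h) * f h‖ ≤ κ ^ (2 * volume h) := fun h => by
    rw [norm_mul, Real.norm_eq_abs, Real.norm_eq_abs, abs_of_pos (pow_pos h0 _)]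
    exact mul_le_of_le_one_right (pow_pos h0 _).le (hf h)
  refine tendsto_tsum_of_dominated_convergence (summable_weights h0 h1) (fun h => ?_)
    (Eventually.of_forall fun L h => (norm_indicator_le_norm_self _ h).trans (hb h))
  refine tendsto_const_nhds.congr' ?_
  filter_upwards [eventually_ge_atTop (lineCount h)] with L hL
  rw [Set.indicator_of_mem (mem_fewLines_mono (mem_fewLines_lineCount h) hL)]

/-- If the kernels with finitely many lines converge, the limit determines the correlation
functions of the crystal. -/
theorem tsum_prod_eq_det (h0 : 0 < κ) (h1 : κ < 1) {K : ℤ × ℤ → ℤ × ℤ → ℝ}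
    (hK : ∀ x y, Tendsto (fun L => lineKernel κ L x y) atTop (𝓝 (K x y))) {r : ℕ}
    {p : Fin r → ℤ × ℤ} (hp : Function.Injective p) :
    ∑' h, κ ^ (2 * volume h) * ∏ k, ind ℝ (∃ l : ℕ, gradientLine h l (p k).2 = (p k).1) =
      (∑' h, κ ^ (2 * volume h)) * (Matrix.of fun k k' => K (p k) (p k')).det := by
  refine tendsto_nhds_unique (tendsto_fewLines_sum h0 h1 fun h => abs_prod_ind_le _) ?_
  have hZ := tendsto_fewLines_sum h0 h1 (f := fun _ => 1) (by simp)
  simp only [mul_one, tsum_fewLines h0 h1] at hZ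
  have hdet : Tendsto (fun L => (Matrix.of fun k k' => lineKernel κ L (p k) (p k')).det) atTop
      (𝓝 (Matrix.of fun k k' => K (p k) (p k')).det) :=
    ((continuous_id.matrix_det).tendsto _).comp
      (tendsto_pi_nhds.2 fun k => tendsto_pi_nhds.2 fun k' => hK _ _)
  refine (hZ.mul hdet).congr' ?_
  have hev : ∀ᶠ L : ℕ in atTop, ∀ k, -(L : ℤ) < (p k).1 := by
    rw [Filter.eventually_all]
    intro k
    filter_upwards [eventually_gt_atTop ((p k).1.natAbs)] with N hN
    omega
  filter_upwards [hev] with L hL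
  rw [tsum_fewLines_prod h0 h1 hp hL]

end PartitionFunction

end FacetedCrystal

namespace FacetedCrystal

/-! ### Inverse Gram matrices and orthogonal projections -/

section GramProjection

variable {E : Type*} [NormedAddCommGroup E] [InnerProductSpace ℂ E]

/-- The normal equations: the coefficients of the projection on the spanning vectors are the inverse
Gram matrix applied to the inner products. -/
theorem inner_starProjection_span {L : ℕ} (e : Fin L → E) {M : Matrix (Fin L) (Fin L) ℂ}
    (hM : ∀ l m, M l m = inner ℂ (e l) (e m)) (hdet : M.det ≠ 0)
    [(Submodule.span ℂ (Set.range e)).HasOrthogonalProjection] (y x : E) :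
    inner ℂ y ((Submodule.span ℂ (Set.range e)).starProjection x) =
      ∑ l, (∑ m, inner ℂ y (e m) * M⁻¹ m l) * inner ℂ (e l) x := by
  let b : Fin L → ℂ := fun l => inner ℂ (e l) x
  have hproj : (Submodule.span ℂ (Set.range e)).starProjection x = ∑ m, (M⁻¹.mulVec b) m • e m := by
    refine Submodule.eq_starProjection_of_mem_orthogonal (Submodule.sum_mem _ fun m _ =>
      Submodule.smul_mem _ _ (Submodule.subset_span ⟨m, rfl⟩)) ?_
    rw [Submodule.mem_orthogonal]
    intro u hu
    induction hu using Submodule.span_induction with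
    | mem u hu =>
      obtain ⟨l, rfl⟩ := hu
      rw [inner_sub_right, inner_sum]
      simp_rw [inner_smul_right, ← hM]
      have h2 : M.mulVec (M⁻¹.mulVec b) = b := by
        rw [Matrix.mulVec_mulVec, Matrix.mul_nonsing_inv _ (isUnit_iff_ne_zero.2 hdet),
          Matrix.one_mulVec]
      have h3 := congrFun h2 l
      rw [Matrix.mulVec, dotProduct] at h3
      rw [sub_eq_zero, ← show b l = inner ℂ (e l) x from rfl, ← h3]
      exact Finset.sum_congr rfl fun m _ => mul_comm _ _
    | zero => exact inner_zero_left _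
    | add u v _ _ hu hv => rw [inner_add_left, hu, hv, add_zero]
    | smul a u _ hu => rw [inner_smul_left, hu, mul_zero]
  rw [hproj, inner_sum]
  simp_rw [inner_smul_right, Matrix.mulVec, dotProduct, Finset.sum_mul]
  rw [Finset.sum_comm]
  refine Finset.sum_congr rfl fun l _ => Finset.sum_congr rfl fun m _ => ?_
  ring

end GramProjection

/-! ### The span of the generators is the space of nonpositive frequencies -/

section HardySpace

variable {κ : ℝ}

theorem continuousOn_zpow_mul {G : ℂ → ℂ} (hG : ContinuousOn G unitCircle) (n : ℤ) :
    ContinuousOn (fun z => z ^ n * G z) unitCircle :=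
  (continuousOn_zpow_unitCircle n).mul hG

theorem symbol_inv (κ α β γ δ : ℝ) (z : ℂ) : symbol κ α β γ δ z⁻¹ = symbol κ γ δ α β z := by
  rw [symbol, symbol, inv_inv, add_comm]

/-- The boundary values of the generators of the space of co-analytic functions. -/
noncomputable def generator (κ : ℝ) (N : ℕ) (l : ℕ) (z : ℂ) : ℂ :=
  z ^ (-(l : ℤ)) * symbol κ 0 0 (κ ^ (2 * N)) 0 z

theorem continuousOn_generator (h0 : 0 < κ) (h1 : κ < 1) (N l : ℕ) :
    ContinuousOn (generator κ N l) unitCircle :=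
  continuousOn_zpow_mul (continuousOn_symbol h0 h1 zero_mem_Icc zero_mem_Icc (pow_mem_Icc h0 h1 _)
    zero_mem_Icc) _

/-- Raising the level divides out one geometric factor in 1/z, and multiplication by 1/z shifts the
label. -/
theorem generator_succ (h0 : 0 < κ) (h1 : κ < 1) (N l : ℕ) {z : ℂ} (hz : z ∈ unitCircle) :
    generator κ (N + 1) l z =
      generator κ N l z - ((κ ^ (2 * N + 1) : ℝ) : ℂ) * generator κ N (l + 1) z := by
  have hw : κ * ‖((κ ^ (2 * N) : ℝ) : ℂ) * z⁻¹‖ < 1 :=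
    (mul_le_of_le_one_right h0.le (norm_ofReal_mul_le (pow_mem_Icc h0 h1 _)
      (inv_mem_unitCircle hz))).trans_lt h1
  have h := exp_potential_sub h0 h1 hw
  have e1 : (κ : ℂ) ^ 2 * (((κ ^ (2 * N) : ℝ) : ℂ) * z⁻¹) = ((κ ^ (2 * (N + 1)) : ℝ) : ℂ) * z⁻¹ := by
    push_cast; ring
  have e2 : (κ : ℂ) * (((κ ^ (2 * N) : ℝ) : ℂ) * z⁻¹) = ((κ ^ (2 * N + 1) : ℝ) : ℂ) * z⁻¹ := by
    push_cast; ring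
  rw [e1, e2] at h
  have h3 := congrArg (fun w : ℂ => w⁻¹) h
  simp only [inv_inv, ← Complex.exp_neg, neg_sub] at h3
  have h4 : symbol κ 0 0 (κ ^ (2 * (N + 1))) 0 z =
      symbol κ 0 0 (κ ^ (2 * N)) 0 z * (1 - ((κ ^ (2 * N + 1) : ℝ) : ℂ) * z⁻¹) := by
    rw [← h3, symbol, symbol, ← Complex.exp_add]
    congr 1
    ring
  rw [generator, generator, generator, h4]
  have hz0 := ne_zero_of_mem_unitCircle hz
  have e3 : z ^ (-((l + 1 : ℕ) : ℤ)) = z ^ (-(l : ℤ)) * z⁻¹ := by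
    rw [← zpow_sub_one₀ hz0]; congr 1; push_cast; ring
  rw [e3]
  ring

/-- The span of the first `L` generators. -/
noncomputable def generatorSpan (h0 : 0 < κ) (h1 : κ < 1) (L : ℕ) : Submodule ℂ L2Circle :=
  Submodule.span ℂ (Set.range fun l : Fin L => toL2 (generator κ 0 l) (continuousOn_generator h0 h1 0 l))

noncomputable instance (h0 : 0 < κ) (h1 : κ < 1) (L : ℕ) :
    FiniteDimensional ℂ (generatorSpan h0 h1 L) :=
  FiniteDimensional.span_of_finite ℂ (Set.finite_range _)

theorem generatorSpan_mono (h0 : 0 < κ) (h1 : κ < 1) : Monotone (generatorSpan h0 h1) := by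
  intro L L' hL
  refine Submodule.span_mono ?_
  rintro _ ⟨l, rfl⟩
  exact ⟨Fin.castLE hL l, rfl⟩

/-- The closed span of all generators. -/
noncomputable def hardySpace (h0 : 0 < κ) (h1 : κ < 1) : Submodule ℂ L2Circle :=
  (⨆ L, generatorSpan h0 h1 L).topologicalClosure

instance (h0 : 0 < κ) (h1 : κ < 1) : CompleteSpace (hardySpace h0 h1) :=
  (Submodule.isClosed_topologicalClosure _).completeSpace_coe

theorem toL2_congr {G H : ℂ → ℂ} (hG : ContinuousOn G unitCircle) (hH : ContinuousOn H unitCircle)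
    (h : ∀ z ∈ unitCircle, G z = H z) : toL2 G hG = toL2 H hH := by
  have := norm_toL2_sub_le hG hH le_rfl (fun z hz => by rw [h z hz, sub_self, norm_zero])
  exact sub_eq_zero.1 (norm_eq_zero.1 (le_antisymm this (norm_nonneg _)))

theorem generator_mem (h0 : 0 < κ) (h1 : κ < 1) (N l : ℕ) :
    toL2 (generator κ N l) (continuousOn_generator h0 h1 N l) ∈ hardySpace h0 h1 := by
  induction N generalizing l with
  | zero =>
    refine Submodule.le_topologicalClosure _ (Submodule.mem_iSup_of_mem (l + 1) ?_)
    exact Submodule.subset_span ⟨⟨l, Nat.lt_succ_self l⟩, rfl⟩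
  | succ N ih =>
    have e : toL2 (generator κ (N + 1) l) (continuousOn_generator h0 h1 (N + 1) l) =
        toL2 (generator κ N l) (continuousOn_generator h0 h1 N l) - ((κ ^ (2 * N + 1) : ℝ) : ℂ) •
          toL2 (generator κ N (l + 1)) (continuousOn_generator h0 h1 N (l + 1)) := by
      rw [toL2_congr (continuousOn_generator h0 h1 (N + 1) l)
        ((continuousOn_generator h0 h1 N l).sub
          (continuousOn_const.mul (continuousOn_generator h0 h1 N (l + 1))))
        (fun z hz => generator_succ h0 h1 N l hz)]
      simp only [toL2]
      rw [← map_smul, ← map_sub]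
      rfl
    rw [e]
    exact Submodule.sub_mem _ (ih l) (Submodule.smul_mem _ _ (ih (l + 1)))

/-- By `generator_mem` the generators of every level lie in the space. As the level grows, exp
φ(κ^(2N)/z), with φ the potential, tends to 1 uniformly on the circle, so these generators approach
the monomial, and the space is closed. -/
theorem zpow_mem_hardySpace (h0 : 0 < κ) (h1 : κ < 1) (l : ℕ) :
    toL2 (fun z => z ^ (-(l : ℤ))) (continuousOn_zpow_unitCircle _) ∈ hardySpace h0 h1 := by
  have hcl : IsClosed (hardySpace h0 h1 : Set L2Circle) := Submodule.isClosed_topologicalClosure _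
  refine hcl.mem_of_tendsto (f := fun N => toL2 (generator κ N l) (continuousOn_generator h0 h1 N l))
    (b := atTop) ?_ (Eventually.of_forall fun N => generator_mem h0 h1 N l)
  rw [Metric.tendsto_nhds]
  intro ε hε
  have hcont : ContinuousAt (fun w => Complex.exp (potential κ w)) 0 :=
    Complex.continuous_exp.continuousAt.comp (continuousAt_potential h0 h1 (by simp))
  rw [Metric.continuousAt_iff] at hcont
  obtain ⟨δ, hδ, hδ2⟩ := hcont (ε / 2) (half_pos hε)
  have h2 : Tendsto (fun N : ℕ => κ ^ (2 * N)) atTop (𝓝 0) := tendsto_pow_two_mul h0 h1 tendsto_id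
  filter_upwards [h2.eventually (gt_mem_nhds hδ)] with N hN
  rw [dist_eq_norm]
  refine lt_of_le_of_lt (norm_toL2_sub_le _ _ (half_pos hε).le fun z hz => ?_) (half_lt_self hε)
  have h3 : dist (((κ ^ (2 * N) : ℝ) : ℂ) * z⁻¹) 0 < δ := by
    rw [dist_zero_right, norm_mul, norm_of_mem_unitCircle (inv_mem_unitCircle hz), mul_one,
      Complex.norm_real, Real.norm_of_nonneg (pow_pos h0 _).le]
    exact hN
  have h4 := (hδ2 h3).le
  rw [potential_zero, Complex.exp_zero, dist_eq_norm] at h4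
  have h5 : generator κ N l z - z ^ (-(l : ℤ)) =
      z ^ (-(l : ℤ)) * (Complex.exp (potential κ (((κ ^ (2 * N) : ℝ) : ℂ) * z⁻¹)) - 1) := by
    rw [generator, symbol]
    simp only [Complex.ofReal_zero, zero_mul, potential_zero, sub_zero, zero_add]
    ring
  rw [h5, norm_mul, norm_zpow, norm_of_mem_unitCircle hz, one_zpow, one_mul]
  exact h4

theorem cf_symbol_neg (h0 : 0 < κ) (h1 : κ < 1) {k : ℤ} (hk : 0 < k) :
    cf (symbol κ 0 0 1 0) k = 0 := by
  have h := tendsto_zcoeff h0 h1 (a := 0) (b := id) (Eventually.of_forall fun n => Nat.zero_le _)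
    (tendsto_pow_two_mul h0 h1 tendsto_id) (-k)
  have h2 : (cf (symbol κ 1 0 0 0) (-k)).re = 0 := by
    refine tendsto_nhds_unique (by simpa using h) ?_
    refine tendsto_const_nhds.congr fun n => ?_
    rw [zcoeff_of_neg _ (by omega)]
  have h3 : cf (symbol κ 0 0 1 0) k = cf (symbol κ 1 0 0 0) (-k) := by
    rw [← cf_inv]
    exact cf_congr (fun z _ => (symbol_inv _ _ _ _ _ _).symm) _
  rw [h3, (isRealSymbol_symbol κ 1 0 0 0).cf_eq, h2, Complex.ofReal_zero]

theorem inner_zpow_toL2 {G : ℂ → ℂ} (hG : ContinuousOn G unitCircle) (n : ℤ) :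
    inner ℂ (toL2 (fun z => z ^ n) (continuousOn_zpow_unitCircle _)) (toL2 G hG) = cf G n := by
  rw [inner_toL2]
  refine avg_congr fun z hz => ?_
  rw [map_zpow₀, conj_of_mem_unitCircle hz, inv_zpow']

theorem fourierBasis_eq_toL2 (n : ℤ) : (fourierBasis n : L2Circle) =
    toL2 (fun z => z ^ n) (continuousOn_zpow_unitCircle _) := by
  rw [coe_fourierBasis, fourierLp, toL2]
  congr 1
  ext x
  exact fourier_eq_circ n x

/-- The generators are power series in 1/z, so they have no positive frequencies (`cf_symbol_neg`).
-/
theorem zpow_mem_hardySpace_orthogonal (h0 : 0 < κ) (h1 : κ < 1) {n : ℤ} (hn : 0 < n) :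
    toL2 (fun z => z ^ n) (continuousOn_zpow_unitCircle _) ∈ (hardySpace h0 h1)ᗮ := by
  rw [hardySpace, Submodule.orthogonal_closure, Submodule.mem_orthogonal']
  intro u hu
  induction hu using Submodule.iSup_induction' with
  | mem L u hu =>
    induction hu using Submodule.span_induction with
    | mem u hu =>
      obtain ⟨l, rfl⟩ := hu
      simp only
      rw [inner_zpow_toL2, show cf (generator κ 0 l) n = _ from cf_zpow_mul _ _ _]
      have h2 := cf_symbol_neg h0 h1 (k := n - -((l : ℕ) : ℤ)) (by omega)
      simpa using h2
    | zero => exact inner_zero_right _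
    | add u v _ _ hu hv => rw [inner_add_right, hu, hv, add_zero]
    | smul a u _ hu => rw [inner_smul_right, hu, mul_zero]
  | zero => exact inner_zero_right _
  | add u v _ _ hu hv => rw [inner_add_right, hu, hv, add_zero]

/-- Monomials of nonpositive degree lie in the space and those of positive degree are orthogonal to
it, so in the Fourier basis the projection just discards the positive frequencies. -/
theorem hasSum_inner_hardySpace (h0 : 0 < κ) (h1 : κ < 1) {G H : ℂ → ℂ}
    (hG : ContinuousOn G unitCircle) (hH : ContinuousOn H unitCircle) :
    HasSum (fun k : ℕ => (starRingEnd ℂ) (cf G (-(k : ℤ))) * cf H (-(k : ℤ)))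
      (inner ℂ (toL2 G hG) ((hardySpace h0 h1).starProjection (toL2 H hH))) := by
  have h := fourierBasis.hasSum_inner_mul_inner (toL2 G hG)
    ((hardySpace h0 h1).starProjection (toL2 H hH))
  have hinj : Function.Injective fun k : ℕ => -(k : ℤ) := fun a b hab => by simpa using hab
  rw [← hinj.hasSum_iff] at h
  · refine h.congr_fun fun k => ?_
    rw [Function.comp_apply, fourierBasis_eq_toL2, ← Submodule.inner_starProjection_left_eq_right,
      Submodule.starProjection_eq_self_iff.2 (zpow_mem_hardySpace h0 h1 k), inner_zpow_toL2,
      ← inner_conj_symm, inner_zpow_toL2]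
  · intro n hn
    have hn0 : 0 < n := by
      by_contra h'
      exact hn ⟨(-n).toNat, by simp only; omega⟩
    rw [fourierBasis_eq_toL2, ← Submodule.inner_starProjection_left_eq_right,
      (Submodule.starProjection_apply_eq_zero_iff _).2
        (zpow_mem_hardySpace_orthogonal h0 h1 hn0), inner_zero_left, mul_zero]

end HardySpace

end FacetedCrystal

namespace FacetedCrystal

/-! ### The kernel of the whole crystal -/

section InfinitelyManyLines

variable {κ : ℝ}

/-- The symbol of the time evolution, from time `0` to time `t`. -/
noncomputable def evolution (κ : ℝ) (t : ℤ) : ℂ → ℂ :=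
  symbol κ (κ ^ (2 * (-t).toNat)) 0 0 (κ ^ (2 * t.toNat))

/-- The reciprocal of `evolution`. -/
noncomputable def invEvolution (κ : ℝ) (t : ℤ) : ℂ → ℂ :=
  symbol κ 0 (κ ^ (2 * (-t).toNat)) (κ ^ (2 * t.toNat)) 0

theorem continuousOn_invEvolution (h0 : 0 < κ) (h1 : κ < 1) (t : ℤ) :
    ContinuousOn (invEvolution κ t) unitCircle :=
  continuousOn_symbol h0 h1 zero_mem_Icc (pow_mem_Icc h0 h1 _) (pow_mem_Icc h0 h1 _) zero_mem_Icc

theorem isRealSymbol_evolution (κ : ℝ) (t : ℤ) : IsRealSymbol (evolution κ t) :=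
  isRealSymbol_symbol _ _ _ _ _

theorem isRealSymbol_invEvolution (κ : ℝ) (t : ℤ) : IsRealSymbol (invEvolution κ t) :=
  isRealSymbol_symbol _ _ _ _ _

theorem isRealSymbol_transferSymbol (κ : ℝ) (s t : Option ℤ) : IsRealSymbol (transferSymbol κ s t) :=
  isRealSymbol_symbol _ _ _ _ _

/-- The correlation kernel of the crystal. -/
noncomputable def schurKernel (κ : ℝ) (x y : ℤ × ℤ) : ℝ :=
  ∑' k : ℕ, (cf (evolution κ y.2) (y.1 + k)).re * (cf (invEvolution κ x.2) (-x.1 - k)).re -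
    if x.2 < y.2 then lineCoeff κ (some x.2) (some y.2) (y.1 - x.1) else 0

/-- The vector of one-line weights from the remote past. -/
noncomputable def pastVector (κ : ℝ) (y : ℤ × ℤ) (z : ℂ) : ℂ :=
  z ^ y.1 * symbol κ 0 (κ ^ (2 * y.2.toNat)) (κ ^ (2 * (-y.2).toNat)) 0 z

/-- The vector of one-line weights to the remote future. -/
noncomputable def futureVector (κ : ℝ) (x : ℤ × ℤ) (z : ℂ) : ℂ :=
  z ^ x.1 * invEvolution κ x.2 z

theorem continuousOn_pastVector (h0 : 0 < κ) (h1 : κ < 1) (y : ℤ × ℤ) :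
    ContinuousOn (pastVector κ y) unitCircle :=
  continuousOn_zpow_mul (continuousOn_symbol h0 h1 zero_mem_Icc (pow_mem_Icc h0 h1 _)
    (pow_mem_Icc h0 h1 _) zero_mem_Icc) _

theorem continuousOn_futureVector (h0 : 0 < κ) (h1 : κ < 1) (x : ℤ × ℤ) :
    ContinuousOn (futureVector κ x) unitCircle :=
  continuousOn_zpow_mul (continuousOn_invEvolution h0 h1 _) _

theorem cf_reflect {G H : ℂ → ℂ} (h : ∀ z ∈ unitCircle, G z = H z⁻¹) (n : ℤ) :
    cf G n = cf H (-n) := by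
  rw [← cf_inv]
  exact cf_congr h n

theorem conj_generator {l : ℕ} {z : ℂ} (hz : z ∈ unitCircle) :
    (starRingEnd ℂ) (generator κ 0 l z) = z ^ (l : ℤ) * symbol κ 1 0 0 0 z := by
  rw [generator, map_mul, map_zpow₀, conj_of_mem_unitCircle hz, inv_zpow', neg_neg,
    ← isRealSymbol_symbol _ _ _ _ _ z hz, symbol_inv, mul_zero, pow_zero]

theorem inner_generator (h0 : 0 < κ) (h1 : κ < 1) (L : ℕ) (l m : Fin L) :
    inner ℂ (toL2 (generator κ 0 l) (continuousOn_generator h0 h1 0 l))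
      (toL2 (generator κ 0 m) (continuousOn_generator h0 h1 0 m)) = (lineGram κ L l m : ℂ) := by
  rw [lineGram, Matrix.of_apply, lineCoeff, ← (isRealSymbol_transferSymbol _ _ _).cf_eq,
    show ((l : ℤ) - m) = -(m - l) by ring, ← cf_inv, inner_toL2]
  refine avg_congr fun z hz => ?_
  have hz0 := ne_zero_of_mem_unitCircle hz
  rw [conj_generator hz, generator, transferSymbol]
  beta_reduce
  rw [symbol_inv, mul_zero, pow_zero,
    show z ^ ((l : ℕ) : ℤ) * symbol κ 1 0 0 0 z * (z ^ (-((m : ℕ) : ℤ)) * symbol κ 0 0 1 0 z) =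
      (z ^ ((l : ℕ) : ℤ) * z ^ (-((m : ℕ) : ℤ))) * (symbol κ 1 0 0 0 z * symbol κ 0 0 1 0 z) by ring,
    ← zpow_add₀ hz0]
  congr 1
  · congr 1; ring
  · simp only [symbol, Option.elim_none]
    rw [← Complex.exp_add]
    congr 1
    simp only [Complex.ofReal_zero, zero_mul, potential_zero]
    ring

theorem inner_futureVector (h0 : 0 < κ) (h1 : κ < 1) (x : ℤ × ℤ) (m : ℕ) :
    inner ℂ (toL2 (futureVector κ x) (continuousOn_futureVector h0 h1 x))
      (toL2 (generator κ 0 m) (continuousOn_generator h0 h1 0 m)) =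
      (lineCoeff κ (some x.2) none (-(m : ℤ) - x.1) : ℂ) := by
  rw [lineCoeff, ← (isRealSymbol_transferSymbol _ _ _).cf_eq,
    show (-(m : ℤ) - x.1) = -(m + x.1) by ring, ← cf_inv, inner_toL2]
  refine avg_congr fun z hz => ?_
  have hz0 := ne_zero_of_mem_unitCircle hz
  rw [futureVector, generator, map_mul, map_zpow₀, conj_of_mem_unitCircle hz, inv_zpow',
    invEvolution, ← isRealSymbol_symbol _ _ _ _ _ z hz, symbol_inv, transferSymbol]
  beta_reduce
  rw [symbol_inv, mul_mul_mul_comm, ← zpow_add₀ hz0]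
  congr 1
  · congr 1; ring
  · simp only [symbol, Option.elim_none, Option.elim_some, mul_zero, pow_zero]
    rw [← Complex.exp_add]
    congr 1
    simp only [Complex.ofReal_zero, zero_mul, potential_zero]
    ring

theorem inner_pastVector (h0 : 0 < κ) (h1 : κ < 1) (y : ℤ × ℤ) (l : ℕ) :
    inner ℂ (toL2 (generator κ 0 l) (continuousOn_generator h0 h1 0 l))
      (toL2 (pastVector κ y) (continuousOn_pastVector h0 h1 y)) =
      (lineCoeff κ none (some y.2) (y.1 - -(l : ℤ)) : ℂ) := by
  rw [lineCoeff, ← (isRealSymbol_transferSymbol _ _ _).cf_eq,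
    show (y.1 - -(l : ℤ)) = -(-l - y.1) by ring, ← cf_inv, inner_toL2]
  refine avg_congr fun z hz => ?_
  have hz0 := ne_zero_of_mem_unitCircle hz
  rw [conj_generator hz, pastVector, transferSymbol]
  beta_reduce
  rw [symbol_inv, mul_mul_mul_comm, ← zpow_add₀ hz0]
  congr 1
  · congr 1; ring
  · simp only [symbol, Option.elim_none, Option.elim_some]
    rw [← Complex.exp_add]
    congr 1
    simp only [Complex.ofReal_zero, zero_mul, potential_zero]
    ring

/-- The Gram matrix of the generators is `lineGram`, and their inner products with the future and
past vectors are the one-line weights of `gramKernel`. Its first term is therefore a matrix element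
of the projection onto the first `L` generators. -/
theorem inner_future_past (h0 : 0 < κ) (h1 : κ < 1) (x y : ℤ × ℤ) (L : ℕ) :
    inner ℂ (toL2 (futureVector κ x) (continuousOn_futureVector h0 h1 x))
      ((generatorSpan h0 h1 L).starProjection
        (toL2 (pastVector κ y) (continuousOn_pastVector h0 h1 y))) =
    ((lineKernel κ L x y + if x.2 < y.2 then lineCoeff κ (some x.2) (some y.2) (y.1 - x.1) else 0 :
      ℝ) : ℂ) := by
  have hmap : ((lineGram κ L).map Complex.ofRealHom).det = Complex.ofRealHom (lineGram κ L).det :=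
    (RingHom.map_det Complex.ofRealHom _).symm
  have hdet : ((lineGram κ L).map Complex.ofRealHom).det ≠ 0 := by
    rw [hmap]
    exact Complex.ofReal_ne_zero.2 ((one_le_det_lineGram h0 h1 L).trans_lt' one_pos).ne'
  have hinv : ((lineGram κ L).map Complex.ofRealHom)⁻¹ = (lineGram κ L)⁻¹.map Complex.ofRealHom := by
    refine Matrix.inv_eq_right_inv ?_
    rw [← Matrix.map_mul, Matrix.mul_nonsing_inv _ (isUnit_iff_ne_zero.2
      ((one_le_det_lineGram h0 h1 L).trans_lt' one_pos).ne'), Matrix.map_one _ (map_zero _) (map_one _)]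
  have : (Submodule.span ℂ (Set.range fun l : Fin L => toL2 (generator κ 0 l)
      (continuousOn_generator h0 h1 0 l))).HasOrthogonalProjection :=
    inferInstanceAs (generatorSpan h0 h1 L).HasOrthogonalProjection
  have h := inner_starProjection_span
    (fun l : Fin L => toL2 (generator κ 0 l) (continuousOn_generator h0 h1 0 l))
    (M := (lineGram κ L).map Complex.ofRealHom)
    (fun l m => (inner_generator h0 h1 L l m).symm) hdet
    (toL2 (futureVector κ x) (continuousOn_futureVector h0 h1 x))
    (toL2 (pastVector κ y) (continuousOn_pastVector h0 h1 y))
  refine h.trans ?_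
  rw [lineKernel, gramKernel, sub_add_cancel]
  push_cast
  refine Finset.sum_congr rfl fun l _ => congrArg₂ (· * ·) (Finset.sum_congr rfl fun m _ =>
    congrArg₂ (· * ·) (inner_futureVector h0 h1 x m) ?_) (inner_pastVector h0 h1 y l)
  rw [hinv]
  rfl

/-- Projections onto increasing subspaces converge strongly to the projection onto the closure of
their union, which keeps exactly the nonpositive frequencies. -/
theorem tendsto_lineKernel (h0 : 0 < κ) (h1 : κ < 1) (x y : ℤ × ℤ) :
    Tendsto (fun L => lineKernel κ L x y) atTop (𝓝 (schurKernel κ x y)) := by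
  have hproj := Submodule.starProjection_tendsto_closure_iSup (generatorSpan h0 h1)
    (hU := generatorSpan_mono h0 h1) (x := toL2 (pastVector κ y) (continuousOn_pastVector h0 h1 y))
  have h2 := (tendsto_const_nhds (x := toL2 (futureVector κ x)
    (continuousOn_futureVector h0 h1 x))).inner (𝕜 := ℂ) hproj
  simp only [inner_future_past] at h2
  have hs := hasSum_inner_hardySpace h0 h1 (continuousOn_futureVector h0 h1 x)
    (continuousOn_pastVector h0 h1 y)
  have hs2 : HasSum (fun k : ℕ => (cf (evolution κ y.2) (y.1 + k)).re *
      (cf (invEvolution κ x.2) (-x.1 - k)).re)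
      (inner ℂ (toL2 (futureVector κ x) (continuousOn_futureVector h0 h1 x))
        ((hardySpace h0 h1).starProjection
          (toL2 (pastVector κ y) (continuousOn_pastVector h0 h1 y)))).re := by
    have hs3 := Complex.hasSum_re hs
    refine hs3.congr_fun fun k => ?_
    have e1 : cf (futureVector κ x) (-(k : ℤ)) = cf (invEvolution κ x.2) (-x.1 - k) := by
      rw [show cf (futureVector κ x) (-(k : ℤ)) = _ from cf_zpow_mul _ _ _]
      congr 1
      ring
    have e2 : cf (pastVector κ y) (-(k : ℤ)) = cf (evolution κ y.2) (y.1 + k) := by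
      rw [show cf (pastVector κ y) (-(k : ℤ)) = _ from cf_zpow_mul _ _ _,
        cf_reflect (H := evolution κ y.2) (fun z _ => by rw [evolution, symbol_inv])]
      congr 1
      ring
    rw [e1, e2, (isRealSymbol_invEvolution _ _).conj_cf, (isRealSymbol_evolution _ _).cf_eq,
      (isRealSymbol_invEvolution _ _).cf_eq, ← Complex.ofReal_mul, Complex.ofReal_re, mul_comm]
    rfl
  rw [schurKernel, hs2.tsum_eq]
  have h3 := (Complex.continuous_re.tendsto _).comp h2
  have h4 : Tendsto (fun L => lineKernel κ L x y +
      if x.2 < y.2 then lineCoeff κ (some x.2) (some y.2) (y.1 - x.1) else 0) atTop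
      (𝓝 (inner ℂ (toL2 (futureVector κ x) (continuousOn_futureVector h0 h1 x))
        ((hardySpace h0 h1).starProjection
          (toL2 (pastVector κ y) (continuousOn_pastVector h0 h1 y)))).re) := by
    refine h3.congr fun L => ?_
    rw [Function.comp_apply, Complex.ofReal_re]
  refine (h4.sub_const _).congr fun L => ?_
  ring

/-- The occupation field of the crystal is determinantal. -/
theorem tsum_prod_eq_det_schurKernel (h0 : 0 < κ) (h1 : κ < 1) {r : ℕ} {p : Fin r → ℤ × ℤ}
    (hp : Function.Injective p) :
    ∑' h, κ ^ (2 * volume h) * ∏ k, ind ℝ (∃ l : ℕ, gradientLine h l (p k).2 = (p k).1) =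
      (∑' h, κ ^ (2 * volume h)) * (Matrix.of fun k k' => schurKernel κ (p k) (p k')).det :=
  tsum_prod_eq_det h0 h1 (tendsto_lineKernel h0 h1) hp

end InfinitelyManyLines

end FacetedCrystal

namespace FacetedCrystal

/-! ### Pairings restricted to nonnegative frequencies -/

section HalfSum

/-- The part of the `L²` pairing of two functions on the circle that comes from the nonnegative
frequencies. -/
noncomputable def halfSum (U V : ℂ → ℂ) : ℂ := ∑' k : ℕ, cf U k * cf V (-(k : ℤ))

/-- The square of the `L²` norm on the circle. -/
noncomputable def energy (U : ℂ → ℂ) : ℝ := (avg fun z => (starRingEnd ℂ) (U z) * U z).re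

theorem energy_nonneg (U : ℂ → ℂ) : 0 ≤ energy U := by
  rw [energy, avg_eq_integral]
  have : ∀ x, (starRingEnd ℂ) (U (circ x)) * U (circ x) = ((‖U (circ x)‖ ^ 2 : ℝ) : ℂ) := fun x => by
    rw [mul_comm, Complex.mul_conj, Complex.normSq_eq_norm_sq]
  simp_rw [this, integral_complex_ofReal, Complex.ofReal_re]
  exact integral_nonneg fun x => by positivity

theorem energy_eq_integral (U : ℂ → ℂ) :
    energy U = ∫ x, ‖U (circ x)‖ ^ 2 ∂AddCircle.haarAddCircle (T := 2 * Real.pi) := by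
  rw [energy, avg_eq_integral]
  have : ∀ x, (starRingEnd ℂ) (U (circ x)) * U (circ x) = ((‖U (circ x)‖ ^ 2 : ℝ) : ℂ) := fun x => by
    rw [mul_comm, Complex.mul_conj, Complex.normSq_eq_norm_sq]
  simp_rw [this, integral_complex_ofReal, Complex.ofReal_re]

theorem energy_le {U : ℂ → ℂ} {C : ℝ} (h : ∀ z ∈ unitCircle, ‖U z‖ ≤ C) : energy U ≤ C ^ 2 := by
  refine (Complex.re_le_norm _).trans (norm_avg_le fun z hz => ?_)
  rw [norm_mul, RCLike.norm_conj, ← sq]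
  exact pow_le_pow_left₀ (norm_nonneg _) (h z hz) 2

theorem bessel {U : ℂ → ℂ} (hU : ContinuousOn U unitCircle) (s : Finset ℤ) :
    ∑ n ∈ s, ‖cf U n‖ ^ 2 ≤ energy U := by
  have h := Complex.hasSum_re (parseval hU hU)
  have e : ∀ n, ((starRingEnd ℂ) (cf U n) * cf U n).re = ‖cf U n‖ ^ 2 := fun n => by
    rw [mul_comm, Complex.mul_conj, Complex.normSq_eq_norm_sq, Complex.ofReal_re]
  simp_rw [e] at h
  exact sum_le_hasSum s (fun _ _ => by positivity) h

theorem summable_mul_and_norm_tsum_le {ι : Type*} {a b : ι → ℂ} {A B : ℝ} (hA : 0 ≤ A) (hB : 0 ≤ B)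
    (ha : ∀ s : Finset ι, ∑ i ∈ s, ‖a i‖ ^ 2 ≤ A ^ 2)
    (hb : ∀ s : Finset ι, ∑ i ∈ s, ‖b i‖ ^ 2 ≤ B ^ 2) :
    Summable (fun i => a i * b i) ∧ ‖∑' i, a i * b i‖ ≤ A * B := by
  have h : ∀ s : Finset ι, ∑ i ∈ s, ‖a i * b i‖ ≤ A * B := by
    intro s
    have h2 := Finset.sum_mul_sq_le_sq_mul_sq s (fun i => ‖a i‖) (fun i => ‖b i‖)
    simp_rw [norm_mul]
    refine le_of_sq_le_sq (h2.trans ?_) (mul_nonneg hA hB)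
    rw [mul_pow]
    exact mul_le_mul (ha s) (hb s) (Finset.sum_nonneg fun _ _ => by positivity) (by positivity)
  have hs : Summable fun i => ‖a i * b i‖ :=
    summable_of_sum_le (fun _ => norm_nonneg _) h
  refine ⟨hs.of_norm, (norm_tsum_le_tsum_norm hs).trans ?_⟩
  exact hs.tsum_le_of_sum_le h

theorem sum_comp_le_energy {U : ℂ → ℂ} (hU : ContinuousOn U unitCircle) {φ : ℕ → ℤ}
    (hφ : Function.Injective φ) (s : Finset ℕ) :
    ∑ k ∈ s, ‖cf U (φ k)‖ ^ 2 ≤ √(energy U) ^ 2 := by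
  rw [Real.sq_sqrt (energy_nonneg U)]
  refine le_trans (le_of_eq ?_) (bessel hU (s.map ⟨φ, hφ⟩))
  rw [Finset.sum_map]
  rfl

theorem natCast_neg_injective : Function.Injective fun k : ℕ => -(k : ℤ) :=
  fun a b hab => by simpa using hab

theorem natCast_injective : Function.Injective fun k : ℕ => (k : ℤ) := fun a b hab => by simpa using hab

theorem summable_halfSum {U V : ℂ → ℂ} (hU : ContinuousOn U unitCircle)
    (hV : ContinuousOn V unitCircle) : Summable fun k : ℕ => cf U k * cf V (-(k : ℤ)) :=
  (summable_mul_and_norm_tsum_le (Real.sqrt_nonneg _) (Real.sqrt_nonneg _)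
    (sum_comp_le_energy hU natCast_injective) (sum_comp_le_energy hV natCast_neg_injective)).1

theorem norm_halfSum_le {U V : ℂ → ℂ} (hU : ContinuousOn U unitCircle)
    (hV : ContinuousOn V unitCircle) : ‖halfSum U V‖ ≤ √(energy U) * √(energy V) :=
  (summable_mul_and_norm_tsum_le (Real.sqrt_nonneg _) (Real.sqrt_nonneg _)
    (sum_comp_le_energy hU natCast_injective) (sum_comp_le_energy hV natCast_neg_injective)).2

theorem halfSum_congr {U V U' V' : ℂ → ℂ} (hU : ∀ z ∈ unitCircle, U z = U' z)
    (hV : ∀ z ∈ unitCircle, V z = V' z) : halfSum U V = halfSum U' V' :=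
  tsum_congr fun k => by rw [cf_congr hU, cf_congr hV]

theorem halfSum_add_left {U U' V : ℂ → ℂ} (hU : ContinuousOn U unitCircle)
    (hU' : ContinuousOn U' unitCircle) (hV : ContinuousOn V unitCircle) :
    halfSum (fun z => U z + U' z) V = halfSum U V + halfSum U' V := by
  rw [halfSum, halfSum, halfSum, ← (summable_halfSum hU hV).tsum_add (summable_halfSum hU' hV)]
  refine tsum_congr fun k => ?_
  rw [cf_add hU hU']
  ring

theorem halfSum_sub_left {U U' V : ℂ → ℂ} (hU : ContinuousOn U unitCircle)
    (hU' : ContinuousOn U' unitCircle) (hV : ContinuousOn V unitCircle) :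
    halfSum (fun z => U z - U' z) V = halfSum U V - halfSum U' V := by
  rw [halfSum, halfSum, halfSum, ← (summable_halfSum hU hV).tsum_sub (summable_halfSum hU' hV)]
  refine tsum_congr fun k => ?_
  rw [cf_sub hU hU']
  ring

theorem halfSum_sub_right {U V V' : ℂ → ℂ} (hU : ContinuousOn U unitCircle)
    (hV : ContinuousOn V unitCircle) (hV' : ContinuousOn V' unitCircle) :
    halfSum U (fun z => V z - V' z) = halfSum U V - halfSum U V' := by
  rw [halfSum, halfSum, halfSum, ← (summable_halfSum hU hV).tsum_sub (summable_halfSum hU hV')]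
  refine tsum_congr fun k => ?_
  rw [cf_sub hV hV']
  ring

theorem hasSum_cf_mul {U V : ℂ → ℂ} (hU : ContinuousOn U unitCircle)
    (hV : ContinuousOn V unitCircle) :
    HasSum (fun n : ℤ => cf U n * cf V (-n)) (avg fun z => U z * V z) := by
  have hV' : ContinuousOn (fun z => (starRingEnd ℂ) (V z)) unitCircle :=
    Complex.continuous_conj.comp_continuousOn hV
  have h := parseval hV' hU
  simp only [Complex.conj_conj] at h
  have e : ∀ n, (starRingEnd ℂ) (cf (fun z => (starRingEnd ℂ) (V z)) n) = cf V (-n) := by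
    intro n
    rw [cf, conj_avg]
    refine avg_congr fun z hz => ?_
    rw [map_mul, Complex.conj_conj, map_zpow₀, conj_of_mem_unitCircle hz, inv_zpow']
  simp_rw [e] at h
  rw [show (fun z => U z * V z) = fun z => V z * U z from funext fun z => mul_comm _ _]
  exact h.congr_fun fun n => mul_comm _ _

/-- Parseval split at frequency zero; used when the negative frequencies are the negligible ones. -/
theorem halfSum_add_tsum_neg {U V : ℂ → ℂ} (hU : ContinuousOn U unitCircle)
    (hV : ContinuousOn V unitCircle) :
    halfSum U V + ∑' k : ℕ, cf U (-((k : ℤ) + 1)) * cf V ((k : ℤ) + 1) =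
      avg fun z => U z * V z := by
  have h := hasSum_cf_mul hU hV
  rw [← h.tsum_eq, tsum_of_nat_of_neg_add_one]
  · simp only [neg_neg]
    rfl
  · exact summable_halfSum hU hV
  · exact h.summable.comp_injective (i := fun k : ℕ => -((k : ℤ) + 1))
      fun a b hab => by simpa using hab

end HalfSum

/-! ### Nonstationary phase on the circle -/

section Phase

/-- The derivative of a function on the unit circle with respect to the angle. -/
def HasAngularDeriv (h : ℂ → ℂ) (h' : ℝ → ℂ) : Prop :=
  ∀ θ, HasDerivAt (fun θ => h (circleMap 0 1 θ)) (h' θ) θ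

theorem circleMap_mem_unitCircle (θ : ℝ) : circleMap 0 1 θ ∈ unitCircle :=
  circleMap_mem_sphere 0 zero_le_one θ

theorem cf_eq_intervalIntegral (G : ℂ → ℂ) (n : ℤ) :
    cf G n = (2 * Real.pi : ℂ)⁻¹ * ∫ θ in (0 : ℝ)..2 * Real.pi,
      Complex.exp (-(Complex.I * n * θ)) * G (circleMap 0 1 θ) := by
  rw [cf, avg, Real.circleAverage_def, Complex.real_smul]
  push_cast
  congr 1
  refine intervalIntegral.integral_congr fun θ _ => ?_
  simp only [circleMap, Complex.ofReal_one, one_mul, zero_add, ← Complex.exp_int_mul]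
  congr 2
  push_cast
  ring

theorem integral_angular_deriv {F : ℝ → ℂ} {F' : ℝ → ℂ} (hF : ∀ θ, HasDerivAt F (F' θ) θ)
    (hF' : Continuous F') (hper : F (2 * Real.pi) = F 0) :
    ∫ θ in (0 : ℝ)..2 * Real.pi, F' θ = 0 := by
  rw [intervalIntegral.integral_eq_sub_of_hasDerivAt (fun θ _ => hF θ)
    (hF'.intervalIntegrable _ _), hper, sub_self]

theorem norm_circle_integral_le {F : ℝ → ℂ} {C : ℝ} (h : ∀ θ, ‖F θ‖ ≤ C) :
    ‖(2 * Real.pi : ℂ)⁻¹ * ∫ θ in (0 : ℝ)..2 * Real.pi, F θ‖ ≤ C := by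
  have h2 := intervalIntegral.norm_integral_le_of_norm_le_const (a := 0) (b := 2 * Real.pi)
    (fun θ _ => h θ)
  rw [sub_zero, abs_of_pos Real.two_pi_pos] at h2
  have h3 : ‖(2 * Real.pi : ℂ)⁻¹‖ = (2 * Real.pi)⁻¹ := by
    rw [norm_inv, show (2 * Real.pi : ℂ) = ((2 * Real.pi : ℝ) : ℂ) by push_cast; rfl,
      Complex.norm_real, Real.norm_of_nonneg Real.two_pi_pos.le]
  rw [norm_mul, h3, inv_mul_le_iff₀ Real.two_pi_pos, mul_comm _ C]
  exact h2

/-- Integration by parts: the Fourier coefficients of an oscillating function away from the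
frequencies that are present. -/
theorem norm_cf_le_of_phase {E h : ℂ → ℂ} {ψ₁ ψ₂ : ℝ → ℝ} {h' : ℝ → ℂ}
    (hE : HasAngularDeriv E fun θ => Complex.I * ψ₁ θ * E (circleMap 0 1 θ))
    (hE1 : ∀ z ∈ unitCircle, ‖E z‖ = 1) (hψ : ∀ θ, HasDerivAt ψ₁ (ψ₂ θ) θ) (hψ₂ : Continuous ψ₂)
    (hh : HasAngularDeriv h h') (hh' : Continuous h') {k : ℤ} {A B C₀ C₁ : ℝ} (hA : 0 < A)
    (hsupp : ∀ θ, A ≤ |ψ₁ θ - k| ∨ (fun θ => h (circleMap 0 1 θ)) =ᶠ[𝓝 θ] 0)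
    (hB : ∀ θ, |ψ₂ θ| ≤ B) (hC₀ : ∀ θ, ‖h (circleMap 0 1 θ)‖ ≤ C₀) (hC₁ : ∀ θ, ‖h' θ‖ ≤ C₁) :
    ‖cf (fun z => E z * h z) k‖ ≤ C₁ / A + C₀ * B / A ^ 2 := by
  -- The integrand is e·H with e' = i d e. Putting g = H / d, the derivative (e g)' = i e H + e g'
  -- integrates to zero, so ∫ e H = i ∫ e g'. Where `d` may be small, `H` vanishes on a
  -- neighbourhood, and division by zero returning zero keeps `g` smooth there.
  let d : ℝ → ℂ := fun θ => ((ψ₁ θ - k : ℝ) : ℂ)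
  let H : ℝ → ℂ := fun θ => h (circleMap 0 1 θ)
  let g : ℝ → ℂ := fun θ => H θ / d θ
  let g' : ℝ → ℂ := fun θ => (h' θ * d θ - H θ * (ψ₂ θ : ℂ)) / d θ ^ 2
  have hdne : ∀ θ, A ≤ |ψ₁ θ - k| → d θ ≠ 0 := fun θ hθ h0 => by
    rw [Complex.ofReal_eq_zero.1 h0, abs_zero] at hθ
    exact absurd hθ hA.not_ge
  have hd : ∀ θ, HasDerivAt d (ψ₂ θ : ℂ) θ := fun θ => ((hψ θ).sub_const _).ofReal_comp
  have hdc : Continuous d := continuous_iff_continuousAt.2 fun θ => (hd θ).continuousAt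
  have hHc : Continuous H := continuous_iff_continuousAt.2 fun θ => (hh θ).continuousAt
  have hzero : ∀ θ, H =ᶠ[𝓝 θ] 0 → h' =ᶠ[𝓝 θ] 0 := fun θ hθ => by
    filter_upwards [hθ.eventuallyEq_nhds] with θ' hθ'
    exact (hh θ').unique ((hasDerivAt_const θ' (0 : ℂ)).congr_of_eventuallyEq hθ')
  have hg : ∀ θ, HasDerivAt g (g' θ) θ := by
    intro θ
    rcases hsupp θ with h1 | h1
    · exact (hh θ).div (hd θ) (hdne θ h1)
    · have e1 : g =ᶠ[𝓝 θ] fun _ => 0 := by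
        filter_upwards [h1] with θ' hθ'
        simp only [g, show H θ' = 0 from hθ', zero_div]
      have e2 : g' θ = 0 := by
        simp only [g', show H θ = 0 from h1.eq_of_nhds, show h' θ = 0 from (hzero θ h1).eq_of_nhds]
        simp
      rw [e2]
      exact (hasDerivAt_const θ (0 : ℂ)).congr_of_eventuallyEq e1
  have hgc : Continuous g' := by
    rw [continuous_iff_continuousAt]
    intro θ
    rcases hsupp θ with h1 | h1
    · have c1 : ContinuousAt (fun θ => (ψ₂ θ : ℂ)) θ :=
        (Complex.continuous_ofReal.comp hψ₂).continuousAt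
      exact ((hh'.continuousAt.mul hdc.continuousAt).sub (hHc.continuousAt.mul c1)).div
        (hdc.continuousAt.pow 2) (pow_ne_zero 2 (hdne θ h1))
    · have e1 : g' =ᶠ[𝓝 θ] fun _ => 0 := by
        filter_upwards [h1, hzero θ h1] with θ' hθ' hθ''
        simp only [g', show H θ' = 0 from hθ', show h' θ' = 0 from hθ'']
        simp
      exact continuousAt_const.congr e1.symm
  have hbound : ∀ θ, ‖g' θ‖ ≤ C₁ / A + C₀ * B / A ^ 2 := by
    intro θ
    have hC0 : 0 ≤ C₀ := (norm_nonneg _).trans (hC₀ θ)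
    have hC1 : 0 ≤ C₁ := (norm_nonneg _).trans (hC₁ θ)
    have hB0 : 0 ≤ B := (abs_nonneg _).trans (hB θ)
    rcases hsupp θ with h1 | h1
    · have e : g' θ = h' θ / d θ - H θ * (ψ₂ θ : ℂ) / d θ ^ 2 := by
        have := hdne θ h1
        simp only [g']
        field_simp
      have hn : ‖d θ‖ = |ψ₁ θ - k| := by rw [Complex.norm_real, Real.norm_eq_abs]
      rw [e]
      refine (norm_sub_le _ _).trans (add_le_add ?_ ?_)
      · rw [norm_div, hn]
        exact div_le_div₀ hC1 (hC₁ θ) hA h1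
      · rw [norm_div, norm_mul, norm_pow, hn, Complex.norm_real, Real.norm_eq_abs]
        exact div_le_div₀ (mul_nonneg hC0 hB0) (mul_le_mul (hC₀ θ) (hB θ) (abs_nonneg _) hC0)
          (by positivity) (pow_le_pow_left₀ hA.le h1 2)
    · have e : g' θ = 0 := by
        simp only [g', show H θ = 0 from h1.eq_of_nhds, show h' θ = 0 from (hzero θ h1).eq_of_nhds]
        simp
      rw [e, norm_zero]
      positivity
  let e : ℝ → ℂ := fun θ => Complex.exp (-(Complex.I * k * θ)) * E (circleMap 0 1 θ)
  have he : ∀ θ, HasDerivAt e (Complex.I * d θ * e θ) θ := by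
    intro θ
    have h1 : HasDerivAt (fun θ : ℝ => Complex.exp (-(Complex.I * k * θ)))
        (Complex.exp (-(Complex.I * k * θ)) * -(Complex.I * k * 1)) θ :=
      ((((hasDerivAt_id θ).ofReal_comp).const_mul (Complex.I * k)).neg).cexp
    refine (h1.mul (hE θ)).congr_deriv ?_
    simp only [e, d]
    push_cast
    ring
  have hec : Continuous e := continuous_iff_continuousAt.2 fun θ => (he θ).continuousAt
  have hen : ∀ θ, ‖e θ‖ = 1 := fun θ => by
    simp only [e]
    rw [norm_mul, hE1 _ (circleMap_mem_unitCircle θ), mul_one, Complex.norm_exp]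
    simp
  have hdg : ∀ θ, d θ * g θ = H θ := by
    intro θ
    rcases hsupp θ with h1 | h1
    · exact mul_div_cancel₀ _ (hdne θ h1)
    · simp only [g, show H θ = 0 from h1.eq_of_nhds, zero_div, mul_zero]
  have hmain := integral_angular_deriv (F := fun θ => e θ * g θ)
    (F' := fun θ => Complex.I * (e θ * H θ) + e θ * g' θ) (fun θ => by
      refine ((he θ).mul (hg θ)).congr_deriv ?_
      rw [← hdg θ]
      ring) ((continuous_const.mul (hec.mul hHc)).add (hec.mul hgc)) (by
      have h1 : circleMap 0 1 (2 * Real.pi) = circleMap 0 1 0 := by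
        have := periodic_circleMap 0 1 0
        rwa [zero_add] at this
      -- Periodicity of the phase derivative is not a hypothesis; it follows because E is periodic,
      -- has no zero, and satisfies E' = i ψ₁ E.
      have h2 : ψ₁ (2 * Real.pi) = ψ₁ 0 := by
        have q := hE 0
        have q2 := hE (2 * Real.pi)
        have hp : (fun θ => E (circleMap 0 1 (θ + 2 * Real.pi))) = fun θ => E (circleMap 0 1 θ) := by
          funext θ
          rw [periodic_circleMap 0 1 θ]
        have q3 : HasDerivAt (fun θ => E (circleMap 0 1 (θ + 2 * Real.pi)))
            (Complex.I * ψ₁ (2 * Real.pi) * E (circleMap 0 1 (2 * Real.pi))) 0 := by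
          refine HasDerivAt.comp_add_const (f := fun θ => E (circleMap 0 1 θ)) 0 (2 * Real.pi) ?_
          rw [zero_add]
          exact q2
        rw [hp] at q3
        have q4 := q.unique q3
        rw [h1] at q4
        have hne : E (circleMap 0 1 0) ≠ 0 := fun h0 => by
          have := hE1 _ (circleMap_mem_unitCircle 0)
          rw [h0, norm_zero] at this
          exact zero_ne_one this
        have q5 := mul_left_cancel₀ Complex.I_ne_zero (mul_right_cancel₀ hne q4)
        exact (Complex.ofReal_injective q5).symm
      simp only [e, g, H, d, h1, h2]
      congr 2
      have h3 : Complex.exp (-(Complex.I * k * ((2 * Real.pi : ℝ) : ℂ))) = 1 := by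
        rw [Complex.exp_eq_one_iff]
        exact ⟨-k, by push_cast; ring⟩
      rw [h3]
      simp)
  have k1 : Continuous fun θ => Complex.I * (e θ * H θ) := continuous_const.mul (hec.mul hHc)
  have k2 : Continuous fun θ => e θ * g' θ := hec.mul hgc
  rw [intervalIntegral.integral_add (k1.intervalIntegrable _ _) (k2.intervalIntegrable _ _), intervalIntegral.integral_const_mul] at hmain
  have hcf : cf (fun z => E z * h z) k = (2 * Real.pi : ℂ)⁻¹ *
      ∫ θ in (0 : ℝ)..2 * Real.pi, Complex.I * (e θ * g' θ) := by
    rw [cf_eq_intervalIntegral, intervalIntegral.integral_const_mul]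
    congr 1
    have h2 : ∫ θ in (0 : ℝ)..2 * Real.pi, e θ * g' θ =
        -(Complex.I * ∫ θ in (0 : ℝ)..2 * Real.pi, e θ * H θ) := by
      rw [eq_neg_iff_add_eq_zero, add_comm]
      exact hmain
    rw [h2, mul_neg, ← mul_assoc, Complex.I_mul_I, neg_mul, one_mul, neg_neg]
    refine intervalIntegral.integral_congr fun θ _ => ?_
    simp only [e, H]
    ring
  rw [hcf]
  refine norm_circle_integral_le fun θ => ?_
  rw [norm_mul, norm_mul, Complex.norm_I, hen, one_mul, one_mul]
  exact hbound θ

end Phase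

end FacetedCrystal

namespace FacetedCrystal

/-! ### Positive frequencies of rapidly oscillating functions -/

section Oscillation

theorem HasAngularDeriv.exists_bound {h : ℂ → ℂ} {h' : ℝ → ℂ} (hh : HasAngularDeriv h h')
    (hc : Continuous h') : ∃ C, ∀ θ, ‖h' θ‖ ≤ C := by
  have hper : Function.Periodic h' (2 * Real.pi) := by
    intro θ
    have hp : (fun θ => h (circleMap 0 1 (θ + 2 * Real.pi))) = fun θ => h (circleMap 0 1 θ) := by
      funext θ
      rw [periodic_circleMap 0 1 θ]
    have h1 : HasDerivAt (fun θ => h (circleMap 0 1 (θ + 2 * Real.pi))) (h' (θ + 2 * Real.pi)) θ :=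
      HasDerivAt.comp_add_const (f := fun θ => h (circleMap 0 1 θ)) θ (2 * Real.pi) (hh _)
    rw [hp] at h1
    exact h1.unique (hh θ)
  obtain ⟨C, hC⟩ := (hper.isBounded_of_continuous Real.two_pi_pos.ne' hc).exists_norm_le
  exact ⟨C, fun θ => hC _ ⟨θ, rfl⟩⟩

theorem exists_bound_of_continuousOn {h : ℂ → ℂ} (hh : ContinuousOn h unitCircle) :
    ∃ C, 0 ≤ C ∧ ∀ z ∈ unitCircle, ‖h z‖ ≤ C := by
  obtain ⟨C, hC⟩ := (isCompact_sphere (0 : ℂ) 1).exists_bound_of_continuousOn hh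
  exact ⟨max C 0, le_max_right _ _, fun z hz => (hC z hz).trans (le_max_left _ _)⟩

/-- Telescoping, since 1/(a+n+1)² is at most 1/(a+n) - 1/(a+n+1). -/
theorem sum_inv_sq_le {a : ℝ} (ha : 0 < a) (s : Finset ℕ) :
    ∑ k ∈ s, (1 / (a + k + 1)) ^ 2 ≤ 1 / a := by
  have h1 : ∀ n : ℕ, ∑ k ∈ Finset.range n, (1 / (a + k + 1)) ^ 2 ≤ 1 / a - 1 / (a + n) := by
    intro n
    induction n with
    | zero => simp
    | succ n ih =>
      rw [Finset.sum_range_succ]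
      have h2 : (1 / (a + n + 1)) ^ 2 ≤ 1 / (a + n) - 1 / (a + n + 1) := by
        have p1 : 0 < a + n := by positivity
        have p2 : 0 < a + n + 1 := by positivity
        rw [div_sub_div _ _ p1.ne' p2.ne', div_pow, div_le_div_iff₀ (by positivity) (by positivity)]
        nlinarith
      push_cast
      rw [← add_assoc]
      linarith
  obtain ⟨n, hn⟩ := s.exists_nat_subset_range
  refine (Finset.sum_le_sum_of_subset_of_nonneg hn fun _ _ _ => by positivity).trans
    ((h1 n).trans (sub_le_self _ (by positivity)))

theorem sum_norm_sq_le {c : ℕ → ℂ} {M a : ℝ} (ha : 0 < a) (hc : ∀ k, ‖c k‖ ≤ M / (a + k + 1))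
    (s : Finset ℕ) : ∑ k ∈ s, ‖c k‖ ^ 2 ≤ (M / √a) ^ 2 := by
  calc ∑ k ∈ s, ‖c k‖ ^ 2 ≤ ∑ k ∈ s, M ^ 2 * (1 / (a + k + 1)) ^ 2 := by
        refine Finset.sum_le_sum fun k _ => ?_
        rw [← mul_pow, mul_one_div]
        exact pow_le_pow_left₀ (norm_nonneg _) (hc k) 2
    _ ≤ M ^ 2 * (1 / a) := by
        rw [← Finset.mul_sum]
        exact mul_le_mul_of_nonneg_left (sum_inv_sq_le ha s) (sq_nonneg _)
    _ = (M / √a) ^ 2 := by rw [div_pow, Real.sq_sqrt ha.le, mul_one_div]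

/-- A family of unimodular functions on the circle whose local frequency is asymptotically
`T * D`. -/
structure HasLocalFrequency {ι : Type*} (l : Filter ι) (T : ι → ℝ) (E : ι → ℂ → ℂ) (D : ℂ → ℝ)
    (ψ₁ ψ₂ : ι → ℝ → ℝ) (B : ℝ) : Prop where
  scale : Tendsto T l atTop
  continuousOn : ∀ᶠ i in l, ContinuousOn (E i) unitCircle
  norm_eq_one : ∀ᶠ i in l, ∀ z ∈ unitCircle, ‖E i z‖ = 1
  angularDeriv : ∀ᶠ i in l,
    HasAngularDeriv (E i) fun θ => Complex.I * ψ₁ i θ * E i (circleMap 0 1 θ)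
  hasDerivAt : ∀ᶠ i in l, ∀ θ, HasDerivAt (ψ₁ i) (ψ₂ i θ) θ
  continuous : ∀ᶠ i in l, Continuous (ψ₂ i)
  bound : ∀ᶠ i in l, ∀ θ, |ψ₂ i θ| ≤ B * T i
  frequency : ∀ ε > 0, ∀ᶠ i in l, ∀ θ, |ψ₁ i θ - T i * D (circleMap 0 1 θ)| ≤ ε * T i
  continuousOn_frequency : ContinuousOn D unitCircle

variable {ι : Type*} {l : Filter ι} {T : ι → ℝ} {E : ι → ℂ → ℂ} {D : ℂ → ℝ} {ψ₁ ψ₂ : ι → ℝ → ℝ}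
  {B : ℝ}

/-- On the support of `h` the local frequency lies at distance of order T from zero on the side `s`,
while `φ k` lies on the other side at distance at least `k`. Nonstationary phase applies with a gap
of order T + k, and by `sum_norm_sq_le` the coefficients are small in ℓ². -/
theorem HasLocalFrequency.decay (hE : HasLocalFrequency l T E D ψ₁ ψ₂ B) {h : ℂ → ℂ} {h' : ℝ → ℂ}
    (hc : ContinuousOn h unitCircle) (hh : HasAngularDeriv h h') (hh' : Continuous h') {δ s : ℝ}
    (hδ : 0 < δ) (hs : |s| = 1) (hsupp : ∀ z ∈ unitCircle, s * D z < δ → h z = 0) {φ : ℕ → ℤ}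
    (hφ : ∀ k : ℕ, (k : ℝ) ≤ -(s * φ k)) :
    ∃ M, ∀ᶠ i in l, ∀ k : ℕ, ‖cf (fun z => E i z * h z) (φ k)‖ ≤ M / (T i * δ / 8 + k + 1) := by
  obtain ⟨C₁, hC₁⟩ := hh.exists_bound hh'
  obtain ⟨C₀, hC0, hC₀⟩ := exists_bound_of_continuousOn hc
  refine ⟨C₁ + C₀ * (8 * |B| / δ), ?_⟩
  filter_upwards [hE.norm_eq_one, hE.angularDeriv, hE.hasDerivAt, hE.continuous, hE.bound,
    hE.frequency (δ / 4) (by positivity), hE.scale.eventually_ge_atTop (8 / δ)] with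
    i h1 h2 h3 h4 h5 h6 h7 k
  have hT : 0 < T i := (by positivity : 0 < 8 / δ).trans_le h7
  have h8 : 1 ≤ T i * δ / 8 := by
    rw [div_le_iff₀ hδ] at h7
    linarith
  have hC1 : 0 ≤ C₁ := (norm_nonneg _).trans (hC₁ 0)
  have hA : 0 < T i * δ / 8 + k + 1 := by positivity
  have hDc : Continuous fun θ => D (circleMap 0 1 θ) :=
    hE.continuousOn_frequency.comp_continuous (continuous_circleMap 0 1) circleMap_mem_unitCircle
  refine (norm_cf_le_of_phase h2 h1 h3 h4 hh hh' (A := T i * δ / 8 + k + 1) (B := |B| * T i) hA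
    (fun θ => ?_) (fun θ => (h5 θ).trans ?_) (fun θ => hC₀ _ (circleMap_mem_unitCircle θ)) hC₁).trans ?_
  -- The threshold δ/2 is strictly below δ, so that where it is not exceeded `h` vanishes on a whole
  -- neighbourhood. Above it the gap is at least Tδ/2 - Tδ/4 + k, which is at least Tδ/8 + k + 1
  -- once T ≥ 8/δ.
  · by_cases hθ : δ / 2 < s * D (circleMap 0 1 θ)
    · left
      have e1 : |s * (ψ₁ i θ - φ k)| = |ψ₁ i θ - φ k| := by rw [abs_mul, hs, one_mul]
      rw [← e1]
      refine le_trans ?_ (le_abs_self _)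
      have e2 : |s * (ψ₁ i θ - T i * D (circleMap 0 1 θ))| ≤ δ / 4 * T i := by
        rw [abs_mul, hs, one_mul]; exact h6 θ
      have e3 := (abs_le.1 e2).1
      have e4 := hφ k
      have e5 : T i * (δ / 2) ≤ T i * (s * D (circleMap 0 1 θ)) :=
        mul_le_mul_of_nonneg_left hθ.le hT.le
      nlinarith
    · right
      have h9 : s * D (circleMap 0 1 θ) < δ := by linarith [not_lt.1 hθ]
      have h10 : ∀ᶠ θ' in 𝓝 θ, s * D (circleMap 0 1 θ') < δ :=
        (continuous_const.mul hDc).continuousAt.eventually (gt_mem_nhds h9)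
      filter_upwards [h10] with θ' hθ'
      exact hsupp _ (circleMap_mem_unitCircle θ') hθ'
  · exact mul_le_mul_of_nonneg_right (le_abs_self _) hT.le
  · rw [add_div]
    refine add_le_add_right ?_ _
    rw [sq, ← div_div, div_le_div_iff_of_pos_right hA, div_le_iff₀ hA]
    have e6 : C₀ * (|B| * T i) = C₀ * (8 * |B| / δ) * (T i * δ / 8) := by
      field_simp
    rw [e6]
    refine mul_le_mul_of_nonneg_left ?_ (by positivity)
    have : (0 : ℝ) ≤ k := Nat.cast_nonneg k
    linarith

theorem tendsto_const_div_sqrt (hT : Tendsto T l atTop) {δ : ℝ} (hδ : 0 < δ) (M C : ℝ) :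
    Tendsto (fun i => M / √(T i * δ / 8) * C) l (𝓝 0) := by
  have h1 : Tendsto (fun i => √(T i * δ / 8)) l atTop := by
    refine Real.tendsto_sqrt_atTop.comp ?_
    have := hT.atTop_mul_const (show 0 < δ / 8 by positivity)
    simpa only [mul_div_assoc] using this
  simpa using (h1.const_div_atTop M).mul_const C

theorem energy_mul_eq {e f : ℂ → ℂ} (he : ∀ z ∈ unitCircle, ‖e z‖ = 1) :
    energy (fun z => e z * f z) = energy f := by
  rw [energy_eq_integral, energy_eq_integral]
  simp only [norm_mul, he _ (circ_mem _), one_mul]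

/-- The smooth cutoff to `δ < x`, equal to one for `2 δ ≤ x`. -/
noncomputable def cutoff (δ x : ℝ) : ℝ := Real.smoothTransition (x / δ - 1)

theorem cutoff_of_le {δ x : ℝ} (hδ : 0 < δ) (hx : x ≤ δ) : cutoff δ x = 0 :=
  Real.smoothTransition.zero_of_nonpos (by rw [sub_nonpos, div_le_one hδ]; exact hx)

theorem cutoff_of_ge {δ x : ℝ} (hδ : 0 < δ) (hx : 2 * δ ≤ x) : cutoff δ x = 1 :=
  Real.smoothTransition.one_of_one_le (by rw [le_sub_iff_add_le, le_div_iff₀ hδ]; linarith)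

theorem cutoff_nonneg (δ x : ℝ) : 0 ≤ cutoff δ x := Real.smoothTransition.nonneg _

theorem cutoff_le_one (δ x : ℝ) : cutoff δ x ≤ 1 := Real.smoothTransition.le_one _

theorem continuous_cutoff (δ : ℝ) : Continuous (cutoff δ) :=
  Real.smoothTransition.continuous.comp (by fun_prop)

theorem hasDerivAt_cutoff (δ x : ℝ) :
    HasDerivAt (cutoff δ) (deriv Real.smoothTransition (x / δ - 1) * (1 / δ)) x := by
  have h1 : HasDerivAt Real.smoothTransition (deriv Real.smoothTransition (x / δ - 1)) (x / δ - 1) :=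
    ((Real.smoothTransition.contDiff (n := 1)).differentiable one_ne_zero _).hasDerivAt
  exact h1.comp x (((hasDerivAt_id x).div_const δ).sub_const 1)

theorem continuous_deriv_smoothTransition : Continuous (deriv Real.smoothTransition) :=
  (Real.smoothTransition.contDiff (n := 1)).continuous_deriv le_rfl

variable {f g : ℂ → ℂ} {f' : ℝ → ℂ} {D₁ : ℝ → ℝ}

theorem angularDeriv_cutoff (hD : ∀ θ, HasDerivAt (fun θ => D (circleMap 0 1 θ)) (D₁ θ) θ)
    (hf : HasAngularDeriv f f') (δ s : ℝ) :
    HasAngularDeriv (fun z => (cutoff δ (s * D z) : ℂ) * f z) fun θ =>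
      ((deriv Real.smoothTransition (s * D (circleMap 0 1 θ) / δ - 1) * (1 / δ) * (s * D₁ θ) : ℝ) : ℂ) *
        f (circleMap 0 1 θ) + (cutoff δ (s * D (circleMap 0 1 θ)) : ℂ) * f' θ := by
  intro θ
  have h1 := (hasDerivAt_cutoff δ (s * D (circleMap 0 1 θ))).comp θ ((hD θ).const_mul s)
  exact h1.ofReal_comp.mul (hf θ)

theorem continuous_angularDeriv_cutoff (hD : Continuous fun θ => D (circleMap 0 1 θ))
    (hD₁ : Continuous D₁) (hf : Continuous fun θ => f (circleMap 0 1 θ)) (hf' : Continuous f')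
    (δ s : ℝ) : Continuous fun θ =>
      ((deriv Real.smoothTransition (s * D (circleMap 0 1 θ) / δ - 1) * (1 / δ) * (s * D₁ θ) : ℝ) : ℂ) *
        f (circleMap 0 1 θ) + (cutoff δ (s * D (circleMap 0 1 θ)) : ℂ) * f' θ := by
  have h1 : Continuous fun θ => deriv Real.smoothTransition (s * D (circleMap 0 1 θ) / δ - 1) :=
    continuous_deriv_smoothTransition.comp (((continuous_const.mul hD).div_const δ).sub continuous_const)
  have h2 : Continuous fun θ => cutoff δ (s * D (circleMap 0 1 θ)) :=
    (continuous_cutoff δ).comp (continuous_const.mul hD)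
  exact ((Complex.continuous_ofReal.comp ((h1.mul continuous_const).mul
    (continuous_const.mul hD₁))).mul hf).add ((Complex.continuous_ofReal.comp h2).mul hf')

theorem continuousOn_cutoff_mul (hD : ContinuousOn D unitCircle) (hf : ContinuousOn f unitCircle)
    (δ s : ℝ) : ContinuousOn (fun z => (cutoff δ (s * D z) : ℂ) * f z) unitCircle :=
  (Complex.continuous_ofReal.comp_continuousOn
    ((continuous_cutoff δ).comp_continuousOn (continuousOn_const.mul hD))).mul hf

theorem cutoff_tendsto (x s : ℝ) : Tendsto (fun n : ℕ => cutoff (1 / ((n : ℝ) + 1)) (s * x)) atTop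
    (𝓝 (if 0 < s * x then 1 else 0)) := by
  split_ifs with h
  · refine tendsto_const_nhds.congr' ?_
    have h1 : Tendsto (fun n : ℕ => 2 * (1 / ((n : ℝ) + 1))) atTop (𝓝 0) := by
      simpa using (tendsto_one_div_add_atTop_nhds_zero_nat (𝕜 := ℝ)).const_mul 2
    filter_upwards [h1.eventually (gt_mem_nhds h)] with n hn
    rw [cutoff_of_ge (by positivity) hn.le]
  · refine tendsto_const_nhds.congr fun n => ?_
    rw [cutoff_of_le (by positivity) ((not_lt.1 h).trans (by positivity))]

theorem tendsto_avg_cutoff (hD : ContinuousOn D unitCircle) (hf : ContinuousOn f unitCircle)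
    (hg : ContinuousOn g unitCircle) :
    Tendsto (fun n : ℕ => avg fun z => (cutoff (1 / ((n : ℝ) + 1)) (1 * D z) : ℂ) * f z * g z) atTop
      (𝓝 (avg fun z => if 0 < D z then f z * g z else 0)) := by
  simp only [avg_eq_integral]
  refine tendsto_integral_of_dominated_convergence (fun x => ‖f (circ x) * g (circ x)‖)
    (fun n => ((integrable_comp_circ ((continuousOn_cutoff_mul hD hf _ 1).mul hg))).1)
    (integrable_comp_circ (hf.mul hg)).norm (fun n => ae_of_all _ fun x => ?_)
    (ae_of_all _ fun x => ?_)
  · rw [mul_assoc, norm_mul, Complex.norm_real, Real.norm_of_nonneg (cutoff_nonneg _ _)]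
    exact mul_le_of_le_one_left (norm_nonneg _) (cutoff_le_one _ _)
  · have h := (Complex.continuous_ofReal.tendsto _).comp (cutoff_tendsto (D (circ x)) 1)
    have h2 := (h.mul_const (f (circ x))).mul_const (g (circ x))
    refine (congrArg (Tendsto _ atTop) (congrArg 𝓝 ?_)).mp h2
    rw [one_mul]
    split_ifs <;> simp

/-- What the two cutoffs leave lives where |D| is below twice the cutoff width, and D is almost
everywhere nonzero. -/
theorem tendsto_energy_cutoff (hD : ContinuousOn D unitCircle) (hf : ContinuousOn f unitCircle)
    (hD0 : ∀ᵐ x ∂AddCircle.haarAddCircle (T := 2 * Real.pi), D (circ x) ≠ 0) :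
    Tendsto (fun n : ℕ => energy fun z => f z - (cutoff (1 / ((n : ℝ) + 1)) (1 * D z) : ℂ) * f z -
      (cutoff (1 / ((n : ℝ) + 1)) (-1 * D z) : ℂ) * f z) atTop (𝓝 0) := by
  simp only [energy_eq_integral]
  have hint : Integrable (fun x => ‖f (circ x)‖ ^ 2)
      (AddCircle.haarAddCircle (T := 2 * Real.pi)) :=
    (((continuous_comp_circ hf).norm).pow 2).integrable_of_hasCompactSupport
      (HasCompactSupport.of_compactSpace _)
  have h := tendsto_integral_of_dominated_convergence (μ := AddCircle.haarAddCircle (T := 2 * Real.pi))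
    (F := fun (n : ℕ) x => ‖f (circ x) - (cutoff (1 / ((n : ℝ) + 1)) (1 * D (circ x)) : ℂ) * f (circ x) -
      (cutoff (1 / ((n : ℝ) + 1)) (-1 * D (circ x)) : ℂ) * f (circ x)‖ ^ 2) (f := fun _ => 0)
    (fun x => ‖f (circ x)‖ ^ 2)
    (fun n => ?_) hint (fun n => ae_of_all _ fun x => ?_) ?_
  · simpa using h
  · have c1 := continuous_comp_circ ((hf.sub (continuousOn_cutoff_mul hD hf (1 / ((n : ℝ) + 1)) 1)).sub
      (continuousOn_cutoff_mul hD hf (1 / ((n : ℝ) + 1)) (-1)))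
    exact ((c1.norm).pow 2).aestronglyMeasurable
  · set δ : ℝ := 1 / ((n : ℝ) + 1) with hδ
    have hδ0 : 0 < δ := by positivity
    set a := cutoff δ (1 * D (circ x))
    set b := cutoff δ (-1 * D (circ x))
    have ha : 0 ≤ a ∧ a ≤ 1 := ⟨cutoff_nonneg _ _, cutoff_le_one _ _⟩
    have hb : 0 ≤ b ∧ b ≤ 1 := ⟨cutoff_nonneg _ _, cutoff_le_one _ _⟩
    have hab : a + b ≤ 1 := by
      rcases le_total (D (circ x)) 0 with h0 | h0
      · have : a = 0 := cutoff_of_le hδ0 (by linarith)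
        linarith
      · have : b = 0 := cutoff_of_le hδ0 (by linarith)
        linarith
    have e : f (circ x) - (a : ℂ) * f (circ x) - (b : ℂ) * f (circ x) =
        ((1 - a - b : ℝ) : ℂ) * f (circ x) := by push_cast; ring
    rw [e, norm_pow, norm_norm, norm_mul, Complex.norm_real, Real.norm_of_nonneg (by linarith)]
    refine pow_le_pow_left₀ (by have : 0 ≤ 1 - a - b := by linarith
                                positivity) ?_ 2
    exact mul_le_of_le_one_left (norm_nonneg _) (by linarith)
  · filter_upwards [hD0] with x hx
    have h1 := (Complex.continuous_ofReal.tendsto _).comp (cutoff_tendsto (D (circ x)) 1)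
    have h2 := (Complex.continuous_ofReal.tendsto _).comp (cutoff_tendsto (D (circ x)) (-1))
    have h3 := (((tendsto_const_nhds (x := f (circ x))).sub (h1.mul_const (f (circ x)))).sub
      (h2.mul_const (f (circ x)))).norm.pow 2
    refine (congrArg (Tendsto _ atTop) (congrArg 𝓝 ?_)).mp h3
    rcases lt_or_gt_of_ne hx with h0 | h0
    · rw [if_neg (by linarith), if_pos (by linarith)]; simp
    · rw [if_pos (by linarith), if_neg (by linarith)]; simp

/-- The nonnegative frequencies asymptotically project to the set where the local frequency is
positive. -/
theorem HasLocalFrequency.tendsto_halfSum_fixed (hE : HasLocalFrequency l T E D ψ₁ ψ₂ B)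
    (hD : ∀ θ, HasDerivAt (fun θ => D (circleMap 0 1 θ)) (D₁ θ) θ) (hD₁ : Continuous D₁)
    (hD0 : ∀ᵐ x ∂AddCircle.haarAddCircle (T := 2 * Real.pi), D (circ x) ≠ 0)
    (hf : ContinuousOn f unitCircle) (hf' : HasAngularDeriv f f') (hf'c : Continuous f')
    (hg : ContinuousOn g unitCircle) :
    Tendsto (fun i => halfSum (fun z => E i z * f z) (fun z => (E i z)⁻¹ * g z)) l
      (𝓝 (avg fun z => if 0 < D z then f z * g z else 0)) := by
  have hDc := hE.continuousOn_frequency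
  have hDθ : Continuous fun θ => D (circleMap 0 1 θ) :=
    hDc.comp_continuous (continuous_circleMap 0 1) circleMap_mem_unitCircle
  have hfθ : Continuous fun θ => f (circleMap 0 1 θ) :=
    hf.comp_continuous (continuous_circleMap 0 1) circleMap_mem_unitCircle
  rw [Metric.tendsto_nhds]
  intro ε hε
  -- The cutoff width is fixed first, to control the region where D is near zero; only then does the
  -- oscillation become fast.
  obtain ⟨n, hn1, hn2⟩ : ∃ n : ℕ,
      dist (avg fun z => (cutoff (1 / ((n : ℝ) + 1)) (1 * D z) : ℂ) * f z * g z)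
        (avg fun z => if 0 < D z then f z * g z else 0) < ε / 4 ∧
      √(energy fun z => f z - (cutoff (1 / ((n : ℝ) + 1)) (1 * D z) : ℂ) * f z -
        (cutoff (1 / ((n : ℝ) + 1)) (-1 * D z) : ℂ) * f z) * √(energy g) < ε / 4 := by
    have h1 := (Metric.tendsto_nhds.1 (tendsto_avg_cutoff hDc hf hg)) (ε / 4) (by positivity)
    have h2 : Tendsto (fun n : ℕ => √(energy fun z => f z -
        (cutoff (1 / ((n : ℝ) + 1)) (1 * D z) : ℂ) * f z -
        (cutoff (1 / ((n : ℝ) + 1)) (-1 * D z) : ℂ) * f z) * √(energy g)) atTop (𝓝 0) := by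
      have := ((Real.continuous_sqrt.tendsto _).comp
        (tendsto_energy_cutoff hDc hf hD0)).mul_const √(energy g)
      simpa using this
    exact (h1.and (h2.eventually (gt_mem_nhds (by positivity)))).exists
  set δ : ℝ := 1 / ((n : ℝ) + 1) with hδ
  have hδ0 : 0 < δ := by positivity
  set f₁ : ℂ → ℂ := fun z => (cutoff δ (1 * D z) : ℂ) * f z with hf₁
  set f₂ : ℂ → ℂ := fun z => (cutoff δ (-1 * D z) : ℂ) * f z with hf₂
  have c1 : ContinuousOn f₁ unitCircle := continuousOn_cutoff_mul hDc hf δ 1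
  have c2 : ContinuousOn f₂ unitCircle := continuousOn_cutoff_mul hDc hf δ (-1)
  have c3 : ContinuousOn (fun z => f z - f₁ z - f₂ z) unitCircle := (hf.sub c1).sub c2
  -- `f₁` lives where D > δ, so its negative frequencies are small; for `f₂`, living where D < -δ,
  -- it is the nonnegative ones.
  obtain ⟨M₁, hM₁⟩ := hE.decay (s := 1) c1 (angularDeriv_cutoff hD hf' δ 1)
    (continuous_angularDeriv_cutoff hDθ hD₁ hfθ hf'c δ 1) hδ0 (by simp)
    (fun z _ hz => by simp only [hf₁]; rw [cutoff_of_le hδ0 hz.le]; simp)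
    (φ := fun k => -((k : ℤ) + 1)) (fun k => by push_cast; linarith)
  obtain ⟨M₂, hM₂⟩ := hE.decay (s := -1) c2 (angularDeriv_cutoff hD hf' δ (-1))
    (continuous_angularDeriv_cutoff hDθ hD₁ hfθ hf'c δ (-1)) hδ0 (by simp)
    (fun z _ hz => by simp only [hf₂]; rw [cutoff_of_le hδ0 hz.le]; simp)
    (φ := fun k => (k : ℤ)) (fun k => by push_cast; linarith)
  filter_upwards [hM₁, hM₂, hE.continuousOn, hE.norm_eq_one, hE.scale.eventually_gt_atTop 0,
    (tendsto_const_div_sqrt hE.scale hδ0 |M₁| √(energy g)).eventually (gt_mem_nhds (show 0 < ε / 4 by positivity)),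
    (tendsto_const_div_sqrt hE.scale hδ0 |M₂| √(energy g)).eventually (gt_mem_nhds (show 0 < ε / 4 by positivity))]
    with i hi₁ hi₂ hEc hEn hT hs₁ hs₂
  have hEne : ∀ z ∈ unitCircle, E i z ≠ 0 := fun z hz h0 => by
    have := hEn z hz
    rw [h0, norm_zero] at this
    exact zero_ne_one this
  have hV : ContinuousOn (fun z => (E i z)⁻¹ * g z) unitCircle := (hEc.inv₀ hEne).mul hg
  have hVe : energy (fun z => (E i z)⁻¹ * g z) = energy g :=
    energy_mul_eq fun z hz => by rw [norm_inv, hEn z hz, inv_one]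
  have u1 : ContinuousOn (fun z => E i z * f₁ z) unitCircle := hEc.mul c1
  have u2 : ContinuousOn (fun z => E i z * f₂ z) unitCircle := hEc.mul c2
  have u3 : ContinuousOn (fun z => E i z * (f z - f₁ z - f₂ z)) unitCircle := hEc.mul c3
  have ha : 0 < T i * δ / 8 := by positivity
  have hsplit : halfSum (fun z => E i z * f z) (fun z => (E i z)⁻¹ * g z) =
      halfSum (fun z => E i z * f₁ z) (fun z => (E i z)⁻¹ * g z) +
      halfSum (fun z => E i z * f₂ z) (fun z => (E i z)⁻¹ * g z) +
      halfSum (fun z => E i z * (f z - f₁ z - f₂ z)) (fun z => (E i z)⁻¹ * g z) := by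
    have u12 : ContinuousOn (fun z => E i z * f₁ z + E i z * f₂ z) unitCircle := u1.add u2
    rw [← halfSum_add_left u1 u2 hV, ← halfSum_add_left u12 u3 hV]
    refine halfSum_congr (fun z _ => ?_) fun z _ => rfl
    ring
  -- The half sum of `f₁` is traded for the full pairing, in which the oscillating factors cancel,
  -- minus its small negative part.
  have hfull := halfSum_add_tsum_neg u1 hV
  have havg : (avg fun z => E i z * f₁ z * ((E i z)⁻¹ * g z)) = avg fun z => f₁ z * g z := by
    refine avg_congr fun z hz => ?_
    have := hEne z hz
    field_simp
  rw [havg] at hfull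
  have hnegV : ∀ s : Finset ℕ, ∑ k ∈ s, ‖cf (fun z => (E i z)⁻¹ * g z) ((k : ℤ) + 1)‖ ^ 2 ≤
      √(energy g) ^ 2 := fun s => by
    rw [← hVe]
    exact sum_comp_le_energy hV (φ := fun k => (k : ℤ) + 1) (fun a b hab => by simpa using hab) s
  have hposV : ∀ s : Finset ℕ, ∑ k ∈ s, ‖cf (fun z => (E i z)⁻¹ * g z) (-(k : ℤ))‖ ^ 2 ≤
      √(energy g) ^ 2 := fun s => by
    rw [← hVe]
    exact sum_comp_le_energy hV natCast_neg_injective s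
  have habs : ∀ {M : ℝ} {k : ℕ} {v : ℂ}, ‖v‖ ≤ M / (T i * δ / 8 + k + 1) →
      ‖v‖ ≤ |M| / (T i * δ / 8 + k + 1) := fun h =>
    h.trans (div_le_div_of_nonneg_right (le_abs_self _) (by positivity))
  have b1 := (summable_mul_and_norm_tsum_le (by positivity) (Real.sqrt_nonneg (energy g))
    (sum_norm_sq_le ha fun k => habs (hi₁ k)) hnegV).2
  have b2 := (summable_mul_and_norm_tsum_le (by positivity) (Real.sqrt_nonneg (energy g))
    (sum_norm_sq_le ha fun k => habs (hi₂ k)) hposV).2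
  have b3 := norm_halfSum_le u3 hV
  rw [hVe, energy_mul_eq hEn] at b3
  rw [dist_eq_norm] at hn1 ⊢
  rw [hsplit, eq_sub_of_add_eq hfull]
  calc ‖_‖ = ‖((avg fun z => f₁ z * g z) - avg fun z => if 0 < D z then f z * g z else 0) -
        (∑' k : ℕ, cf (fun z => E i z * f₁ z) (-((k : ℤ) + 1)) *
          cf (fun z => (E i z)⁻¹ * g z) ((k : ℤ) + 1)) +
        halfSum (fun z => E i z * f₂ z) (fun z => (E i z)⁻¹ * g z) +
        halfSum (fun z => E i z * (f z - f₁ z - f₂ z)) (fun z => (E i z)⁻¹ * g z)‖ := by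
          congr 1; ring
    _ ≤ _ := (norm_add_le _ _).trans (add_le_add_left ((norm_add_le _ _).trans
          (add_le_add_left (norm_sub_le _ _) _)) _)
    _ < ε / 4 + ε / 4 + ε / 4 + ε / 4 := by
          refine add_lt_add (add_lt_add (add_lt_add hn1 (b1.trans_lt hs₁)) (lt_of_le_of_lt ?_ hs₂))
            (b3.trans_lt hn2)
          exact b2
    _ = ε := by ring

end Oscillation

end FacetedCrystal

namespace FacetedCrystal

/-! ### Amplitudes that vary with T -/

section VaryingAmplitudes

variable {ι : Type*} {l : Filter ι} {T : ι → ℝ} {E : ι → ℂ → ℂ} {D : ℂ → ℝ} {ψ₁ ψ₂ : ι → ℝ → ℝ}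
  {B : ℝ} {f g : ℂ → ℂ} {f' : ℝ → ℂ} {D₁ : ℝ → ℝ}

/-- Bounded pointwise convergence on the circle. -/
structure BoundedlyTendsto (F : ι → ℂ → ℂ) (f : ℂ → ℂ) (l : Filter ι) : Prop where
  continuousOn : ∀ᶠ i in l, ContinuousOn (F i) unitCircle
  bound : ∃ C, ∀ᶠ i in l, ∀ z ∈ unitCircle, ‖F i z‖ ≤ C
  tendsto : ∀ z ∈ unitCircle, Tendsto (fun i => F i z) l (𝓝 (f z))

theorem BoundedlyTendsto.mul {F G : ι → ℂ → ℂ} (hF : BoundedlyTendsto F f l)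
    (hG : BoundedlyTendsto G g l) :
    BoundedlyTendsto (fun i z => F i z * G i z) (fun z => f z * g z) l := by
  obtain ⟨C, hC⟩ := hF.bound
  obtain ⟨C', hC'⟩ := hG.bound
  refine ⟨?_, ⟨C * C', ?_⟩, fun z hz => (hF.tendsto z hz).mul (hG.tendsto z hz)⟩
  · filter_upwards [hF.continuousOn, hG.continuousOn] with i h1 h2 using h1.mul h2
  · filter_upwards [hC, hC'] with i h1 h2 z hz
    rw [norm_mul]
    exact mul_le_mul (h1 z hz) (h2 z hz) (norm_nonneg _) ((norm_nonneg _).trans (h1 z hz))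

theorem boundedlyTendsto_const (hf : ContinuousOn f unitCircle) :
    BoundedlyTendsto (fun _ : ι => f) f l := by
  obtain ⟨C, _, hC⟩ := exists_bound_of_continuousOn hf
  exact ⟨Eventually.of_forall fun _ => hf, ⟨C, Eventually.of_forall fun _ => hC⟩,
    fun _ _ => tendsto_const_nhds⟩

theorem BoundedlyTendsto.tendsto_avg [l.IsCountablyGenerated] {F : ι → ℂ → ℂ} (hF : BoundedlyTendsto F f l) :
    Tendsto (fun i => avg (F i)) l (𝓝 (avg f)) := by
  obtain ⟨C, hC⟩ := hF.bound
  simp only [avg_eq_integral]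
  refine tendsto_integral_filter_of_dominated_convergence (fun _ => C) ?_ ?_ (integrable_const _)
    (ae_of_all _ fun x => hF.tendsto _ (circ_mem x))
  · filter_upwards [hF.continuousOn] with i hi using (integrable_comp_circ hi).1
  · filter_upwards [hC] with i hi using ae_of_all _ fun x => hi _ (circ_mem x)

theorem BoundedlyTendsto.energy_sub [l.IsCountablyGenerated] {F : ι → ℂ → ℂ}
    (hf : ContinuousOn f unitCircle) (hF : BoundedlyTendsto F f l) :
    Tendsto (fun i => energy fun z => F i z - f z) l (𝓝 0) := by
  obtain ⟨C, hC⟩ := hF.bound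
  obtain ⟨C', hC0, hC'⟩ := exists_bound_of_continuousOn hf
  simp only [energy_eq_integral]
  have h := tendsto_integral_filter_of_dominated_convergence (l := l)
    (μ := AddCircle.haarAddCircle (T := 2 * Real.pi))
    (F := fun i x => ‖F i (circ x) - f (circ x)‖ ^ 2) (f := fun _ => 0) (fun _ => (C + C') ^ 2)
    ?_ ?_ (integrable_const _) (ae_of_all _ fun x => ?_)
  · simpa using h
  · filter_upwards [hF.continuousOn] with i hi
    exact ((continuous_comp_circ (hi.sub hf)).norm.pow 2).aestronglyMeasurable
  · filter_upwards [hC] with i hi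
    refine ae_of_all _ fun x => ?_
    rw [norm_pow, norm_norm]
    exact pow_le_pow_left₀ (norm_nonneg _)
      ((norm_sub_le _ _).trans (add_le_add (hi _ (circ_mem x)) (hC' _ (circ_mem x)))) 2
  · have h1 := ((hF.tendsto _ (circ_mem x)).sub_const (f (circ x))).norm.pow 2
    simpa using h1

/-- Since |E| = 1, replacing the amplitudes by their limits changes the half sum by at most L²
distances, which tend to zero by dominated convergence. -/
theorem HasLocalFrequency.tendsto_halfSum [l.IsCountablyGenerated]
    (hE : HasLocalFrequency l T E D ψ₁ ψ₂ B)
    (hD : ∀ θ, HasDerivAt (fun θ => D (circleMap 0 1 θ)) (D₁ θ) θ) (hD₁ : Continuous D₁)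
    (hD0 : ∀ᵐ x ∂AddCircle.haarAddCircle (T := 2 * Real.pi), D (circ x) ≠ 0)
    (hf : ContinuousOn f unitCircle) (hf' : HasAngularDeriv f f') (hf'c : Continuous f')
    (hg : ContinuousOn g unitCircle) {F G : ι → ℂ → ℂ} (hF : BoundedlyTendsto F f l)
    (hG : BoundedlyTendsto G g l) :
    Tendsto (fun i => halfSum (fun z => E i z * F i z) (fun z => (E i z)⁻¹ * G i z)) l
      (𝓝 (avg fun z => if 0 < D z then f z * g z else 0)) := by
  have h1 := hE.tendsto_halfSum_fixed hD hD₁ hD0 hf hf' hf'c hg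
  obtain ⟨C, hC⟩ := hG.bound
  have h2 : Tendsto (fun i => √(energy fun z => F i z - f z) * C +
      √(energy f) * √(energy fun z => G i z - g z)) l (𝓝 0) := by
    have q1 := (Real.continuous_sqrt.tendsto _).comp (BoundedlyTendsto.energy_sub hf hF)
    have q2 := (Real.continuous_sqrt.tendsto _).comp (BoundedlyTendsto.energy_sub hg hG)
    simpa using (q1.mul_const C).add (q2.const_mul √(energy f))
  have h3 : Tendsto (fun i => halfSum (fun z => E i z * F i z) (fun z => (E i z)⁻¹ * G i z) -
      halfSum (fun z => E i z * f z) (fun z => (E i z)⁻¹ * g z)) l (𝓝 0) := by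
    refine squeeze_zero_norm' ?_ h2
    filter_upwards [hC, hE.continuousOn, hE.norm_eq_one, hF.continuousOn, hG.continuousOn] with
      i hCi hEc hEn hFc hGc
    have hEne : ∀ z ∈ unitCircle, E i z ≠ 0 := fun z hz h0 => by
      have := hEn z hz
      rw [h0, norm_zero] at this
      exact zero_ne_one this
    have hEn' : ∀ z ∈ unitCircle, ‖(E i z)⁻¹‖ = 1 := fun z hz => by rw [norm_inv, hEn z hz, inv_one]
    have hEc' : ContinuousOn (fun z => (E i z)⁻¹) unitCircle := hEc.inv₀ hEne
    have c1 : ContinuousOn (fun z => E i z * F i z) unitCircle := hEc.mul hFc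
    have c2 : ContinuousOn (fun z => E i z * f z) unitCircle := hEc.mul hf
    have c3 : ContinuousOn (fun z => (E i z)⁻¹ * G i z) unitCircle := hEc'.mul hGc
    have c4 : ContinuousOn (fun z => (E i z)⁻¹ * g z) unitCircle := hEc'.mul hg
    have c5 : ContinuousOn (fun z => E i z * F i z - E i z * f z) unitCircle := c1.sub c2
    have c6 : ContinuousOn (fun z => (E i z)⁻¹ * G i z - (E i z)⁻¹ * g z) unitCircle := c3.sub c4
    have e : halfSum (fun z => E i z * F i z) (fun z => (E i z)⁻¹ * G i z) -
        halfSum (fun z => E i z * f z) (fun z => (E i z)⁻¹ * g z) =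
        halfSum (fun z => E i z * F i z - E i z * f z) (fun z => (E i z)⁻¹ * G i z) +
        halfSum (fun z => E i z * f z) (fun z => (E i z)⁻¹ * G i z - (E i z)⁻¹ * g z) := by
      rw [halfSum_sub_left c1 c2 c3, halfSum_sub_right c2 c3 c4]
      ring
    rw [e]
    refine (norm_add_le _ _).trans (add_le_add ((norm_halfSum_le c5 c3).trans ?_)
      ((norm_halfSum_le c2 c6).trans ?_))
    · have e1 : (fun z => E i z * F i z - E i z * f z) = fun z => E i z * (F i z - f z) := by
        funext z; ring
      have hC0 : 0 ≤ C := (norm_nonneg _).trans (hCi 1 (by simp))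
      rw [e1, energy_mul_eq hEn, energy_mul_eq hEn']
      refine mul_le_mul_of_nonneg_left ?_ (Real.sqrt_nonneg _)
      rw [Real.sqrt_le_left hC0]
      exact energy_le hCi
    · have e1 : (fun z => (E i z)⁻¹ * G i z - (E i z)⁻¹ * g z) =
          fun z => (E i z)⁻¹ * (G i z - g z) := by
        funext z; ring
      rw [e1, energy_mul_eq hEn, energy_mul_eq hEn']
  simpa using h3.add h1

end VaryingAmplitudes

/-! ### One-sided trigonometric series -/

section OscillatorySeries

/-- A one-sided trigonometric series. -/
noncomputable def osc (a : ℕ → ℝ) (θ : ℝ) : ℂ :=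
  ∑' k : ℕ, (a k : ℂ) * Complex.exp (Complex.I * (k + 1) * θ)

theorem norm_osc_term (x : ℝ) (k : ℕ) (θ : ℝ) :
    ‖(x : ℂ) * Complex.exp (Complex.I * (k + 1) * θ)‖ = |x| := by
  rw [norm_mul, Complex.norm_exp, Complex.norm_real, Real.norm_eq_abs]
  simp

theorem norm_osc_le {a b : ℕ → ℝ} (hb : Summable b) (h : ∀ k, |a k| ≤ b k) (θ : ℝ) :
    ‖osc a θ‖ ≤ ∑' k, b k :=
  tsum_of_norm_bounded hb.hasSum fun k => by rw [norm_osc_term]; exact h k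

theorem summable_osc {a : ℕ → ℝ} (ha : Summable fun k => |a k|) (θ : ℝ) :
    Summable fun k : ℕ => (a k : ℂ) * Complex.exp (Complex.I * (k + 1) * θ) :=
  Summable.of_norm_bounded ha fun k => by rw [norm_osc_term]

theorem osc_sub {a b : ℕ → ℝ} (ha : Summable fun k => |a k|) (hb : Summable fun k => |b k|) (θ : ℝ) :
    osc (fun k => a k - b k) θ = osc a θ - osc b θ := by
  rw [osc, osc, osc, ← (summable_osc ha θ).tsum_sub (summable_osc hb θ)]
  refine tsum_congr fun k => ?_
  push_cast
  ring

theorem osc_const_mul (c : ℝ) (a : ℕ → ℝ) (θ : ℝ) : osc (fun k => c * a k) θ = c * osc a θ := by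
  rw [osc, osc, ← tsum_mul_left]
  refine tsum_congr fun k => ?_
  push_cast
  ring

theorem summable_abs_of_succ_mul {a : ℕ → ℝ} (ha : Summable fun k : ℕ => |((k : ℝ) + 1) * a k|) :
    Summable fun k => |a k| := by
  refine Summable.of_nonneg_of_le (fun _ => abs_nonneg _) (fun k => ?_) ha
  rw [abs_mul, abs_of_nonneg (show (0 : ℝ) ≤ (k : ℝ) + 1 by positivity)]
  exact le_mul_of_one_le_left (abs_nonneg _) (by have : (0 : ℝ) ≤ k := Nat.cast_nonneg k
                                                 linarith)

theorem hasDerivAt_osc {a : ℕ → ℝ} (ha : Summable fun k : ℕ => |((k : ℝ) + 1) * a k|) (θ : ℝ) :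
    HasDerivAt (osc a) (Complex.I * osc (fun k => ((k : ℝ) + 1) * a k) θ) θ := by
  have h := hasDerivAt_tsum (𝕜 := ℝ) (F := ℂ) ha
    (g := fun (k : ℕ) (θ : ℝ) => (a k : ℂ) * Complex.exp (Complex.I * (k + 1) * θ))
    (g' := fun (k : ℕ) (θ : ℝ) => Complex.I * ((((k : ℝ) + 1) * a k : ℝ) *
      Complex.exp (Complex.I * (k + 1) * θ))) (y₀ := 0)
    (fun k θ => ?_) (fun k θ => ?_) (summable_osc (summable_abs_of_succ_mul ha) 0) θ
  · rw [tsum_mul_left] at h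
    exact h
  · have h1 : HasDerivAt (fun θ : ℝ => Complex.exp (Complex.I * (k + 1) * θ))
        (Complex.exp (Complex.I * (k + 1) * θ) * (Complex.I * (k + 1) * 1)) θ :=
      (((hasDerivAt_id θ).ofReal_comp).const_mul _).cexp
    refine (h1.const_mul (a k : ℂ)).congr_deriv ?_
    push_cast
    ring
  · rw [norm_mul, Complex.norm_I, one_mul, norm_osc_term]

theorem continuous_osc {a : ℕ → ℝ} (ha : Summable fun k => |a k|) : Continuous (osc a) :=
  continuous_tsum (fun k => by fun_prop) ha fun k θ => (norm_osc_term _ _ _).le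

theorem hasDerivAt_re_osc {a : ℕ → ℝ} (ha : Summable fun k : ℕ => |((k : ℝ) + 1) * a k|) (θ : ℝ) :
    HasDerivAt (fun θ => (osc a θ).re) (-(osc (fun k => ((k : ℝ) + 1) * a k) θ).im) θ := by
  have h := (Complex.reCLM.hasFDerivAt.comp_hasDerivAt θ (hasDerivAt_osc ha θ))
  refine h.congr_deriv ?_
  simp

theorem exp_mul_circle (k : ℕ) (θ : ℝ) :
    Complex.exp (Complex.I * (k + 1) * θ) = circleMap 0 1 θ ^ (k + 1) := by
  rw [circleMap, Complex.ofReal_one, one_mul, zero_add, ← Complex.exp_nat_mul]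
  congr 1
  push_cast
  ring

/-- The Fourier coefficients of the potential on the circle of radius `c`. -/
noncomputable def potentialCoeff (κ c : ℝ) (k : ℕ) : ℝ :=
  κ ^ (k + 1) / ((k + 1) * (1 - κ ^ (2 * (k + 1)))) * c ^ (k + 1)

theorem potential_eq_osc (κ c θ : ℝ) :
    potential κ (c * circleMap 0 1 θ) = osc (potentialCoeff κ c) θ := by
  rw [potential, osc]
  refine tsum_congr fun k => ?_
  rw [exp_mul_circle, potentialCoeff, mul_pow]
  push_cast
  ring

end OscillatorySeries

end FacetedCrystal

namespace FacetedCrystal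

/-! ### The scaling q = 1 - 1/T -/

section Scaling

/-- The square root of the Boltzmann factor `1 - 1 / T`. -/
noncomputable def stepRatio (T : ℝ) : ℝ := √(1 - 1 / T)

theorem one_sub_inv_pos {T : ℝ} (hT : 1 < T) : 0 < 1 - 1 / T := by
  rw [sub_pos, div_lt_one (by linarith)]
  exact hT

theorem stepRatio_sq {T : ℝ} (hT : 1 < T) : stepRatio T ^ 2 = 1 - 1 / T :=
  Real.sq_sqrt (one_sub_inv_pos hT).le

theorem stepRatio_pos {T : ℝ} (hT : 1 < T) : 0 < stepRatio T := Real.sqrt_pos.2 (one_sub_inv_pos hT)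

theorem stepRatio_lt_one {T : ℝ} (hT : 1 < T) : stepRatio T < 1 := by
  rw [stepRatio, Real.sqrt_lt' one_pos, one_pow]
  have : 0 < 1 / T := by positivity
  linarith

/-- As 1 - q = 1/T, this is the geometric sum. It shows both that T(1 - q^n) is at least one for n ≥
1 and that it tends to n. -/
theorem scaled_one_sub_pow {T : ℝ} (hT : 1 < T) (n : ℕ) :
    T * (1 - stepRatio T ^ (2 * n)) = ∑ i ∈ Finset.range n, stepRatio T ^ (2 * i) := by
  have hT0 : T ≠ 0 := by linarith
  rw [pow_mul, stepRatio_sq hT, ← mul_neg_geom_sum (1 - 1 / T) n]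
  simp_rw [pow_mul, stepRatio_sq hT]
  field_simp
  ring

theorem one_le_scaled {T : ℝ} (hT : 1 < T) (n : ℕ) :
    1 ≤ T * (1 - stepRatio T ^ (2 * (n + 1))) := by
  rw [scaled_one_sub_pow hT, Finset.sum_range_succ']
  have : 0 ≤ ∑ i ∈ Finset.range n, stepRatio T ^ (2 * (i + 1)) :=
    Finset.sum_nonneg fun i _ => (pow_pos (stepRatio_pos hT) _).le
  simpa using this

theorem tendsto_stepRatio : Tendsto stepRatio atTop (𝓝 1) := by
  have h : Tendsto (fun T : ℝ => 1 - 1 / T) atTop (𝓝 1) := by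
    simpa using (tendsto_const_nhds (x := (1 : ℝ))).sub (tendsto_inv_atTop_zero (𝕜 := ℝ))
  have h2 := (Real.continuous_sqrt.tendsto 1).comp h
  rwa [Real.sqrt_one] at h2

theorem tendsto_scaled (n : ℕ) :
    Tendsto (fun T => T * (1 - stepRatio T ^ (2 * n))) atTop (𝓝 n) := by
  have h : Tendsto (fun T => ∑ i ∈ Finset.range n, stepRatio T ^ (2 * i)) atTop (𝓝 n) := by
    have := tendsto_finsetSum (Finset.range n) fun i _ => tendsto_stepRatio.pow (2 * i)
    simpa using this
  refine h.congr' ?_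
  filter_upwards [eventually_gt_atTop 1] with T hT using (scaled_one_sub_pow hT n).symm

theorem tendsto_stepRatio_pow {τ : ℝ} {Θ : ℝ → ℕ}
    (hΘ : Tendsto (fun T => (Θ T : ℝ) / T) atTop (𝓝 τ)) :
    Tendsto (fun T => stepRatio T ^ Θ T) atTop (𝓝 (Real.exp (-τ / 2))) := by
  have h1 := Real.tendsto_mul_log_one_add_div_atTop (-1)
  have h2 := (Real.continuous_exp.tendsto _).comp ((hΘ.mul h1).div_const 2)
  rw [mul_neg_one] at h2
  refine h2.congr' ?_
  filter_upwards [eventually_gt_atTop 1] with T hT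
  have hT0 : T ≠ 0 := by linarith
  have e : (Θ T : ℝ) / T * (T * Real.log (1 + -1 / T)) / 2 = Θ T * Real.log (stepRatio T) := by
    rw [stepRatio, Real.log_sqrt (one_sub_inv_pos hT).le, show 1 + -1 / T = 1 - 1 / T by ring]
    field_simp
  rw [Function.comp_apply, e, mul_comm, Real.exp_mul, Real.exp_log (stepRatio_pos hT),
    Real.rpow_natCast]

end Scaling

/-! ### The local frequency of the carrier -/

section Frequencies

theorem summable_succ_pow_mul {c : ℝ} (h0 : 0 ≤ c) (h1 : c < 1) (m : ℕ) :
    Summable fun k : ℕ => ((k : ℝ) + 1) ^ m * c ^ (k + 1) := by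
  have h := summable_pow_mul_geometric_of_norm_lt_one (R := ℝ) m (r := c)
    (by rwa [Real.norm_of_nonneg h0])
  have h2 := (summable_nat_add_iff 1).2 h
  refine h2.congr fun k => ?_
  push_cast
  rfl

/-- The coefficients of the local frequency. -/
noncomputable def frequencyCoeff (κ c : ℝ) (k : ℕ) : ℝ := ((k : ℝ) + 1) * potentialCoeff κ c k

theorem frequencyCoeff_eq (κ c : ℝ) (k : ℕ) :
    frequencyCoeff κ c k = κ ^ (k + 1) * c ^ (k + 1) / (1 - κ ^ (2 * (k + 1))) := by
  rw [frequencyCoeff, potentialCoeff]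
  have : ((k : ℝ) + 1) ≠ 0 := by positivity
  field_simp

theorem frequencyCoeff_nonneg {T c : ℝ} (hT : 1 < T) (hc : 0 ≤ c) (k : ℕ) :
    0 ≤ frequencyCoeff (stepRatio T) c k := by
  rw [frequencyCoeff_eq]
  have h1 := stepRatio_pos hT
  have h2 : stepRatio T ^ (2 * (k + 1)) ≤ 1 := pow_le_one₀ h1.le (stepRatio_lt_one hT).le
  have h3 : 0 ≤ 1 - stepRatio T ^ (2 * (k + 1)) := by linarith
  positivity

/-- The bound is uniform in T after division by T, by `one_le_scaled`; it is the majorant in all the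
limits of this part. -/
theorem frequencyCoeff_le {T c c₁ : ℝ} (hT : 1 < T) (hc : 0 ≤ c) (hcc : c ≤ c₁) (k : ℕ) :
    frequencyCoeff (stepRatio T) c k ≤ T * c₁ ^ (k + 1) := by
  have h1 := stepRatio_pos hT
  have h2 := one_le_scaled hT k
  have hT0 : 0 < T := by linarith
  have h3 : 0 < 1 - stepRatio T ^ (2 * (k + 1)) := by
    by_contra h
    have := mul_nonpos_of_nonneg_of_nonpos hT0.le (not_lt.1 h)
    linarith
  rw [frequencyCoeff_eq, div_le_iff₀ h3]
  have h4 : stepRatio T ^ (k + 1) ≤ 1 := pow_le_one₀ h1.le (stepRatio_lt_one hT).le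
  have h5 : c ^ (k + 1) ≤ c₁ ^ (k + 1) := pow_le_pow_left₀ hc hcc _
  have h6 : 0 ≤ c₁ ^ (k + 1) := pow_nonneg (hc.trans hcc) _
  calc stepRatio T ^ (k + 1) * c ^ (k + 1) ≤ 1 * c₁ ^ (k + 1) :=
        mul_le_mul h4 h5 (pow_nonneg hc _) zero_le_one
    _ ≤ (T * (1 - stepRatio T ^ (2 * (k + 1)))) * c₁ ^ (k + 1) :=
        mul_le_mul_of_nonneg_right h2 h6
    _ = _ := by ring

theorem tendsto_frequencyCoeff {c : ℝ → ℝ} {c₀ : ℝ} (hc : Tendsto c atTop (𝓝 c₀)) (k : ℕ) :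
    Tendsto (fun T => frequencyCoeff (stepRatio T) (c T) k / T) atTop
      (𝓝 (c₀ ^ (k + 1) / (k + 1))) := by
  have h1 := tendsto_scaled (k + 1)
  have h2 := ((tendsto_stepRatio.pow (k + 1)).mul (hc.pow (k + 1))).div h1
    (by positivity : ((k + 1 : ℕ) : ℝ) ≠ 0)
  rw [one_pow, one_mul] at h2
  push_cast at h2
  refine h2.congr fun T => ?_
  rw [frequencyCoeff_eq, div_div, mul_comm _ T]
  rfl

/-- The limiting coefficients of the local frequency. -/
noncomputable def limitCoeff (c : ℝ) (k : ℕ) : ℝ := c ^ (k + 1) / (k + 1)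

theorem abs_limitCoeff_le {c c₁ : ℝ} (h0 : 0 ≤ c) (h1 : c ≤ c₁) (k : ℕ) :
    |limitCoeff c k| ≤ c₁ ^ (k + 1) := by
  rw [limitCoeff, abs_of_nonneg (by positivity)]
  exact (div_le_self (by positivity) (by
    have : (0 : ℝ) ≤ k := Nat.cast_nonneg k
    linarith)).trans (pow_le_pow_left₀ h0 h1 _)

theorem tendsto_frequency_error {c : ℝ → ℝ} {c₀ c₁ : ℝ} (h0 : ∀ᶠ T in atTop, 0 ≤ c T)
    (hc : Tendsto c atTop (𝓝 c₀)) (hc0 : 0 ≤ c₀) (hc₁ : c₀ < c₁) (hc1 : c₁ < 1) :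
    Tendsto (fun T => ∑' k, |frequencyCoeff (stepRatio T) (c T) k / T - limitCoeff c₀ k|) atTop
      (𝓝 0) := by
  have hs := summable_succ_pow_mul (hc0.trans hc₁.le) hc1 0
  simp only [pow_zero, one_mul] at hs
  have h := tendsto_tsum_of_dominated_convergence (𝓕 := atTop)
    (f := fun T k => |frequencyCoeff (stepRatio T) (c T) k / T - limitCoeff c₀ k|)
    (g := fun _ => 0) (hs.add hs) (fun k => ?_) ?_
  · simpa using h
  · have := ((tendsto_frequencyCoeff hc k).sub_const (limitCoeff c₀ k)).abs
    simpa [limitCoeff] using this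
  · filter_upwards [h0, hc.eventually (gt_mem_nhds hc₁), eventually_gt_atTop 1] with T hT0 hT1 hT k
    have hTp : 0 < T := by linarith
    rw [Real.norm_eq_abs, abs_abs]
    refine (abs_sub _ _).trans (add_le_add ?_ (abs_limitCoeff_le hc0 hc₁.le k))
    rw [abs_of_nonneg (div_nonneg (frequencyCoeff_nonneg hT hT0 k) hTp.le), div_le_iff₀ hTp,
      mul_comm _ T]
    exact frequencyCoeff_le hT hT0 hT1.le k

/-- The limiting local frequency, relative to the scale `T`. -/
noncomputable def localFrequency (ζ c : ℝ) (z : ℂ) : ℝ := -(2 * Real.log ‖1 - c * z‖) - ζ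

theorem one_sub_mul_ne_zero {c : ℝ} (h0 : 0 ≤ c) (h1 : c < 1) {z : ℂ} (hz : z ∈ unitCircle) :
    (1 : ℂ) - c * z ≠ 0 := by
  intro h
  have h2 := congrArg norm (sub_eq_zero.1 h)
  rw [norm_one, norm_mul, norm_of_mem_unitCircle hz, Complex.norm_real, Real.norm_of_nonneg h0,
    mul_one] at h2
  linarith

theorem localFrequency_circleMap {c : ℝ} (h0 : 0 ≤ c) (h1 : c < 1) (ζ θ : ℝ) :
    localFrequency ζ c (circleMap 0 1 θ) = 2 * (osc (limitCoeff c) θ).re - ζ := by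
  have hz : ‖(c : ℂ) * circleMap 0 1 θ‖ < 1 := by
    rw [norm_mul, norm_of_mem_unitCircle (circleMap_mem_unitCircle θ), mul_one, Complex.norm_real,
      Real.norm_of_nonneg h0]
    exact h1
  have h := Complex.hasSum_taylorSeries_neg_log hz
  have h2 := (hasSum_nat_add_iff' 1).2 h
  simp only [Finset.range_one, Finset.sum_singleton, pow_zero, Nat.cast_zero, div_zero,
    sub_zero] at h2
  have e : osc (limitCoeff c) θ = -Complex.log (1 - c * circleMap 0 1 θ) := by
    rw [← h2.tsum_eq, osc]
    refine tsum_congr fun k => ?_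
    rw [exp_mul_circle, limitCoeff, mul_pow]
    push_cast
    ring
  rw [e, localFrequency, Complex.neg_re, Complex.log_re]
  ring

theorem summable_succ_mul_of_le {a : ℕ → ℝ} {c C : ℝ} (h0 : 0 ≤ c) (h1 : c < 1)
    (ha : ∀ k, |a k| ≤ C * c ^ (k + 1)) (m : ℕ) :
    Summable fun k : ℕ => |((k : ℝ) + 1) ^ m * a k| := by
  refine Summable.of_nonneg_of_le (fun _ => abs_nonneg _) (fun k => ?_)
    ((summable_succ_pow_mul h0 h1 m).mul_left C)
  rw [abs_mul, abs_of_nonneg (show (0 : ℝ) ≤ ((k : ℝ) + 1) ^ m by positivity), mul_left_comm]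
  exact mul_le_mul_of_nonneg_left (ha k) (by positivity)

theorem hasDerivAt_localFrequency {c : ℝ} (h0 : 0 ≤ c) (h1 : c < 1) (ζ θ : ℝ) :
    HasDerivAt (fun θ => localFrequency ζ c (circleMap 0 1 θ))
      (-(2 * (osc (fun k => ((k : ℝ) + 1) * limitCoeff c k) θ).im)) θ := by
  simp_rw [localFrequency_circleMap h0 h1]
  have hs := summable_succ_mul_of_le (C := 1) h0 h1
    (fun k => by rw [one_mul]; exact abs_limitCoeff_le h0 le_rfl k) 1
  simp only [pow_one] at hs
  refine (((hasDerivAt_re_osc hs θ).const_mul 2).sub_const ζ).congr_deriv ?_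
  ring

theorem continuous_deriv_localFrequency {c : ℝ} (h0 : 0 ≤ c) (h1 : c < 1) :
    Continuous fun θ => -(2 * (osc (fun k => ((k : ℝ) + 1) * limitCoeff c k) θ).im) := by
  have hs := summable_succ_mul_of_le (C := 1) h0 h1
    (fun k => by rw [one_mul]; exact abs_limitCoeff_le h0 le_rfl k) 1
  simp only [pow_one] at hs
  exact (continuous_const.mul (Complex.continuous_im.comp (continuous_osc hs))).neg

theorem continuousOn_localFrequency {c : ℝ} (h0 : 0 ≤ c) (h1 : c < 1) (ζ : ℝ) :
    ContinuousOn (localFrequency ζ c) unitCircle := by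
  refine ContinuousOn.sub (ContinuousOn.neg (continuousOn_const.mul
    (ContinuousOn.log (by fun_prop) fun z hz => ?_))) continuousOn_const
  exact norm_ne_zero_iff.2 (one_sub_mul_ne_zero h0 h1 hz)

/-- The unimodular part of the evolution to a macroscopic time, seen from a macroscopic position. -/
noncomputable def carrier (κ c : ℝ) (J : ℤ) (z : ℂ) : ℂ := z ^ (-J) * symbol κ c 0 0 c z

/-- On the circle the two potentials in the carrier are complex conjugates, so their difference is
purely imaginary and only a phase remains. -/
theorem carrier_eq (κ c : ℝ) (J : ℤ) (θ : ℝ) : carrier κ c J (circleMap 0 1 θ) =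
    Complex.exp (Complex.I * ((2 * (osc (potentialCoeff κ c) θ).im - J * θ : ℝ) : ℂ)) := by
  have hz := circleMap_mem_unitCircle θ
  have h1 : potential κ (c * (circleMap 0 1 θ)⁻¹) =
      (starRingEnd ℂ) (osc (potentialCoeff κ c) θ) := by
    rw [← potential_eq_osc, ← potential_conj, map_mul, Complex.conj_ofReal, conj_of_mem_unitCircle hz]
  have h2 : circleMap 0 1 θ ^ (-J) = Complex.exp (-(Complex.I * J * θ)) := by
    rw [circleMap, Complex.ofReal_one, one_mul, zero_add, ← Complex.exp_int_mul]
    congr 1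
    push_cast
    ring
  rw [carrier, symbol, h1, h2, potential_eq_osc, ← Complex.exp_add]
  simp only [Complex.ofReal_zero, zero_mul, potential_zero, sub_zero, zero_sub]
  congr 1
  have h3 : osc (potentialCoeff κ c) θ - (starRingEnd ℂ) (osc (potentialCoeff κ c) θ) =
      2 * Complex.I * ((osc (potentialCoeff κ c) θ).im : ℂ) := by
    rw [Complex.sub_conj]
    push_cast
    ring
  rw [← sub_eq_add_neg, h3]
  push_cast
  ring

theorem exists_angle {z : ℂ} (hz : z ∈ unitCircle) : ∃ θ : ℝ, circleMap 0 1 θ = z := by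
  have h : z ∈ Set.range (circleMap 0 1) := by
    rw [range_circleMap, abs_one]
    exact hz
  exact h

theorem norm_carrier (κ c : ℝ) (J : ℤ) {z : ℂ} (hz : z ∈ unitCircle) : ‖carrier κ c J z‖ = 1 := by
  obtain ⟨θ, rfl⟩ := exists_angle hz
  rw [carrier_eq, mul_comm, Complex.norm_exp_ofReal_mul_I]

theorem hasAngularDeriv_carrier {κ c : ℝ}
    (hs : Summable fun k : ℕ => |((k : ℝ) + 1) * potentialCoeff κ c k|) (J : ℤ) :
    HasAngularDeriv (carrier κ c J) fun θ => Complex.I *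
      ((2 * (osc (frequencyCoeff κ c) θ).re - J : ℝ) : ℂ) * carrier κ c J (circleMap 0 1 θ) := by
  intro θ
  have h1 : HasDerivAt (fun θ => (osc (potentialCoeff κ c) θ).im) (osc (frequencyCoeff κ c) θ).re θ := by
    have h := (Complex.imCLM.hasFDerivAt.comp_hasDerivAt θ (hasDerivAt_osc hs θ))
    refine h.congr_deriv ?_
    simp only [Complex.imCLM_apply, Complex.mul_im, Complex.I_re, Complex.I_im, zero_mul, one_mul,
      zero_add]
    rfl
  have h2 : HasDerivAt (fun θ => 2 * (osc (potentialCoeff κ c) θ).im - J * θ)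
      (2 * (osc (frequencyCoeff κ c) θ).re - J * 1) θ :=
    (h1.const_mul 2).sub ((hasDerivAt_id θ).const_mul (J : ℝ))
  have h3 := (h2.ofReal_comp.const_mul Complex.I).cexp
  simp_rw [carrier_eq]
  refine h3.congr_deriv ?_
  push_cast
  ring

/-- The carriers oscillate with the local frequency `T * localFrequency`. -/
theorem hasLocalFrequency_carrier {ζ c₀ c₁ : ℝ} {c : ℝ → ℝ} {J : ℝ → ℤ}
    (hJ : Tendsto (fun T => (J T : ℝ) / T) atTop (𝓝 ζ)) (h0 : ∀ᶠ T in atTop, 0 ≤ c T)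
    (hc : Tendsto c atTop (𝓝 c₀)) (hc0 : 0 ≤ c₀) (hc₁ : c₀ < c₁) (hc1 : c₁ < 1) :
    HasLocalFrequency atTop (fun T => T) (fun T => carrier (stepRatio T) (c T) (J T))
      (localFrequency ζ c₀)
      (fun T θ => 2 * (osc (frequencyCoeff (stepRatio T) (c T)) θ).re - J T)
      (fun T θ => 2 * -(osc (fun k => ((k : ℝ) + 1) * frequencyCoeff (stepRatio T) (c T) k) θ).im)
      (2 * ∑' k : ℕ, ((k : ℝ) + 1) * c₁ ^ (k + 1)) := by
  have hc₁0 : 0 ≤ c₁ := hc0.trans hc₁.le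
  have hbasic : ∀ᶠ T in atTop, 1 < T ∧ 0 ≤ c T ∧ c T ≤ c₁ := by
    filter_upwards [h0, hc.eventually (gt_mem_nhds hc₁), eventually_gt_atTop 1] with T h1 h2 h3
    exact ⟨h3, h1, h2.le⟩
  have hle : ∀ {T : ℝ}, 1 < T → 0 ≤ c T → c T ≤ c₁ → ∀ k,
      |frequencyCoeff (stepRatio T) (c T) k| ≤ T * c₁ ^ (k + 1) := fun h1 h2 h3 k => by
    rw [abs_of_nonneg (frequencyCoeff_nonneg h1 h2 k)]
    exact frequencyCoeff_le h1 h2 h3 k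
  have hs0 : ∀ {T : ℝ}, 1 < T → 0 ≤ c T → c T ≤ c₁ →
      Summable fun k => |frequencyCoeff (stepRatio T) (c T) k| := fun h1 h2 h3 => by
    simpa using summable_succ_mul_of_le hc₁0 hc1 (hle h1 h2 h3) 0
  have hs1 : ∀ {T : ℝ}, 1 < T → 0 ≤ c T → c T ≤ c₁ →
      Summable fun k : ℕ => |((k : ℝ) + 1) * frequencyCoeff (stepRatio T) (c T) k| := fun h1 h2 h3 => by
    simpa using summable_succ_mul_of_le hc₁0 hc1 (hle h1 h2 h3) 1
  have hs2 : ∀ {T : ℝ}, 1 < T → 0 ≤ c T → c T ≤ c₁ →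
      Summable fun k : ℕ => |((k : ℝ) + 1) * (((k : ℝ) + 1) * frequencyCoeff (stepRatio T) (c T) k)| :=
    fun h1 h2 h3 => by
      refine (summable_succ_mul_of_le hc₁0 hc1 (hle h1 h2 h3) 2).congr fun k => ?_
      congr 1
      ring
  refine ⟨tendsto_id, ?_, ?_, ?_, ?_, ?_, ?_, ?_, continuousOn_localFrequency hc0 (hc₁.trans hc1) ζ⟩
  · filter_upwards [hbasic] with T ⟨hT, hcT, hcT'⟩
    have hmem : c T ∈ Set.Icc (0 : ℝ) 1 := ⟨hcT, hcT'.trans hc1.le⟩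
    exact continuousOn_zpow_mul (continuousOn_symbol (stepRatio_pos hT) (stepRatio_lt_one hT) hmem
      zero_mem_Icc zero_mem_Icc hmem) _
  · exact Eventually.of_forall fun T z hz => norm_carrier _ _ _ hz
  · filter_upwards [hbasic] with T ⟨hT, hcT, hcT'⟩
    exact hasAngularDeriv_carrier (hs0 hT hcT hcT') _
  · filter_upwards [hbasic] with T ⟨hT, hcT, hcT'⟩ θ
    exact ((hasDerivAt_re_osc (hs1 hT hcT hcT') θ).const_mul 2).sub_const _
  · filter_upwards [hbasic] with T ⟨hT, hcT, hcT'⟩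
    exact continuous_const.mul (Complex.continuous_im.comp (continuous_osc (hs1 hT hcT hcT'))).neg
  · filter_upwards [hbasic] with T ⟨hT, hcT, hcT'⟩ θ
    have hsum := (summable_succ_pow_mul hc₁0 hc1 1)
    simp only [pow_one] at hsum
    have h1 := norm_osc_le (a := fun k => ((k : ℝ) + 1) * frequencyCoeff (stepRatio T) (c T) k)
      (hsum.mul_left T) (fun k => by
        rw [abs_mul, abs_of_nonneg (show (0 : ℝ) ≤ (k : ℝ) + 1 by positivity), mul_left_comm]
        exact mul_le_mul_of_nonneg_left (hle hT hcT hcT' k) (by positivity)) θ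
    rw [tsum_mul_left] at h1
    rw [abs_mul, abs_neg, abs_two, mul_assoc, mul_comm _ T]
    exact mul_le_mul_of_nonneg_left ((Complex.abs_im_le_norm _).trans h1) zero_le_two
  · intro ε hε
    have he := (tendsto_frequency_error h0 hc hc0 hc₁ hc1).const_mul 2
    have hj := (hJ.sub_const ζ).abs
    rw [sub_self, abs_zero] at hj
    rw [mul_zero] at he
    filter_upwards [hbasic, (he.add hj).eventually (gt_mem_nhds (show 0 + 0 < ε by linarith))]
      with T ⟨hT, hcT, hcT'⟩ hε' θ
    have hT0 : 0 < T := by linarith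
    have hsT : Summable fun k => |frequencyCoeff (stepRatio T) (c T) k / T| := by
      refine ((hs0 hT hcT hcT').div_const T).congr fun k => ?_
      rw [abs_div, abs_of_pos hT0]
    have hsl : Summable fun k => |limitCoeff c₀ k| := by
      simpa using summable_succ_mul_of_le (C := 1) hc₁0 hc1
        (fun k => by rw [one_mul]; exact abs_limitCoeff_le hc0 hc₁.le k) 0
    have h1 : osc (frequencyCoeff (stepRatio T) (c T)) θ =
        T * (osc (fun k => frequencyCoeff (stepRatio T) (c T) k / T - limitCoeff c₀ k) θ +
          osc (limitCoeff c₀) θ) := by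
      rw [osc_sub hsT hsl, sub_add_cancel, ← osc_const_mul]
      congr 1
      funext k
      field_simp
    set err := osc (fun k => frequencyCoeff (stepRatio T) (c T) k / T - limitCoeff c₀ k) θ
    have h2 : ‖err‖ ≤ ∑' k, |frequencyCoeff (stepRatio T) (c T) k / T - limitCoeff c₀ k| :=
      norm_osc_le (Summable.of_nonneg_of_le (fun _ => abs_nonneg _) (fun k => abs_sub _ _)
        (hsT.add hsl)) (fun k => le_rfl) θ
    rw [localFrequency_circleMap hc0 (hc₁.trans hc1), h1, Complex.re_ofReal_mul, Complex.add_re]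
    have e : 2 * (T * (err.re + (osc (limitCoeff c₀) θ).re)) - (J T : ℝ) -
        T * (2 * (osc (limitCoeff c₀) θ).re - ζ) = T * (2 * err.re - (J T / T - ζ)) := by
      field_simp
      ring
    rw [e, abs_mul, abs_of_pos hT0, mul_comm]
    refine mul_le_mul_of_nonneg_right ((abs_sub _ _).trans ?_) hT0.le
    rw [abs_mul, abs_two]
    have h3 := (Complex.abs_re_le_norm err).trans h2
    linarith

end Frequencies

end FacetedCrystal

namespace FacetedCrystal

/-! ### Moving the contour to the balanced radius -/

section ContourShift

variable {κ : ℝ}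

theorem symbol_ofReal_mul (κ α β γ δ r : ℝ) (z : ℂ) :
    symbol κ α β γ δ (r * z) = symbol κ (α * r) (β * r) (γ / r) (δ / r) z := by
  have e1 : ∀ a : ℝ, (a : ℂ) * (r * z) = ((a * r : ℝ) : ℂ) * z := fun a => by
    rw [Complex.ofReal_mul, mul_assoc]
  have e2 : ∀ a : ℝ, (a : ℂ) * (r * z)⁻¹ = ((a / r : ℝ) : ℂ) * z⁻¹ := fun a => by
    rw [mul_inv, Complex.ofReal_div, div_eq_mul_inv, mul_assoc]
  rw [symbol, symbol, e1, e1, e2, e2]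

theorem differentiableAt_symbol (h0 : 0 < κ) (h1 : κ < 1) {α β γ δ : ℝ}
    (hα : α ∈ Set.Icc (0 : ℝ) 1) (hβ : β ∈ Set.Icc (0 : ℝ) 1) (hγ : 0 ≤ γ) (hδ : 0 ≤ δ) {z : ℂ}
    (hz0 : z ≠ 0) (hz1 : ‖z‖ ≤ 1) (hzγ : κ * γ < ‖z‖) (hzδ : κ * δ < ‖z‖) :
    DifferentiableAt ℂ (symbol κ α β γ δ) z := by
  have hn : 0 < ‖z‖ := norm_pos_iff.2 hz0
  have d1 : ∀ {a : ℝ}, a ∈ Set.Icc (0 : ℝ) 1 →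
      DifferentiableAt ℂ (fun z => potential κ (a * z)) z := by
    intro a ha
    refine DifferentiableAt.comp (f := fun z : ℂ => (a : ℂ) * z) z
      (differentiableAt_potential h0 h1 ?_) (by fun_prop)
    rw [norm_mul, Complex.norm_real, Real.norm_of_nonneg ha.1]
    have : a * ‖z‖ ≤ 1 := mul_le_one₀ ha.2 hn.le hz1
    nlinarith
  have d2 : ∀ {a : ℝ}, 0 ≤ a → κ * a < ‖z‖ →
      DifferentiableAt ℂ (fun z => potential κ (a * z⁻¹)) z := by
    intro a ha haz
    refine DifferentiableAt.comp (f := fun z : ℂ => (a : ℂ) * z⁻¹) z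
      (differentiableAt_potential h0 h1 ?_) ((differentiableAt_inv hz0).const_mul _)
    rw [norm_mul, Complex.norm_real, Real.norm_of_nonneg ha, norm_inv, ← mul_assoc,
      ← div_eq_mul_inv, div_lt_one hn]
    exact haz
  exact (((d1 hα).sub (d1 hβ)).add ((d2 hγ hzγ).sub (d2 hδ hzδ))).cexp

/-- The Fourier coefficients of a symbol from its values on a smaller circle. -/
theorem cf_symbol_eq_radius (h0 : 0 < κ) (h1 : κ < 1) {α β γ δ r : ℝ} (hr : 0 < r) (hr1 : r ≤ 1)
    (hα : α ∈ Set.Icc (0 : ℝ) 1) (hβ : β ∈ Set.Icc (0 : ℝ) 1) (hγ : 0 ≤ γ) (hδ : 0 ≤ δ)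
    (hrγ : κ * γ < r) (hrδ : κ * δ < r) (n : ℤ) :
    cf (symbol κ α β γ δ) n =
      (r : ℂ) ^ (-n) * cf (symbol κ (α * r) (β * r) (γ / r) (δ / r)) n := by
  have hd : ∀ z : ℂ, r ≤ ‖z‖ → ‖z‖ ≤ 1 →
      DifferentiableAt ℂ (fun z => z ^ (-n) * symbol κ α β γ δ z) z := by
    intro z hz hz'
    have hz0 : z ≠ 0 := norm_pos_iff.1 (hr.trans_le hz)
    exact ((differentiableAt_zpow (m := -n)).2 (Or.inl hz0)).mul (differentiableAt_symbol h0 h1 hα hβ hγ hδ hz0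
      hz' (hrγ.trans_le hz) (hrδ.trans_le hz))
  have h := Complex.circleIntegral_sub_center_inv_smul_eq_of_differentiable_on_annulus_off_countable
    (c := 0) hr hr1 (f := fun z => z ^ (-n) * symbol κ α β γ δ z) (s := ∅) Set.countable_empty
    (fun z hz => (hd z (by simpa using hz.2) (by simpa using hz.1)).continuousAt.continuousWithinAt)
    (fun z hz => hd z (by have := hz.1.2; simp at this; exact this.le)
      (by have := hz.1.1; simp at this; exact this.le))
  rw [cf, avg, Real.circleAverage_eq_circleIntegral one_ne_zero, h,
    ← Real.circleAverage_eq_circleIntegral hr.ne', Real.circleAverage_eq_circleAverage_zero_one, cf,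
    avg, ← smul_eq_mul, ← Real.circleAverage_fun_smul]
  congr 1
  funext z
  rw [add_zero, symbol_ofReal_mul, mul_zpow, smul_eq_mul, mul_assoc]

/-- The factor picked up by the symbol in `s` further time steps. -/
noncomputable def hop (κ c : ℝ) (s : ℕ) (z : ℂ) : ℂ :=
  ∏ i ∈ Finset.range s, (1 - ((κ ^ (2 * i + 1) * c : ℝ) : ℂ) * z⁻¹)

theorem exp_potential_sub_hop (h0 : 0 < κ) (h1 : κ < 1) {c : ℝ} (hc : c ∈ Set.Icc (0 : ℝ) 1)
    {z : ℂ} (hz : z ∈ unitCircle) (s : ℕ) :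
    Complex.exp (potential κ (c * z⁻¹) - potential κ ((κ ^ (2 * s) * c : ℝ) * z⁻¹)) =
      (hop κ c s z)⁻¹ := by
  induction s with
  | zero => simp [hop]
  | succ s ih =>
    have hmem : κ ^ (2 * s) * c ∈ Set.Icc (0 : ℝ) 1 :=
      ⟨mul_nonneg (pow_nonneg h0.le _) hc.1, mul_le_one₀ (pow_le_one₀ h0.le h1.le) hc.1 hc.2⟩
    have hw : κ * ‖((κ ^ (2 * s) * c : ℝ) : ℂ) * z⁻¹‖ < 1 :=
      (mul_le_of_le_one_right h0.le (norm_ofReal_mul_le hmem (inv_mem_unitCircle hz))).trans_lt h1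
    have h := exp_potential_sub h0 h1 hw
    have e1 : (κ : ℂ) ^ 2 * (((κ ^ (2 * s) * c : ℝ) : ℂ) * z⁻¹) =
        ((κ ^ (2 * (s + 1)) * c : ℝ) : ℂ) * z⁻¹ := by push_cast; ring
    have e2 : (κ : ℂ) * (((κ ^ (2 * s) * c : ℝ) : ℂ) * z⁻¹) =
        ((κ ^ (2 * s + 1) * c : ℝ) : ℂ) * z⁻¹ := by push_cast; ring
    rw [e1, e2] at h
    rw [hop, Finset.prod_range_succ, mul_inv, ← hop, ← ih, ← h, ← Complex.exp_add]
    congr 1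
    ring

theorem symbol_hop (h0 : 0 < κ) (h1 : κ < 1) {c : ℝ} (hc : c ∈ Set.Icc (0 : ℝ) 1) {z : ℂ}
    (hz : z ∈ unitCircle) (s : ℕ) :
    symbol κ c 0 0 (κ ^ (2 * s) * c) z = symbol κ c 0 0 c z * (hop κ c s z)⁻¹ := by
  rw [← exp_potential_sub_hop h0 h1 hc hz, symbol, symbol, ← Complex.exp_add]
  congr 1
  ring

theorem symbol_inv_eq (κ α β γ δ : ℝ) (z : ℂ) :
    symbol κ β α δ γ z = (symbol κ α β γ δ z)⁻¹ := by
  rw [symbol, symbol, ← Complex.exp_neg]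
  congr 1
  ring

theorem evolution_natCast (κ : ℝ) (t : ℕ) : evolution κ t = symbol κ 1 0 0 (κ ^ (2 * t)) := by
  rw [evolution, Int.toNat_natCast, Int.toNat_of_nonpos (by omega), mul_zero, pow_zero]

theorem invEvolution_natCast (κ : ℝ) (t : ℕ) : invEvolution κ t = symbol κ 0 1 (κ ^ (2 * t)) 0 := by
  rw [invEvolution, Int.toNat_natCast, Int.toNat_of_nonpos (by omega), mul_zero, pow_zero]

theorem transferSymbol_natCast (κ : ℝ) (s t : ℕ) :
    transferSymbol κ (some s) (some t) = symbol κ 1 1 (κ ^ (2 * s)) (κ ^ (2 * t)) := by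
  simp only [transferSymbol, Option.elim_some, Int.toNat_natCast]
  rw [Int.toNat_of_nonpos (by omega), Int.toNat_of_nonpos (by omega), mul_zero, pow_zero]

/-- The amplitude of the future evolution at a point `(j, s)` relative to the carrier. -/
noncomputable def outAmplitude (κ c : ℝ) (j : ℤ) (s : ℕ) (z : ℂ) : ℂ := z ^ j * hop κ c s z

/-- The amplitude of the past evolution at a point `(j, s)` relative to the carrier. -/
noncomputable def inAmplitude (κ c : ℝ) (j : ℤ) (s : ℕ) (z : ℂ) : ℂ := z ^ (-j) * (hop κ c s z)⁻¹

/-- The kernel near a macroscopic point, up to a gauge transformation, in terms of the carrier. -/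
theorem schurKernel_eq_halfSum (h0 : 0 < κ) (h1 : κ < 1) (J : ℤ) (Θ : ℕ) (jx jy : ℤ) (sx sy : ℕ) :
    (schurKernel κ (J + jx, ((Θ + sx : ℕ) : ℤ)) (J + jy, ((Θ + sy : ℕ) : ℤ)) : ℂ) =
      ((κ ^ Θ : ℝ) : ℂ) ^ (jx - jy) *
      (halfSum (fun z => carrier κ (κ ^ Θ) J z * inAmplitude κ (κ ^ Θ) jy sy z)
          (fun z => (carrier κ (κ ^ Θ) J z)⁻¹ * outAmplitude κ (κ ^ Θ) jx sx z) -
        if sx < sy then avg fun z => inAmplitude κ (κ ^ Θ) jy sy z * outAmplitude κ (κ ^ Θ) jx sx z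
        else 0) := by
  -- This radius balances the two sides: there the potentials with parameters 1 and κ^(2Θ) both get
  -- parameter κ^Θ, so the evolution up to time `Θ` becomes the unimodular carrier. The price is a
  -- power of `r` for each Fourier coefficient.
  set r : ℝ := κ ^ Θ with hr
  have hr0 : 0 < r := pow_pos h0 _
  have hr1 : r ≤ 1 := pow_le_one₀ h0.le h1.le
  have hrC : (r : ℂ) ≠ 0 := Complex.ofReal_ne_zero.2 hr0.ne'
  have hrm : r ∈ Set.Icc (0 : ℝ) 1 := ⟨hr0.le, hr1⟩
  have hsr : ∀ s : ℕ, κ * κ ^ (2 * (Θ + s)) < r := fun s => by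
    rw [← pow_succ', hr]
    exact pow_lt_pow_right_of_lt_one₀ h0 h1 (by omega)
  have hdiv : ∀ s : ℕ, κ ^ (2 * (Θ + s)) / r = κ ^ (2 * s) * r := fun s => by
    rw [div_eq_iff hr0.ne', hr]; ring
  have hκr : κ * 0 < r := by rw [mul_zero]; exact hr0
  have ein : ∀ (n : ℤ), cf (evolution κ ((Θ + sy : ℕ) : ℤ)) n =
      (r : ℂ) ^ (-n) * cf (symbol κ r 0 0 (κ ^ (2 * sy) * r)) n := fun n => by
    rw [evolution_natCast, cf_symbol_eq_radius h0 h1 hr0 hr1 one_mem_Icc zero_mem_Icc le_rfl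
      (pow_nonneg h0.le _) hκr (hsr sy), hdiv]
    simp
  have eout : ∀ (n : ℤ), cf (invEvolution κ ((Θ + sx : ℕ) : ℤ)) n =
      (r : ℂ) ^ (-n) * cf (symbol κ 0 r (κ ^ (2 * sx) * r) 0) n := fun n => by
    rw [invEvolution_natCast, cf_symbol_eq_radius h0 h1 hr0 hr1 zero_mem_Icc one_mem_Icc
      (pow_nonneg h0.le _) le_rfl (hsr sx) hκr, hdiv]
    simp
  have etr : ∀ (n : ℤ), cf (transferSymbol κ (some ((Θ + sx : ℕ) : ℤ)) (some ((Θ + sy : ℕ) : ℤ))) n =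
      (r : ℂ) ^ (-n) * cf (symbol κ r r (κ ^ (2 * sx) * r) (κ ^ (2 * sy) * r)) n := fun n => by
    rw [transferSymbol_natCast, cf_symbol_eq_radius h0 h1 hr0 hr1 one_mem_Icc one_mem_Icc
      (pow_nonneg h0.le _) (pow_nonneg h0.le _) (hsr sx) (hsr sy), hdiv, hdiv]
    simp
  have uin : ∀ k : ℤ, cf (fun z => carrier κ r J z * inAmplitude κ r jy sy z) k =
      cf (symbol κ r 0 0 (κ ^ (2 * sy) * r)) (J + jy + k) := by
    intro k
    rw [show J + jy + k = k - -(J + jy) by ring, ← cf_zpow_mul]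
    refine cf_congr (fun z hz => ?_) k
    rw [symbol_hop h0 h1 hrm hz, carrier, inAmplitude, neg_add,
      zpow_add₀ (ne_zero_of_mem_unitCircle hz)]
    ring
  have uout : ∀ k : ℤ, cf (fun z => (carrier κ r J z)⁻¹ * outAmplitude κ r jx sx z) k =
      cf (symbol κ 0 r (κ ^ (2 * sx) * r) 0) (k - (J + jx)) := by
    intro k
    rw [← cf_zpow_mul]
    refine cf_congr (fun z hz => ?_) k
    rw [symbol_inv_eq κ r 0 0, symbol_hop h0 h1 hrm hz, carrier, outAmplitude,
      zpow_add₀ (ne_zero_of_mem_unitCircle hz), mul_inv, mul_inv, inv_inv, zpow_neg, inv_inv]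
    ring
  have hsum : ((∑' k : ℕ, (cf (evolution κ ((Θ + sy : ℕ) : ℤ)) (J + jy + k)).re *
      (cf (invEvolution κ ((Θ + sx : ℕ) : ℤ)) (-(J + jx) - k)).re : ℝ) : ℂ) =
      (r : ℂ) ^ (jx - jy) * halfSum (fun z => carrier κ r J z * inAmplitude κ r jy sy z)
          (fun z => (carrier κ r J z)⁻¹ * outAmplitude κ r jx sx z) := by
    rw [Complex.ofReal_tsum, halfSum, ← tsum_mul_left]
    refine tsum_congr fun k => ?_
    -- The exponents of `r` are -(J + jy + k) and (J + jx) + k; the summation index drops out and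
    -- only the gauge factor r^(jx - jy) is left.
    rw [Complex.ofReal_mul, ← (isRealSymbol_evolution _ _).cf_eq,
      ← (isRealSymbol_invEvolution _ _).cf_eq, ein, eout, uin, uout,
      show jx - jy = -(J + jy + k) + -(-(J + jx) - k) by ring, zpow_add₀ hrC,
      show -(k : ℤ) - (J + jx) = -(J + jx) - k by ring]
    ring
  have hif : (((Θ + sx : ℕ) : ℤ) < ((Θ + sy : ℕ) : ℤ)) ↔ sx < sy := by omega
  rw [schurKernel, Complex.ofReal_sub]
  simp only [hif]
  rw [mul_sub, hsum]
  congr 1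
  split_ifs with hlt
  · rw [lineCoeff, ← (isRealSymbol_transferSymbol _ _ _).cf_eq, etr,
      show -(J + jy - (J + jx)) = jx - jy by ring]
    congr 1
    refine avg_congr fun z hz => ?_
    have hz0 := ne_zero_of_mem_unitCircle hz
    have hsx := symbol_hop h0 h1 hrm hz sx
    have hsy := symbol_hop h0 h1 hrm hz sy
    have hsne : symbol κ r 0 0 r z ≠ 0 := Complex.exp_ne_zero _
    have hsym : symbol κ r r (κ ^ (2 * sx) * r) (κ ^ (2 * sy) * r) z =
        symbol κ r 0 0 (κ ^ (2 * sy) * r) z * (symbol κ r 0 0 (κ ^ (2 * sx) * r) z)⁻¹ := by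
      rw [← symbol_inv_eq κ r 0 0, symbol, symbol, symbol, ← Complex.exp_add]
      congr 1
      simp only [Complex.ofReal_zero, zero_mul, potential_zero]
      ring
    rw [hsym, hsx, hsy, inAmplitude, outAmplitude, mul_inv, inv_inv,
      show -(J + jy - (J + jx)) = -jy + jx by ring, zpow_add₀ hz0]
    field_simp
  · simp

end ContourShift

end FacetedCrystal

namespace FacetedCrystal

/-! ### Limits of the amplitudes -/

section Amplitudes

variable {c : ℝ}

/-- The limiting amplitude `z ^ j * (1 - c / z) ^ s`. -/
noncomputable def limitAmplitude (c : ℝ) (j s : ℤ) (z : ℂ) : ℂ := z ^ j * (1 - c * z⁻¹) ^ s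

theorem continuousOn_limitAmplitude (h0 : 0 ≤ c) (h1 : c < 1) (j s : ℤ) :
    ContinuousOn (limitAmplitude c j s) unitCircle := by
  refine ContinuousOn.mul (continuousOn_id.zpow₀ _ fun z hz => Or.inl (ne_zero_of_mem_unitCircle hz))
    (ContinuousOn.zpow₀ (continuousOn_const.sub (continuousOn_const.mul (continuousOn_inv₀.mono
      fun z hz => ne_zero_of_mem_unitCircle hz))) _ fun z hz =>
        Or.inl (one_sub_mul_ne_zero h0 h1 (inv_mem_unitCircle hz)))

theorem limitAmplitude_mul (h0 : 0 ≤ c) (h1 : c < 1) (j s j' s' : ℤ) {z : ℂ} (hz : z ∈ unitCircle) :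
    limitAmplitude c j s z * limitAmplitude c j' s' z = limitAmplitude c (j + j') (s + s') z := by
  rw [limitAmplitude, limitAmplitude, limitAmplitude, zpow_add₀ (ne_zero_of_mem_unitCircle hz),
    zpow_add₀ (one_sub_mul_ne_zero h0 h1 (inv_mem_unitCircle hz))]
  ring

theorem circleMap_zero_one (θ : ℝ) : circleMap 0 1 θ = Complex.exp (θ * Complex.I) := by
  simp [circleMap]

theorem contDiff_limitAmplitude (h0 : 0 ≤ c) (h1 : c < 1) (j : ℤ) (s : ℕ) :
    ContDiff ℝ 1 fun θ : ℝ => limitAmplitude c j (-s) (circleMap 0 1 θ) := by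
  have e : (fun θ : ℝ => limitAmplitude c j (-s) (circleMap 0 1 θ)) = fun θ : ℝ =>
      Complex.exp (j * (θ * Complex.I)) * ((1 - c * Complex.exp (-(θ * Complex.I))) ^ s)⁻¹ := by
    funext θ
    rw [limitAmplitude, circleMap_zero_one, Complex.exp_int_mul, zpow_neg, zpow_natCast,
      Complex.exp_neg]
  have hθ : ContDiff ℝ 1 fun θ : ℝ => (θ : ℂ) := Complex.ofRealCLM.contDiff
  rw [e]
  refine ContDiff.mul (contDiff_const.mul (hθ.mul contDiff_const)).cexp
    (ContDiff.inv ((contDiff_const.sub (contDiff_const.mul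
      (hθ.mul contDiff_const).neg.cexp)).pow s) fun θ => pow_ne_zero _ ?_)
  rw [Complex.exp_neg, ← circleMap_zero_one]
  exact one_sub_mul_ne_zero h0 h1 (inv_mem_unitCircle (circleMap_mem_unitCircle θ))

theorem hasAngularDeriv_deriv {h : ℂ → ℂ} (hh : ContDiff ℝ 1 fun θ : ℝ => h (circleMap 0 1 θ)) :
    HasAngularDeriv h (deriv fun θ : ℝ => h (circleMap 0 1 θ)) := fun θ =>
  (hh.differentiable one_ne_zero θ).hasDerivAt

theorem norm_one_sub_mul_inv_bounds {b : ℝ} (hb : 0 ≤ b) {c₁ : ℝ} (hbc : b ≤ c₁) {z : ℂ}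
    (hz : z ∈ unitCircle) : 1 - c₁ ≤ ‖1 - (b : ℂ) * z⁻¹‖ ∧ ‖1 - (b : ℂ) * z⁻¹‖ ≤ 1 + c₁ := by
  have hn : ‖(b : ℂ) * z⁻¹‖ = b := by
    rw [norm_mul, norm_of_mem_unitCircle (inv_mem_unitCircle hz), mul_one, Complex.norm_real,
      Real.norm_of_nonneg hb]
  have h1 := norm_sub_norm_le (1 : ℂ) ((b : ℂ) * z⁻¹)
  have h2 := norm_sub_le (1 : ℂ) ((b : ℂ) * z⁻¹)
  rw [norm_one, hn] at h1 h2
  constructor <;> linarith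

theorem continuousOn_hop (κ c : ℝ) (s : ℕ) : ContinuousOn (hop κ c s) unitCircle := by
  refine continuousOn_finsetProd _ fun i _ => continuousOn_const.sub (continuousOn_const.mul
    (continuousOn_inv₀.mono fun z hz => ne_zero_of_mem_unitCircle hz))

theorem tendsto_hop {c : ℝ → ℝ} {c₀ : ℝ} (hc : Tendsto c atTop (𝓝 c₀)) (s : ℕ) (z : ℂ) :
    Tendsto (fun T => hop (stepRatio T) (c T) s z) atTop (𝓝 ((1 - c₀ * z⁻¹) ^ s)) := by
  have h : Tendsto (fun T => hop (stepRatio T) (c T) s z) atTop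
      (𝓝 (∏ i ∈ Finset.range s, (1 - ((1 ^ (2 * i + 1) * c₀ : ℝ) : ℂ) * z⁻¹))) :=
    tendsto_finsetProd _ fun i _ => tendsto_const_nhds.sub
      (((Complex.continuous_ofReal.tendsto _).comp ((tendsto_stepRatio.pow _).mul hc)).mul_const _)
  simpa using h

theorem hop_factor_mem {T c c₁ : ℝ} (hT : 1 < T) (hc : 0 ≤ c) (hc' : c ≤ c₁) (i : ℕ) :
    0 ≤ stepRatio T ^ (2 * i + 1) * c ∧ stepRatio T ^ (2 * i + 1) * c ≤ c₁ :=
  ⟨mul_nonneg (pow_nonneg (stepRatio_pos hT).le _) hc,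
    (mul_le_of_le_one_left hc (pow_le_one₀ (stepRatio_pos hT).le (stepRatio_lt_one hT).le)).trans hc'⟩

theorem boundedlyTendsto_hop {c : ℝ → ℝ} {c₀ c₁ : ℝ} (h0 : ∀ᶠ T in atTop, 0 ≤ c T)
    (hc : Tendsto c atTop (𝓝 c₀)) (hc₁ : c₀ < c₁) (s : ℕ) :
    BoundedlyTendsto (fun T => hop (stepRatio T) (c T) s) (fun z => (1 - c₀ * z⁻¹) ^ s) atTop := by
  refine ⟨Eventually.of_forall fun T => continuousOn_hop _ _ _, ⟨(1 + c₁) ^ s, ?_⟩,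
    fun z _ => tendsto_hop hc s z⟩
  filter_upwards [h0, hc.eventually (gt_mem_nhds hc₁), eventually_gt_atTop 1] with T h1 h2 h3 z hz
  rw [hop, norm_prod]
  refine (Finset.prod_le_prod (fun _ _ => norm_nonneg _) fun i _ => ?_).trans
    (by rw [Finset.prod_const, Finset.card_range])
  obtain ⟨h4, h5⟩ := hop_factor_mem h3 h1 h2.le i
  exact (norm_one_sub_mul_inv_bounds h4 h5 hz).2

/-- The factors stay at distance at least 1 - c₁ from zero, uniformly on the circle, so the inverses
are bounded. -/
theorem boundedlyTendsto_hop_inv {c : ℝ → ℝ} {c₀ c₁ : ℝ} (h0 : ∀ᶠ T in atTop, 0 ≤ c T)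
    (hc : Tendsto c atTop (𝓝 c₀)) (hc0 : 0 ≤ c₀) (hc₁ : c₀ < c₁) (hc1 : c₁ < 1) (s : ℕ) :
    BoundedlyTendsto (fun T z => (hop (stepRatio T) (c T) s z)⁻¹)
      (fun z => ((1 - c₀ * z⁻¹) ^ s)⁻¹) atTop := by
  have hlow : ∀ᶠ T in atTop, ∀ z ∈ unitCircle, (1 - c₁) ^ s ≤ ‖hop (stepRatio T) (c T) s z‖ := by
    filter_upwards [h0, hc.eventually (gt_mem_nhds hc₁), eventually_gt_atTop 1] with T h1 h2 h3 z hz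
    rw [hop, norm_prod]
    refine le_trans (by rw [Finset.prod_const, Finset.card_range])
      (Finset.prod_le_prod (f := fun _ => 1 - c₁) (fun _ _ => by linarith) fun i _ => ?_)
    obtain ⟨h4, h5⟩ := hop_factor_mem h3 h1 h2.le i
    exact (norm_one_sub_mul_inv_bounds h4 h5 hz).1
  have hpos : 0 < (1 - c₁) ^ s := pow_pos (by linarith) _
  refine ⟨?_, ⟨((1 - c₁) ^ s)⁻¹, ?_⟩, fun z hz => (tendsto_hop hc s z).inv₀ (pow_ne_zero _
    (one_sub_mul_ne_zero hc0 (hc₁.trans hc1) (inv_mem_unitCircle hz)))⟩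
  · filter_upwards [hlow] with T hT
    exact (continuousOn_hop _ _ _).inv₀ fun z hz => norm_pos_iff.1 (hpos.trans_le (hT z hz))
  · filter_upwards [hlow] with T hT z hz
    rw [norm_inv]
    exact inv_anti₀ hpos (hT z hz)

theorem boundedlyTendsto_outAmplitude {c : ℝ → ℝ} {c₀ c₁ : ℝ} (h0 : ∀ᶠ T in atTop, 0 ≤ c T)
    (hc : Tendsto c atTop (𝓝 c₀)) (hc₁ : c₀ < c₁) (j : ℤ) (s : ℕ) :
    BoundedlyTendsto (fun T => outAmplitude (stepRatio T) (c T) j s) (limitAmplitude c₀ j s) atTop := by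
  have h := (boundedlyTendsto_const (continuousOn_zpow_unitCircle j)).mul
    (boundedlyTendsto_hop h0 hc hc₁ s)
  have e : limitAmplitude c₀ j s = fun z : ℂ => z ^ j * (1 - c₀ * z⁻¹) ^ s := by
    funext z
    rw [limitAmplitude, zpow_natCast]
  rw [e]
  exact h

theorem boundedlyTendsto_inAmplitude {c : ℝ → ℝ} {c₀ c₁ : ℝ} (h0 : ∀ᶠ T in atTop, 0 ≤ c T)
    (hc : Tendsto c atTop (𝓝 c₀)) (hc0 : 0 ≤ c₀) (hc₁ : c₀ < c₁) (hc1 : c₁ < 1) (j : ℤ) (s : ℕ) :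
    BoundedlyTendsto (fun T => inAmplitude (stepRatio T) (c T) j s)
      (limitAmplitude c₀ (-j) (-s)) atTop := by
  have h := (boundedlyTendsto_const (continuousOn_zpow_unitCircle (-j))).mul
    (boundedlyTendsto_hop_inv h0 hc hc0 hc₁ hc1 s)
  have e : limitAmplitude c₀ (-j) (-s) = fun z : ℂ => z ^ (-j) * ((1 - c₀ * z⁻¹) ^ s)⁻¹ := by
    funext z
    rw [limitAmplitude, zpow_neg (1 - c₀ * z⁻¹), zpow_natCast]
  rw [e]
  exact h

end Amplitudes

/-! ### The set where the local frequency is positive -/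

section FilledStates

variable {c ζ : ℝ}

theorem normSq_one_sub_mul_circleMap (c θ : ℝ) :
    ‖(1 : ℂ) - c * circleMap 0 1 θ‖ ^ 2 = 1 + c ^ 2 - 2 * c * Real.cos θ := by
  rw [← Complex.normSq_eq_norm_sq, Complex.normSq_apply, Complex.sub_re, Complex.sub_im,
    Complex.re_ofReal_mul, Complex.im_ofReal_mul, circleMap_zero_one, Complex.exp_ofReal_mul_I_re,
    Complex.exp_ofReal_mul_I_im, Complex.one_re, Complex.one_im]
  nlinarith [Real.sin_sq_add_cos_sq θ]

theorem localFrequency_eq_log (ζ c : ℝ) (θ : ℝ) : localFrequency ζ c (circleMap 0 1 θ) =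
    -Real.log (1 + c ^ 2 - 2 * c * Real.cos θ) - ζ := by
  rw [localFrequency, ← normSq_one_sub_mul_circleMap, Real.log_pow]
  norm_num

theorem normSq_pos (h0 : 0 ≤ c) (h1 : c < 1) (θ : ℝ) : 0 < 1 + c ^ 2 - 2 * c * Real.cos θ := by
  nlinarith [mul_le_mul_of_nonneg_left (Real.cos_le_one θ) h0]

theorem localFrequency_pos_iff (h0 : 0 < c) (h1 : c < 1) (ζ θ : ℝ) :
    0 < localFrequency ζ c (circleMap 0 1 θ) ↔
      (1 + c ^ 2 - Real.exp (-ζ)) / (2 * c) < Real.cos θ := by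
  rw [localFrequency_eq_log, div_lt_iff₀ (by positivity), sub_pos, lt_neg,
    Real.log_lt_iff_lt_exp (normSq_pos h0.le h1 θ)]
  constructor <;> intro h <;> linarith

theorem localFrequency_eq_zero_imp (h0 : 0 < c) (h1 : c < 1) {ζ θ : ℝ}
    (h : localFrequency ζ c (circleMap 0 1 θ) = 0) :
    Real.cos θ = (1 + c ^ 2 - Real.exp (-ζ)) / (2 * c) := by
  rw [localFrequency_eq_log] at h
  have h2 : Real.log (1 + c ^ 2 - 2 * c * Real.cos θ) = -ζ := by linarith
  rw [← h2, Real.exp_log (normSq_pos h0.le h1 θ)]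
  field_simp
  ring

theorem finite_unitCircle_re (a : ℝ) : {z ∈ unitCircle | z.re = a}.Finite := by
  refine Set.Finite.subset (Set.toFinite {(⟨a, √(1 - a ^ 2)⟩ : ℂ), ⟨a, -√(1 - a ^ 2)⟩}) ?_
  rintro z ⟨hz, rfl⟩
  have h1 : z.re ^ 2 + z.im ^ 2 = 1 := by
    have h := Complex.sq_norm z
    rw [norm_of_mem_unitCircle hz, Complex.normSq_apply] at h
    nlinarith
  have h2 : 1 - z.re ^ 2 = z.im ^ 2 := by linarith
  simp only [Set.mem_insert_iff, Set.mem_singleton_iff, h2, Real.sqrt_sq_eq_abs]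
  rcases abs_choice z.im with h | h <;> rw [h]
  · left; rfl
  · right; rw [neg_neg]

/-- A point is contained in closed balls of arbitrarily small volume. -/
theorem haarAddCircle_singleton (x : AddCircle (2 * Real.pi)) :
    AddCircle.haarAddCircle {x} = 0 := by
  have hv : MeasureTheory.MeasureSpace.volume ({x} : Set (AddCircle (2 * Real.pi))) = 0 := by
    refine le_antisymm (ENNReal.le_of_forall_pos_le_add fun ε hε _ => ?_) zero_le
    refine (measure_mono (Set.singleton_subset_iff.2
      (Metric.mem_closedBall_self (by positivity : (0 : ℝ) ≤ ε / 2)))).trans ?_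
    rw [AddCircle.volume_closedBall, zero_add]
    refine (ENNReal.ofReal_le_ofReal (min_le_right _ _)).trans ?_
    rw [mul_div_cancel₀ _ two_ne_zero, ENNReal.ofReal_coe_nnreal]
  rw [AddCircle.volume_eq_smul_haarAddCircle, Measure.smul_apply, smul_eq_mul, mul_eq_zero] at hv
  exact hv.resolve_left (by simpa using Real.pi_pos)

/-- A zero of the local frequency has a prescribed real part, so there are at most two of them on
the circle. -/
theorem ae_localFrequency_ne_zero (h0 : 0 < c) (h1 : c < 1) (ζ : ℝ) :
    ∀ᵐ x ∂AddCircle.haarAddCircle (T := 2 * Real.pi), localFrequency ζ c (circ x) ≠ 0 := by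
  have hfin : {x : AddCircle (2 * Real.pi) | localFrequency ζ c (circ x) = 0}.Finite := by
    refine ((finite_unitCircle_re ((1 + c ^ 2 - Real.exp (-ζ)) / (2 * c))).preimage
      (f := circ) ?_).subset ?_
    · exact (Subtype.val_injective.comp
        (AddCircle.injective_toCircle Real.two_pi_pos.ne')).injOn
    · intro x hx
      refine ⟨circ_mem x, ?_⟩
      obtain ⟨θ, hθ⟩ := exists_angle (circ_mem x)
      have hx' : localFrequency ζ c (circ x) = 0 := hx
      rw [← hθ] at hx'
      rw [← hθ, ← localFrequency_eq_zero_imp h0 h1 hx', circleMap_zero_one, Complex.exp_ofReal_mul_I_re]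
  rw [ae_iff]
  simp only [ne_eq, not_not]
  rw [← Set.biUnion_of_singleton {x : AddCircle (2 * Real.pi) | localFrequency ζ c (circ x) = 0},
    measure_biUnion_null_iff hfin.countable]
  exact fun x _ => haarAddCircle_singleton x

end FilledStates

end FacetedCrystal

namespace FacetedCrystal

/-! ### Averages over arcs -/

section Arcs

theorem avg_eq_integral_symm (G : ℂ → ℂ) :
    avg G = 1 / (2 * (Real.pi : ℂ)) * ∫ θ in (-Real.pi)..Real.pi, G (circleMap 0 1 θ) := by
  have hp : Function.Periodic (fun θ => G (circleMap 0 1 θ)) (2 * Real.pi) := fun θ => by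
    beta_reduce
    rw [periodic_circleMap 0 1 θ]
  have h := hp.intervalIntegral_add_eq 0 (-Real.pi)
  rw [zero_add, show -Real.pi + 2 * Real.pi = Real.pi by ring] at h
  rw [avg, Real.circleAverage_def, h, Complex.real_smul]
  push_cast
  rw [one_div]

theorem continuous_comp_circleMap {w : ℂ → ℂ} (hw : ContinuousOn w unitCircle) :
    Continuous fun θ => w (circleMap 0 1 θ) :=
  hw.comp_continuous (continuous_circleMap 0 1) circleMap_mem_unitCircle

theorem avg_ite_eq_integral {b : ℝ} (hb0 : 0 ≤ b) (hb : b ≤ Real.pi) {w : ℂ → ℂ} {P : ℂ → Prop}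
    [DecidablePred P] (hP : ∀ θ ∈ Set.Ioc (-Real.pi) Real.pi, P (circleMap 0 1 θ) ↔ |θ| < b) :
    avg (fun z => if P z then w z else 0) =
      1 / (2 * (Real.pi : ℂ)) * ∫ θ in (-b)..b, w (circleMap 0 1 θ) := by
  rw [avg_eq_integral_symm, intervalIntegral.integral_of_le (by linarith [Real.pi_pos]),
    intervalIntegral.integral_of_le (by linarith)]
  congr 1
  have h1 : ∀ θ ∈ Set.Ioc (-Real.pi) Real.pi,
      (if P (circleMap 0 1 θ) then w (circleMap 0 1 θ) else 0) =
        (Set.Ioo (-b) b).indicator (fun θ => w (circleMap 0 1 θ)) θ := by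
    intro θ hθ
    simp only [hP θ hθ, abs_lt, Set.indicator_apply, Set.mem_Ioo]
  rw [setIntegral_congr_fun measurableSet_Ioc h1, setIntegral_indicator measurableSet_Ioo,
    Set.inter_eq_right.2 (Set.Ioo_subset_Ioc_self.trans (Set.Ioc_subset_Ioc (neg_le_neg hb) hb)),
    integral_Ioc_eq_integral_Ioo]

/-- By periodicity the full circle is the arc followed by its complement; this produces the empty
states, with their minus sign. -/
theorem avg_sub_arc {w : ℂ → ℂ} (hw : ContinuousOn w unitCircle) (b : ℝ) :
    1 / (2 * (Real.pi : ℂ)) * (∫ θ in (-b)..b, w (circleMap 0 1 θ)) - avg w =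
      -(1 / (2 * (Real.pi : ℂ))) * ∫ θ in b..(2 * Real.pi - b), w (circleMap 0 1 θ) := by
  have hp : Function.Periodic (fun θ => w (circleMap 0 1 θ)) (2 * Real.pi) := fun θ => by
    beta_reduce
    rw [periodic_circleMap 0 1 θ]
  have h := hp.intervalIntegral_add_eq (-Real.pi) (-b)
  rw [show -Real.pi + 2 * Real.pi = Real.pi by ring,
    show -b + 2 * Real.pi = 2 * Real.pi - b by ring] at h
  have hc := continuous_comp_circleMap hw
  rw [avg_eq_integral_symm, h, ← intervalIntegral.integral_add_adjacent_intervals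
    (hc.intervalIntegrable (-b) b) (hc.intervalIntegrable b (2 * Real.pi - b))]
  ring

end Arcs

/-! ### Bulk limit of the kernel for τ > 0 -/

section BulkKernel

variable {ζ τ : ℝ}

theorem exp_half_mem (hτ : τ ≠ 0) : 0 < Real.exp (-|τ| / 2) ∧ Real.exp (-|τ| / 2) < 1 :=
  ⟨Real.exp_pos _, Real.exp_lt_one_iff.2 (by have := abs_pos.2 hτ; linarith)⟩

/-- With c = exp(-|τ|/2) one has cosh(τ/2) = (c + 1/c)/2, which matches the threshold found in
`localFrequency_pos_iff`. -/
theorem pi_mul_density (ζ τ : ℝ) : Real.pi * density ζ τ =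
    Real.arccos ((1 + Real.exp (-|τ| / 2) ^ 2 - Real.exp (-ζ)) / (2 * Real.exp (-|τ| / 2))) := by
  rw [density, mul_div_cancel₀ _ Real.pi_ne_zero]
  congr 1
  have h1 : Real.cosh (τ / 2) = (Real.exp (|τ| / 2) + Real.exp (-|τ| / 2)) / 2 := by
    rw [← Real.cosh_abs, abs_div, abs_two, Real.cosh_eq, neg_div]
  have h2 : Real.exp (|τ| / 2) = (Real.exp (-|τ| / 2))⁻¹ := by
    rw [← Real.exp_neg]
    congr 1
    ring
  have h3 := (Real.exp_pos (-|τ| / 2)).ne'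
  rw [h1, Real.exp_add, h2]
  field_simp

theorem exp_neg_lt_of_lowerEdge_lt (h : lowerEdge τ < ζ) :
    Real.exp (-ζ) < (1 + Real.exp (-|τ| / 2)) ^ 2 := by
  have hp : 0 < 1 + Real.exp (-|τ| / 2) := by positivity
  rw [← Real.lt_log_iff_exp_lt (pow_pos hp 2), Real.log_pow]
  rw [lowerEdge] at h
  push_cast
  linarith

theorem lt_exp_neg_of_lt_upperEdge (hτ : τ ≠ 0) (h : ζ < upperEdge τ) :
    (1 - Real.exp (-|τ| / 2)) ^ 2 < Real.exp (-ζ) := by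
  have hp : 0 < 1 - Real.exp (-|τ| / 2) := sub_pos.2 (exp_half_mem hτ).2
  rw [← Real.log_lt_iff_lt_exp (pow_pos hp 2), Real.log_pow]
  rw [upperEdge] at h
  push_cast
  linarith

/-- The two edge conditions place the threshold for cos θ in [-1, 1], where arccos inverts cos, and
cos is decreasing on [0, π]. -/
theorem filled_iff (hτ : τ ≠ 0) (hl : lowerEdge τ < ζ) (hu : ζ < upperEdge τ) {θ : ℝ}
    (hθ : θ ∈ Set.Ioc (-Real.pi) Real.pi) :
    0 < localFrequency ζ (Real.exp (-|τ| / 2)) (circleMap 0 1 θ) ↔ |θ| < Real.pi * density ζ τ := by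
  obtain ⟨h0, h1⟩ := exp_half_mem hτ
  have h2 := exp_neg_lt_of_lowerEdge_lt hl
  have h3 := lt_exp_neg_of_lt_upperEdge hτ hu
  rw [localFrequency_pos_iff h0 h1, pi_mul_density]
  set c := Real.exp (-|τ| / 2)
  set a := (1 + c ^ 2 - Real.exp (-ζ)) / (2 * c)
  have ha1 : a ≤ 1 := by
    rw [div_le_one (by positivity)]
    nlinarith
  have ha0 : -1 ≤ a := by
    rw [le_div_iff₀ (by positivity)]
    nlinarith
  have hcos : Real.cos θ = Real.cos |θ| := (Real.cos_abs θ).symm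
  have hle : |θ| ≤ Real.pi := abs_le.2 ⟨hθ.1.le, hθ.2⟩
  rw [hcos]
  conv_lhs => rw [← Real.cos_arccos ha0 ha1]
  exact Real.strictAntiOn_cos.lt_iff_gt ⟨Real.arccos_nonneg _, Real.arccos_le_pi _⟩
    ⟨abs_nonneg θ, hle⟩

/-- Only integer multiples of the logarithm are exponentiated, so its branch plays no role. -/
theorem bulkWave_eq (hτ : 0 < τ) (x y : ℤ × ℤ) (θ : ℝ) : bulkWave τ x y θ =
    limitAmplitude (Real.exp (-|τ| / 2)) (x.1 - y.1) (x.2 - y.2) (circleMap 0 1 θ) := by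
  obtain ⟨h0, h1⟩ := exp_half_mem hτ.ne'
  have e : Complex.exp (((-|τ| / 2 : ℝ) : ℂ) - Complex.I * θ * (Real.sign τ : ℝ)) =
      (Real.exp (-|τ| / 2) : ℂ) * (circleMap 0 1 θ)⁻¹ := by
    rw [Real.sign_of_pos hτ, circleMap_zero_one, ← Complex.exp_neg, Complex.ofReal_exp,
      ← Complex.exp_add]
    congr 1
    push_cast
    ring
  rw [bulkWave, kineticEnergy, e, Complex.exp_add, limitAmplitude, Complex.exp_int_mul,
    Complex.exp_log (one_sub_mul_ne_zero h0.le h1 (inv_mem_unitCircle (circleMap_mem_unitCircle θ))),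
    circleMap_zero_one, ← Complex.exp_int_mul]
  congr 2
  ring

theorem bulkKernel_eq_avg (hτ : 0 < τ) (hl : lowerEdge τ < ζ) (hu : ζ < upperEdge τ) (x y : ℤ × ℤ) :
    bulkKernel ζ τ x y =
      avg (fun z => if 0 < localFrequency ζ (Real.exp (-|τ| / 2)) z then
          limitAmplitude (Real.exp (-|τ| / 2)) (x.1 - y.1) (x.2 - y.2) z else 0) -
        if x.2 < y.2 then avg (limitAmplitude (Real.exp (-|τ| / 2)) (x.1 - y.1) (x.2 - y.2)) else 0 := by
  obtain ⟨h0, h1⟩ := exp_half_mem hτ.ne'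
  rw [avg_ite_eq_integral (b := Real.pi * density ζ τ) (by rw [pi_mul_density]; exact Real.arccos_nonneg _)
    (by rw [pi_mul_density]; exact Real.arccos_le_pi _) (fun θ hθ => filled_iff hτ.ne' hl hu hθ),
    bulkKernel]
  simp only [bulkWave_eq hτ]
  by_cases h : x.2 < y.2
  · rw [if_neg (not_le.2 h), if_pos h, avg_sub_arc (continuousOn_limitAmplitude h0.le h1 _ _)]
  · rw [if_pos (not_lt.1 h), if_neg h, sub_zero]

/-- Bulk scaling limit of the kernel to the right of the corner, up to a gauge transformation. -/
theorem tendsto_schurKernel (hτ : 0 < τ) (hl : lowerEdge τ < ζ) (hu : ζ < upperEdge τ)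
    {J : ℝ → ℤ} {Θ : ℝ → ℕ} (hJ : Tendsto (fun T => (J T : ℝ) / T) atTop (𝓝 ζ))
    (hΘ : Tendsto (fun T => (Θ T : ℝ) / T) atTop (𝓝 τ)) (jx jy : ℤ) (sx sy : ℕ) :
    Tendsto (fun T => ((stepRatio T ^ Θ T : ℝ) : ℂ) ^ (jy - jx) *
      schurKernel (stepRatio T) (J T + jx, ((Θ T + sx : ℕ) : ℤ)) (J T + jy, ((Θ T + sy : ℕ) : ℤ)))
      atTop (𝓝 (bulkKernel ζ τ (jx, sx) (jy, sy))) := by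
  obtain ⟨h0, h1⟩ := exp_half_mem hτ.ne'
  have hc : Tendsto (fun T => stepRatio T ^ Θ T) atTop (𝓝 (Real.exp (-|τ| / 2))) := by
    rw [abs_of_pos hτ]
    exact tendsto_stepRatio_pow hΘ
  have hpos : ∀ᶠ T : ℝ in atTop, 0 ≤ stepRatio T ^ Θ T :=
    Eventually.of_forall fun T => pow_nonneg (Real.sqrt_nonneg _) _
  obtain ⟨c₁, hc₁, hc1⟩ := exists_between h1
  have hE := hasLocalFrequency_carrier hJ hpos hc h0.le hc₁ hc1
  have hin := boundedlyTendsto_inAmplitude hpos hc h0.le hc₁ hc1 jy sy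
  have hout := boundedlyTendsto_outAmplitude hpos hc hc₁ jx sx
  have hcd := contDiff_limitAmplitude h0.le h1 (-jy) sy
  -- The limiting amplitudes at the two points multiply to the integrand of the bulk kernel, which
  -- depends on differences only.
  have hmul : ∀ z ∈ unitCircle, limitAmplitude (Real.exp (-|τ| / 2)) (-jy) (-sy) z *
      limitAmplitude (Real.exp (-|τ| / 2)) jx sx z =
        limitAmplitude (Real.exp (-|τ| / 2)) (jx - jy) (sx - sy) z := fun z hz => by
    rw [mul_comm, limitAmplitude_mul h0.le h1 _ _ _ _ hz, sub_eq_add_neg, sub_eq_add_neg]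
  have hhalf := hE.tendsto_halfSum (hasDerivAt_localFrequency h0.le h1 ζ)
    (continuous_deriv_localFrequency h0.le h1) (ae_localFrequency_ne_zero h0 h1 ζ)
    (continuousOn_limitAmplitude h0.le h1 _ _) (hasAngularDeriv_deriv hcd)
    (hcd.continuous_deriv le_rfl) (continuousOn_limitAmplitude h0.le h1 jx sx) hin hout
  have hif : Tendsto (fun T => if sx < sy then
      avg fun z => inAmplitude (stepRatio T) (stepRatio T ^ Θ T) jy sy z *
        outAmplitude (stepRatio T) (stepRatio T ^ Θ T) jx sx z else 0) atTop
      (𝓝 (if sx < sy then avg fun z => limitAmplitude (Real.exp (-|τ| / 2)) (-jy) (-sy) z *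
        limitAmplitude (Real.exp (-|τ| / 2)) jx sx z else 0)) := by
    split_ifs
    · exact (hin.mul hout).tendsto_avg
    · exact tendsto_const_nhds
  have hlim := hhalf.sub hif
  have e1 : bulkKernel ζ τ (jx, sx) (jy, sy) = _ := bulkKernel_eq_avg hτ hl hu _ _
  rw [e1]
  have e2 : (((sx : ℤ)) < ((sy : ℤ))) ↔ sx < sy := by omega
  simp only [e2]
  rw [avg_congr (H := fun z => if 0 < localFrequency ζ (Real.exp (-|τ| / 2)) z then
      limitAmplitude (Real.exp (-|τ| / 2)) (jx - jy) (sx - sy) z else 0)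
      (fun z hz => by rw [hmul z hz]), avg_congr hmul] at hlim
  refine hlim.congr' ?_
  filter_upwards [eventually_gt_atTop 1] with T hT
  rw [schurKernel_eq_halfSum (stepRatio_pos hT) (stepRatio_lt_one hT), ← mul_assoc,
    ← zpow_add₀ (Complex.ofReal_ne_zero.2 (pow_pos (stepRatio_pos hT) _).ne'),
    show jy - jx + (jx - jy) = 0 by ring, zpow_zero, one_mul]

end BulkKernel

end FacetedCrystal

namespace FacetedCrystal

/-! ### Time reversal -/

section Reflection

/-- Time reversal of space-time points. -/
def timeReversal (x : ℤ × ℤ) : ℤ × ℤ := (x.1, -x.2)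

theorem evolution_neg (κ : ℝ) (t : ℤ) (z : ℂ) : evolution κ (-t) z = invEvolution κ t z⁻¹ := by
  rw [evolution, invEvolution, symbol_inv, neg_neg]

theorem invEvolution_neg (κ : ℝ) (t : ℤ) (z : ℂ) : invEvolution κ (-t) z = evolution κ t z⁻¹ := by
  rw [evolution, invEvolution, symbol_inv, neg_neg]

theorem lineCoeff_timeReversal (κ : ℝ) (s t d : ℤ) :
    lineCoeff κ (some (-t)) (some (-s)) (-d) = lineCoeff κ (some s) (some t) d := by
  have h : ∀ z ∈ unitCircle, transferSymbol κ (some (-t)) (some (-s)) z =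
      transferSymbol κ (some s) (some t) z⁻¹ := fun z _ => by
    simp only [transferSymbol, Option.elim_some, symbol_inv, neg_neg]
  rw [lineCoeff, lineCoeff, cf_reflect h, neg_neg]

/-- Transposing the matrix of a partition reverses time. -/
theorem schurKernel_timeReversal (κ : ℝ) (x y : ℤ × ℤ) :
    schurKernel κ (timeReversal y) (timeReversal x) = schurKernel κ x y := by
  have h1 : ∀ t n, cf (evolution κ (-t)) n = cf (invEvolution κ t) (-n) := fun t n =>
    cf_reflect (fun z _ => evolution_neg κ t z) n
  have h2 : ∀ t n, cf (invEvolution κ (-t)) n = cf (evolution κ t) (-n) := fun t n =>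
    cf_reflect (fun z _ => invEvolution_neg κ t z) n
  simp only [schurKernel, timeReversal, h1, h2, neg_lt_neg_iff]
  congr 1
  · refine tsum_congr fun k => ?_
    rw [mul_comm, neg_sub, sub_neg_eq_add, add_comm (k : ℤ), neg_add, ← sub_eq_add_neg]
  · rw [← neg_sub y.1 x.1, lineCoeff_timeReversal]

theorem bulkKernel_add (ζ τ : ℝ) (x y v : ℤ × ℤ) :
    bulkKernel ζ τ (x + v) (y + v) = bulkKernel ζ τ x y := by
  simp only [bulkKernel, bulkWave, Prod.fst_add, Prod.snd_add, add_le_add_iff_right,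
    add_sub_add_right_eq_sub]

theorem density_neg (ζ τ : ℝ) : density ζ (-τ) = density ζ τ := by
  rw [density, density, abs_neg, neg_div, Real.cosh_neg]

theorem bulkWave_timeReversal (τ : ℝ) (x y : ℤ × ℤ) (k : ℝ) :
    bulkWave (-τ) (timeReversal y) (timeReversal x) k = bulkWave τ x y (-k) := by
  simp only [bulkWave, kineticEnergy, timeReversal, abs_neg, Real.sign_neg]
  congr 2
  · push_cast
    ring
  · congr 1
    · push_cast
      ring
    · congr 3
      push_cast
      ring

theorem bulkWave_two_pi_sub (τ : ℝ) (hτ : τ ≠ 0) (x y : ℤ × ℤ) (k : ℝ) :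
    bulkWave τ x y (2 * Real.pi - k) = bulkWave τ x y (-k) := by
  obtain ⟨σ, hσ⟩ : ∃ σ : ℤ, Real.sign τ = σ := by
    rcases hτ.lt_or_gt with h | h
    · exact ⟨-1, by rw [Real.sign_of_neg h]; norm_num⟩
    · exact ⟨1, by rw [Real.sign_of_pos h]; norm_num⟩
  have e : kineticEnergy τ (2 * Real.pi - k) = kineticEnergy τ (-k) := by
    rw [kineticEnergy, kineticEnergy, hσ]
    congr 2
    refine Complex.exp_eq_exp_iff_exists_int.2 ⟨-σ, ?_⟩
    push_cast
    ring
  rw [bulkWave, bulkWave, e]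
  refine Complex.exp_eq_exp_iff_exists_int.2 ⟨x.1 - y.1, ?_⟩
  push_cast
  ring

/-- The substitution k ↦ -k preserves the arc of filled states, and k ↦ 2π - k that of the empty
states. -/
theorem bulkKernel_timeReversal (ζ τ : ℝ) (hτ : τ ≠ 0) (x y : ℤ × ℤ) :
    bulkKernel ζ (-τ) (timeReversal y) (timeReversal x) = bulkKernel ζ τ x y := by
  rw [bulkKernel, bulkKernel]
  simp only [bulkWave_timeReversal, density_neg]
  have e : (timeReversal x).2 ≤ (timeReversal y).2 ↔ y.2 ≤ x.2 := neg_le_neg_iff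
  simp only [e]
  congr 2
  · rw [intervalIntegral.integral_comp_neg, neg_neg]
  · simp_rw [← bulkWave_two_pi_sub τ hτ x y]
    rw [intervalIntegral.integral_comp_sub_left, sub_sub_cancel]

theorem lowerEdge_neg (τ : ℝ) : lowerEdge (-τ) = lowerEdge τ := by rw [lowerEdge, lowerEdge, abs_neg]

theorem upperEdge_neg (τ : ℝ) : upperEdge (-τ) = upperEdge τ := by rw [upperEdge, upperEdge, abs_neg]

end Reflection

/-! ### Convergence of the correlation functions -/

section Determinants

variable {ζ τ : ℝ}

/-- The gauge factor is conjugation by a diagonal matrix. -/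
theorem det_gauge {n : ℕ} {g : ℂ} (hg : g ≠ 0) (a : Fin n → ℤ) (K : Fin n → Fin n → ℂ) :
    (Matrix.of fun k l => g ^ (a l - a k) * K k l).det = (Matrix.of K).det := by
  have e : (Matrix.of fun k l => g ^ (a l - a k) * K k l) =
      Matrix.of fun k l => g ^ (-a k) * (Matrix.of fun k l => g ^ a l * (Matrix.of K) k l) k l := by
    ext k l
    simp only [Matrix.of_apply]
    rw [sub_eq_add_neg, zpow_add₀ hg]
    ring
  rw [e, Matrix.det_mul_column, Matrix.det_mul_row, ← mul_assoc, ← Finset.prod_mul_distrib,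
    Finset.prod_eq_one fun k _ => by rw [← zpow_add₀ hg, neg_add_cancel, zpow_zero], one_mul]

theorem tendsto_det {n : ℕ} {K : ℝ → Fin n → Fin n → ℂ} {L : Fin n → Fin n → ℂ}
    (h : ∀ k l, Tendsto (fun T => K T k l) atTop (𝓝 (L k l))) :
    Tendsto (fun T => (Matrix.of (K T)).det) atTop (𝓝 (Matrix.of L).det) := by
  have hc : Continuous fun A : Matrix (Fin n) (Fin n) ℂ => A.det := continuous_id.matrix_det
  refine (hc.tendsto (Matrix.of L)).comp ?_
  exact tendsto_pi_nhds.2 fun k => tendsto_pi_nhds.2 fun l => h k l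

theorem tendsto_det_schurKernel_of_pos (hτ : 0 < τ) (hl : lowerEdge τ < ζ) (hu : ζ < upperEdge τ)
    {J S : ℝ → ℤ} (hJ : Tendsto (fun T => (J T : ℝ) / T) atTop (𝓝 ζ))
    (hS : Tendsto (fun T => (S T : ℝ) / T) atTop (𝓝 τ)) {n : ℕ} (p : Fin n → ℤ × ℤ) :
    Tendsto (fun T => (Matrix.of fun k l =>
      (schurKernel (stepRatio T) ((J T, S T) + p k) ((J T, S T) + p l) : ℂ)).det) atTop
      (𝓝 (Matrix.of fun k l => bulkKernel ζ τ (p k) (p l)).det) := by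
  -- `tendsto_schurKernel` counts time forward from its base, so the base is moved back by a
  -- constant `M` until all local times are nonnegative. On the macroscopic scale this shift is
  -- invisible.
  obtain ⟨M, hM⟩ : ∃ M : ℕ, ∀ k, 0 ≤ (p k).2 + M :=
    ⟨∑ k, (p k).2.natAbs, fun k => by
      have : (p k).2.natAbs ≤ ∑ k, (p k).2.natAbs :=
        Finset.single_le_sum (f := fun k => (p k).2.natAbs) (fun _ _ => Nat.zero_le _) (Finset.mem_univ k)
      omega⟩
  have hSM : Tendsto (fun T => ((S T : ℝ) - M) / T) atTop (𝓝 τ) := by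
    have h := hS.sub (tendsto_id.const_div_atTop (M : ℝ))
    rw [sub_zero] at h
    exact h.congr fun T => (sub_div _ _ _).symm
  have hev : ∀ᶠ T in atTop, (M : ℤ) ≤ S T := by
    filter_upwards [hSM.eventually (lt_mem_nhds hτ), eventually_gt_atTop 0] with T h1 h2
    have h3 : (0 : ℝ) < S T - M := (div_pos_iff_of_pos_right h2).1 h1
    have h4 : ((M : ℤ) : ℝ) < S T := by push_cast; linarith
    exact (Int.cast_lt.1 h4).le
  have hΘ : Tendsto (fun T => (((S T - M).toNat : ℕ) : ℝ) / T) atTop (𝓝 τ) := by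
    refine hSM.congr' ?_
    filter_upwards [hev] with T hT
    have h : (((S T - M).toNat : ℕ) : ℤ) = S T - M := Int.toNat_of_nonneg (by omega)
    have h' : (((S T - M).toNat : ℕ) : ℝ) = S T - M := by exact_mod_cast congrArg (Int.cast : ℤ → ℝ) h
    rw [h']
  have hs : ∀ k, ((((p k).2 + M).toNat : ℕ) : ℤ) = (p k).2 + M := fun k => Int.toNat_of_nonneg (hM k)
  have hlim := tendsto_det fun k l => tendsto_schurKernel hτ hl hu hJ hΘ (p k).1 (p l).1
    ((p k).2 + M).toNat ((p l).2 + M).toNat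
  have e : ∀ k l, bulkKernel ζ τ ((p k).1, ((((p k).2 + M).toNat : ℕ) : ℤ))
      ((p l).1, ((((p l).2 + M).toNat : ℕ) : ℤ)) = bulkKernel ζ τ (p k) (p l) := fun k l => by
    rw [hs, hs, ← bulkKernel_add ζ τ (p k) (p l) (0, (M : ℤ))]
    congr 1 <;> ext <;> simp
  simp only [e] at hlim
  refine hlim.congr' ?_
  filter_upwards [hev, eventually_gt_atTop 1] with T hT hT1
  rw [det_gauge (Complex.ofReal_ne_zero.2 (pow_pos (stepRatio_pos hT1) _).ne')]
  congr 1
  ext k l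
  have hp : ∀ k, (J T + (p k).1, (((S T - M).toNat + ((p k).2 + M).toNat : ℕ) : ℤ)) =
      (J T, S T) + p k := fun k => by
    ext
    · rfl
    · rw [Nat.cast_add, hs, Int.toNat_of_nonneg (by omega), Prod.snd_add]
      ring
  simp only [Matrix.of_apply, hp]

/-- For negative τ, time reversal transposes both kernels, which leaves the determinants unchanged
and makes τ positive. -/
theorem tendsto_det_schurKernel (hτ : τ ≠ 0) (hl : lowerEdge τ < ζ) (hu : ζ < upperEdge τ)
    {J S : ℝ → ℤ} (hJ : Tendsto (fun T => (J T : ℝ) / T) atTop (𝓝 ζ))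
    (hS : Tendsto (fun T => (S T : ℝ) / T) atTop (𝓝 τ)) {n : ℕ} (p : Fin n → ℤ × ℤ) :
    Tendsto (fun T => (Matrix.of fun k l =>
      (schurKernel (stepRatio T) ((J T, S T) + p k) ((J T, S T) + p l) : ℂ)).det) atTop
      (𝓝 (Matrix.of fun k l => bulkKernel ζ τ (p k) (p l)).det) := by
  rcases hτ.lt_or_gt with h | h
  · have hS' : Tendsto (fun T => ((-S T : ℤ) : ℝ) / T) atTop (𝓝 (-τ)) := by
      refine hS.neg.congr fun T => ?_
      push_cast
      ring
    have hlim := tendsto_det_schurKernel_of_pos (neg_pos.2 h) (by rwa [lowerEdge_neg])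
      (by rwa [upperEdge_neg]) hJ hS' fun k => timeReversal (p k)
    have e1 : (Matrix.of fun k l => bulkKernel ζ (-τ) (timeReversal (p k)) (timeReversal (p l))).det =
        (Matrix.of fun k l => bulkKernel ζ τ (p k) (p l)).det := by
      rw [← Matrix.det_transpose]
      congr 1
      ext k l
      exact bulkKernel_timeReversal ζ τ hτ _ _
    rw [e1] at hlim
    refine hlim.congr fun T => ?_
    rw [← Matrix.det_transpose]
    congr 1
    ext k l
    have hp : ∀ k, (J T, -S T) + timeReversal (p k) = timeReversal ((J T, S T) + p k) := fun k => by
      ext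
      · rfl
      · simp only [timeReversal, Prod.snd_add]
        ring
    simp only [Matrix.transpose_apply, Matrix.of_apply, hp, schurKernel_timeReversal]
  · exact tendsto_det_schurKernel_of_pos h hl hu hJ hS p

end Determinants

end FacetedCrystal

namespace FacetedCrystal

/-! ### Fields on {0,1}^(ℤ²) and their moments -/

section Monomials

/-- The product of the occupation variables over a finite set of points. -/
noncomputable def monomial (s : Finset (ℤ × ℤ)) (ω : Field) : ℝ := ∏ p ∈ s, ((ω p).toNat : ℝ)

theorem continuous_monomial (s : Finset (ℤ × ℤ)) : Continuous (monomial s) :=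
  continuous_finsetProd _ fun p _ =>
    (continuous_of_discreteTopology (f := fun b : Bool => (b.toNat : ℝ))).comp (continuous_apply p)

theorem integrable_monomial (μ : Measure Field) [IsFiniteMeasure μ] (s : Finset (ℤ × ℤ)) :
    Integrable (monomial s) μ :=
  (continuous_monomial s).integrable_of_hasCompactSupport (HasCompactSupport.of_compactSpace _)

theorem monomial_insert {p : ℤ × ℤ} {s : Finset (ℤ × ℤ)} (hp : p ∉ s) (ω : Field) :
    monomial (insert p s) ω = ((ω p).toNat : ℝ) * monomial s ω := Finset.prod_insert hp

/-- A function of finitely many occupation variables is a combination of monomials. -/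
theorem exists_eq_sum_monomial (A : Finset (ℤ × ℤ)) (f : Field → ℝ)
    (hf : ∀ ω ω' : Field, (∀ p ∈ A, ω p = ω' p) → f ω = f ω') :
    ∃ a : Finset (ℤ × ℤ) → ℝ, ∀ ω, f ω = ∑ s ∈ A.powerset, a s * monomial s ω := by
  classical
  induction A using Finset.induction_on generalizing f with
  | empty =>
    refine ⟨fun _ => f fun _ => false, fun ω => ?_⟩
    rw [Finset.powerset_empty, Finset.sum_singleton, monomial, Finset.prod_empty, mul_one]
    exact hf _ _ fun p hp => absurd hp (Finset.notMem_empty p)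
  | insert q A hq ih =>
    have hdep : ∀ b : Bool, ∀ ω ω' : Field, (∀ p ∈ A, ω p = ω' p) →
        f (Function.update ω q b) = f (Function.update ω' q b) := fun b ω ω' h =>
      hf _ _ fun p hp => by
        rcases Finset.mem_insert.1 hp with rfl | hp'
        · simp
        · by_cases hpq : p = q
          · subst hpq; simp
          · simp [Function.update_of_ne hpq, h p hp']
    -- With ω(q) frozen to 0 and 1 the function becomes f₀ and f₁, and f = f₀ + ω(q) (f₁ - f₀).
    obtain ⟨a₀, h₀⟩ := ih (fun ω => f (Function.update ω q false)) (hdep false)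
    obtain ⟨a₁, h₁⟩ := ih (fun ω => f (Function.update ω q true)) (hdep true)
    refine ⟨fun s => if q ∈ s then a₁ (s.erase q) - a₀ (s.erase q) else a₀ s, fun ω => ?_⟩
    rw [Finset.sum_powerset_insert hq]
    have e0 : ∀ s ∈ A.powerset, (if q ∈ s then a₁ (s.erase q) - a₀ (s.erase q) else a₀ s) *
        monomial s ω = a₀ s * monomial s ω := fun s hs => by
      rw [if_neg fun h => hq (Finset.mem_powerset.1 hs h)]
    have e1 : ∀ s ∈ A.powerset, (if q ∈ insert q s then a₁ ((insert q s).erase q) -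
        a₀ ((insert q s).erase q) else a₀ (insert q s)) * monomial (insert q s) ω =
          ((ω q).toNat : ℝ) * (a₁ s * monomial s ω) - ((ω q).toNat : ℝ) * (a₀ s * monomial s ω) :=
      fun s hs => by
        have hqs : q ∉ s := fun h => hq (Finset.mem_powerset.1 hs h)
        rw [if_pos (Finset.mem_insert_self q s), Finset.erase_insert hqs, monomial_insert hqs]
        ring
    rw [Finset.sum_congr rfl e0, Finset.sum_congr rfl e1, Finset.sum_sub_distrib, ← Finset.mul_sum,
      ← Finset.mul_sum, ← h₀, ← h₁]
    have hup := Function.update_eq_self q ω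
    cases hb : ω q <;> rw [hb] at hup <;> simp [hup]

theorem measurableSet_local (A : Finset (ℤ × ℤ)) (E : Set (A → Bool)) :
    MeasurableSet {ω : Field | (fun a : A => ω a) ∈ E} :=
  (measurable_pi_lambda _ fun _ => measurable_pi_apply _) (Set.toFinite E).measurableSet

/-- Local probabilities are fixed combinations of the moments. -/
theorem exists_measureReal_eq_sum (A : Finset (ℤ × ℤ)) (E : Set (A → Bool)) :
    ∃ a : Finset (ℤ × ℤ) → ℝ, ∀ μ : Measure Field, IsFiniteMeasure μ →
      μ.real {ω | (fun a : A => ω a) ∈ E} = ∑ s ∈ A.powerset, a s * ∫ ω, monomial s ω ∂μ := by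
  obtain ⟨a, ha⟩ := exists_eq_sum_monomial A
    ({ω : Field | (fun a : A => ω a) ∈ E}.indicator fun _ => 1) fun ω ω' h => by
      have e : (fun a : A => ω a) = fun a : A => ω' a := funext fun a => h a a.2
      have hiff : ω ∈ {ω : Field | (fun a : A => ω a) ∈ E} ↔ ω' ∈ {ω : Field | (fun a : A => ω a) ∈ E} := by
        change (fun a : A => ω a) ∈ E ↔ (fun a : A => ω' a) ∈ E
        rw [e]
      by_cases h' : ω' ∈ {ω : Field | (fun a : A => ω a) ∈ E}
      · rw [Set.indicator_of_mem h', Set.indicator_of_mem (hiff.2 h')]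
      · rw [Set.indicator_of_notMem h', Set.indicator_of_notMem (mt hiff.1 h')]
  refine ⟨a, fun μ hμ => ?_⟩
  have h1 := integral_indicator_const (μ := μ) (1 : ℝ) (measurableSet_local A E)
  rw [smul_eq_mul, mul_one] at h1
  rw [← h1]
  simp_rw [ha]
  rw [integral_finsetSum _ fun s _ => (integrable_monomial μ s).const_mul _]
  simp_rw [integral_const_mul]

/-- Cylinder sets form a π-system generating the σ-algebra, and their probabilities are combinations
of moments. -/
theorem eq_of_moments_eq {μ ν : Measure Field} [IsProbabilityMeasure μ] [IsProbabilityMeasure ν]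
    (h : ∀ s, ∫ ω, monomial s ω ∂μ = ∫ ω, monomial s ω ∂ν) : μ = ν := by
  refine ext_of_generate_finite (measurableCylinders fun _ : ℤ × ℤ => Bool)
    generateFrom_measurableCylinders.symm isPiSystem_measurableCylinders (fun t ht => ?_) (by simp)
  obtain ⟨A, E, -, rfl⟩ := (mem_measurableCylinders t).1 ht
  obtain ⟨a, ha⟩ := exists_measureReal_eq_sum A E
  refine (measureReal_eq_measureReal_iff).1 ?_
  refine (ha μ inferInstance).trans (Eq.trans ?_ (ha ν inferInstance).symm)
  simp_rw [h]

theorem tendsto_local_of_moments {P : ℝ → Measure Field} {μ : Measure Field} [IsProbabilityMeasure μ]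
    (hP : ∀ᶠ T in atTop, IsProbabilityMeasure (P T))
    (h : ∀ s, Tendsto (fun T => ∫ ω, monomial s ω ∂P T) atTop (𝓝 (∫ ω, monomial s ω ∂μ))) :
    ConvergesLocally P μ := by
  intro A E
  obtain ⟨a, ha⟩ := exists_measureReal_eq_sum A E
  have h1 : Tendsto (fun T => ENNReal.ofReal (∑ s ∈ A.powerset, a s * ∫ ω, monomial s ω ∂P T)) atTop
      (𝓝 (ENNReal.ofReal (∑ s ∈ A.powerset, a s * ∫ ω, monomial s ω ∂μ))) :=
    ENNReal.tendsto_ofReal (tendsto_finsetSum _ fun s _ => (h s).const_mul _)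
  rw [← ha μ inferInstance, ofReal_measureReal] at h1
  refine h1.congr' ?_
  filter_upwards [hP] with T hT
  rw [← ha (P T) inferInstance, ofReal_measureReal]

theorem prod_toNat_eq_monomial {n : ℕ} {p : Fin n → ℤ × ℤ} (hp : Function.Injective p) (ω : Field) :
    ∏ k, ((ω (p k)).toNat : ℝ) = monomial (Finset.univ.image p) ω := by
  rw [monomial, Finset.prod_image hp.injOn]

theorem exists_enumeration (s : Finset (ℤ × ℤ)) :
    ∃ (n : ℕ) (p : Fin n → ℤ × ℤ), Function.Injective p ∧ Finset.univ.image p = s := by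
  refine ⟨s.card, fun k => (s.equivFin.symm k : ℤ × ℤ), Subtype.val_injective.comp s.equivFin.symm.injective, ?_⟩
  ext x
  simp only [Finset.mem_image, Finset.mem_univ, true_and]
  exact ⟨fun ⟨k, hk⟩ => hk ▸ (s.equivFin.symm k).2, fun hx => ⟨s.equivFin ⟨x, hx⟩, by simp⟩⟩

theorem IsDeterminantal.unique {K : ℤ × ℤ → ℤ × ℤ → ℂ} {μ ν : Measure Field} [IsProbabilityMeasure μ]
    [IsProbabilityMeasure ν] (hμ : IsDeterminantal K μ) (hν : IsDeterminantal K ν) : μ = ν := by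
  refine eq_of_moments_eq fun s => ?_
  obtain ⟨n, p, hp, rfl⟩ := exists_enumeration s
  have h := (hμ _ p hp).trans (hν _ p hp).symm
  simp_rw [prod_toNat_eq_monomial hp] at h
  exact_mod_cast h

theorem IsDeterminantal.translate {K : ℤ × ℤ → ℤ × ℤ → ℂ} (hK : ∀ x y v, K (x + v) (y + v) = K x y)
    {μ : Measure Field} (hμ : IsDeterminantal K μ) (v : ℤ × ℤ) :
    IsDeterminantal K (μ.map fun ω p => ω (p + v)) := by
  intro n p hp
  have hm : Measurable fun (ω : Field) (p : ℤ × ℤ) => ω (p + v) :=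
    measurable_pi_lambda _ fun p => measurable_pi_apply _
  have hs : AEStronglyMeasurable (fun ω : Field => ∏ k, ((ω (p k)).toNat : ℝ))
      (μ.map fun ω p => ω (p + v)) := by
    simp_rw [prod_toNat_eq_monomial hp]
    exact (continuous_monomial _).aestronglyMeasurable
  rw [integral_map hm.aemeasurable hs,
    hμ n (fun k => p k + v) fun k l h => hp (add_right_cancel h)]
  simp only [hK]

theorem IsDeterminantal.isTranslationInvariant {K : ℤ × ℤ → ℤ × ℤ → ℂ}
    (hK : ∀ x y v, K (x + v) (y + v) = K x y) {μ : Measure Field} [IsProbabilityMeasure μ]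
    (hμ : IsDeterminantal K μ) : IsTranslationInvariant μ := fun v => by
  have hm : Measurable fun (ω : Field) (p : ℤ × ℤ) => ω (p + v) :=
    measurable_pi_lambda _ fun p => measurable_pi_apply _
  have := Measure.isProbabilityMeasure_map (μ := μ) hm.aemeasurable
  exact (hμ.translate hK v).unique hμ

/-- A limit of moments defines a determinantal field. -/
theorem exists_isDeterminantal_of_tendsto {K : ℤ × ℤ → ℤ × ℤ → ℂ} {P : ℝ → Measure Field}
    (hP : ∀ᶠ T in atTop, IsProbabilityMeasure (P T))
    (h : ∀ (n : ℕ) (p : Fin n → ℤ × ℤ), Function.Injective p →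
      Tendsto (fun T => ((∫ ω, ∏ k, ((ω (p k)).toNat : ℝ) ∂P T : ℝ) : ℂ)) atTop
        (𝓝 (Matrix.of fun k l => K (p k) (p l)).det)) :
    ∃ μ : Measure Field, IsProbabilityMeasure μ ∧ IsDeterminantal K μ ∧ ConvergesLocally P μ := by
  classical
  let Q : ℝ → ProbabilityMeasure Field := fun T =>
    if hT : IsProbabilityMeasure (P T) then ⟨P T, hT⟩ else ⟨Measure.dirac fun _ => false, inferInstance⟩
  have hQ : ∀ᶠ T in atTop, (Q T : Measure Field) = P T := by
    filter_upwards [hP] with T hT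
    have h : Q T = ⟨P T, hT⟩ := dif_pos hT
    rw [h]
    rfl
  -- The probability measures on the compact space of fields form a compact space, so the measures
  -- converge along an ultrafilter finer than `atTop`. Monomials are continuous, hence the limit has
  -- the prescribed moments.
  let U : Ultrafilter ℝ := Ultrafilter.of atTop
  have hU : (U : Filter ℝ) ≤ atTop := Ultrafilter.of_le atTop
  obtain ⟨μ, -, hμ⟩ := (isCompact_univ (X := ProbabilityMeasure Field)).ultrafilter_le_nhds (U.map Q)
    (by simp)
  have hdet : IsDeterminantal K (μ : Measure Field) := by
    intro n p hp
    have hlim : Tendsto Q U (𝓝 μ) := hμ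
    have hc : Continuous fun ω : Field => ∏ k, ((ω (p k)).toNat : ℝ) := by
      simp_rw [prod_toNat_eq_monomial hp]
      exact continuous_monomial _
    have h1 := (ProbabilityMeasure.tendsto_iff_forall_integral_tendsto.1 hlim)
      (BoundedContinuousFunction.mkOfCompact ⟨_, hc⟩)
    have h2 := (Complex.continuous_ofReal.tendsto _).comp h1
    refine tendsto_nhds_unique h2 (((h n p hp).mono_left hU).congr' ?_)
    filter_upwards [hU hQ] with T hT
    simp [hT]
  -- Convergence along `atTop` itself needs no compactness: the moments converge by hypothesis and
  -- they determine the local probabilities.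
  refine ⟨μ, inferInstance, hdet, tendsto_local_of_moments hP fun s => ?_⟩
  obtain ⟨n, p, hp, rfl⟩ := exists_enumeration s
  have h1 := h _ p hp
  rw [← hdet _ p hp] at h1
  simp_rw [prod_toNat_eq_monomial hp] at h1
  exact (Complex.continuous_re.tendsto _).comp h1

end Monomials

end FacetedCrystal

namespace FacetedCrystal

/-! ### The law of the crystal as a normalized sum -/

section CrystalLaw

instance : Countable Height := Subtype.countable

theorem weight_eq {T : ℝ} (hT : 1 < T) (h : Height) :
    weight T h = ENNReal.ofReal (stepRatio T ^ (2 * volume h)) := by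
  rw [weight, pow_mul, stepRatio_sq hT]

theorem tsum_weight_eq {T : ℝ} (hT : 1 < T) :
    ∑' h, weight T h = ENNReal.ofReal (∑' h, stepRatio T ^ (2 * volume h)) := by
  simp_rw [weight_eq hT]
  exact (ENNReal.ofReal_tsum_of_nonneg (fun h => pow_nonneg (stepRatio_pos hT).le _)
    (summable_weights (stepRatio_pos hT) (stepRatio_lt_one hT))).symm

theorem partition_pos {T : ℝ} (hT : 1 < T) : 0 < ∑' h, stepRatio T ^ (2 * volume h) :=
  (summable_weights (stepRatio_pos hT) (stepRatio_lt_one hT)).tsum_pos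
    (fun _ => pow_nonneg (stepRatio_pos hT).le _) ⟨0, fun _ _ _ => le_rfl⟩
    (pow_pos (stepRatio_pos hT) _)

theorem isProbabilityMeasure_crystalLaw {T : ℝ} (hT : 1 < T) : IsProbabilityMeasure (crystalLaw T) := by
  constructor
  rw [crystalLaw, Measure.smul_apply, Measure.sum_apply _ MeasurableSet.univ]
  simp only [Measure.smul_apply, measure_univ, smul_eq_mul, mul_one]
  rw [tsum_weight_eq hT]
  exact ENNReal.inv_mul_cancel (ENNReal.ofReal_pos.2 (partition_pos hT)).ne' ENNReal.ofReal_ne_top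

theorem crystalLaw_real_singleton {T : ℝ} (hT : 1 < T) (h : Height) : (crystalLaw T).real {h} =
    (∑' h, stepRatio T ^ (2 * volume h))⁻¹ * stepRatio T ^ (2 * volume h) := by
  have hsum : ∑' h', (weight T h' • Measure.dirac h' : Measure Height) {h} = weight T h := by
    rw [tsum_eq_single h fun h' hne => ?_]
    · rw [Measure.smul_apply, Measure.dirac_apply_of_mem (Set.mem_singleton h), smul_eq_mul, mul_one]
    · rw [Measure.smul_apply, Measure.dirac_apply' _ (measurableSet_singleton h),
        Set.indicator_of_notMem (by simpa using hne), smul_zero]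
  rw [measureReal_def, crystalLaw, Measure.smul_apply, Measure.sum_apply _ (measurableSet_singleton h),
    hsum, smul_eq_mul, tsum_weight_eq hT, weight_eq hT, ENNReal.toReal_mul, ENNReal.toReal_inv,
    ENNReal.toReal_ofReal (partition_pos hT).le,
    ENNReal.toReal_ofReal (pow_nonneg (stepRatio_pos hT).le _)]

theorem integral_crystalLaw {T : ℝ} (hT : 1 < T) {f : Height → ℝ} {C : ℝ} (hf : ∀ h, |f h| ≤ C) :
    ∫ h, f h ∂crystalLaw T = (∑' h, stepRatio T ^ (2 * volume h))⁻¹ *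
      ∑' h, stepRatio T ^ (2 * volume h) * f h := by
  have := isProbabilityMeasure_crystalLaw hT
  have hi : Integrable f (crystalLaw T) :=
    Integrable.of_bound measurable_from_top.aestronglyMeasurable C (ae_of_all _ hf)
  rw [integral_countable hi, ← tsum_mul_left]
  exact tsum_congr fun h => by rw [crystalLaw_real_singleton hT, smul_eq_mul, mul_assoc]

theorem measurable_bulkField (ζ τ T : ℝ) : Measurable (bulkField ζ τ T) := measurable_from_top

theorem isProbabilityMeasure_bulkLaw (ζ τ : ℝ) {T : ℝ} (hT : 1 < T) :
    IsProbabilityMeasure (bulkLaw ζ τ T) := by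
  have := isProbabilityMeasure_crystalLaw hT
  exact Measure.isProbabilityMeasure_map (measurable_bulkField ζ τ T).aemeasurable

/-- The shifted occupation field of the crystal is determinantal. -/
theorem isDeterminantal_bulkLaw (ζ τ : ℝ) {T : ℝ} (hT : 1 < T) :
    IsDeterminantal (fun x y => (schurKernel (stepRatio T) ((⌊ζ * T⌋, ⌊τ * T⌋) + x)
      ((⌊ζ * T⌋, ⌊τ * T⌋) + y) : ℂ)) (bulkLaw ζ τ T) := by
  intro n p hp
  have hs : AEStronglyMeasurable (fun ω : Field => ∏ k, ((ω (p k)).toNat : ℝ)) (bulkLaw ζ τ T) := by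
    simp_rw [prod_toNat_eq_monomial hp]
    exact (continuous_monomial _).aestronglyMeasurable
  have e : ∀ h k, ((bulkField ζ τ T h (p k)).toNat : ℝ) = ind ℝ (∃ l : ℕ,
      gradientLine h l ((⌊ζ * T⌋, ⌊τ * T⌋) + p k).2 = ((⌊ζ * T⌋, ⌊τ * T⌋) + p k).1) := by
    intro h k
    rw [bulkField, occupation]
    by_cases hk : ∃ l : ℕ, gradientLine h l (⌊τ * T⌋ + (p k).2) = ⌊ζ * T⌋ + (p k).1
    · rw [ind_of (by exact hk)]
      simp [hk]
    · rw [ind_of_not (by exact hk)]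
      simp [hk]
  rw [bulkLaw, integral_map (measurable_bulkField ζ τ T).aemeasurable hs]
  simp_rw [e]
  rw [integral_crystalLaw hT fun h => abs_prod_ind_le _,
    tsum_prod_eq_det_schurKernel (stepRatio_pos hT) (stepRatio_lt_one hT)
      (p := fun k => (⌊ζ * T⌋, ⌊τ * T⌋) + p k) (fun k l h => hp (add_left_cancel h)), ← mul_assoc,
    inv_mul_cancel₀ (partition_pos hT).ne', one_mul]
  rw [← Complex.ofRealHom_eq_coe, RingHom.map_det]
  rfl

theorem tendsto_floor_div (a : ℝ) : Tendsto (fun T : ℝ => (⌊a * T⌋ : ℝ) / T) atTop (𝓝 a) := by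
  have h : Tendsto (fun T : ℝ => a - 1 / T) atTop (𝓝 a) := by
    simpa using tendsto_const_nhds.sub (tendsto_id.const_div_atTop (1 : ℝ))
  refine tendsto_of_tendsto_of_tendsto_of_le_of_le' h tendsto_const_nhds ?_ ?_
  · filter_upwards [eventually_gt_atTop 0] with T hT
    rw [le_div_iff₀ hT, sub_mul, div_mul_cancel₀ _ hT.ne']
    exact (Int.sub_one_lt_floor _).le
  · filter_upwards [eventually_gt_atTop 0] with T hT
    rw [div_le_iff₀ hT]
    exact Int.floor_le _

end CrystalLaw

/-! ### The kernel at equal times -/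

section SineKernel

theorem bulkKernel_self (ζ τ : ℝ) (x : ℤ × ℤ) : bulkKernel ζ τ x x = ((density ζ τ : ℝ) : ℂ) := by
  have h : ∀ k, bulkWave τ x x k = 1 := fun k => by simp [bulkWave]
  have hπ : (Real.pi : ℂ) ≠ 0 := Complex.ofReal_ne_zero.2 Real.pi_ne_zero
  rw [bulkKernel, if_pos le_rfl]
  simp only [h, intervalIntegral.integral_const, Complex.real_smul]
  push_cast
  field_simp
  ring

theorem bulkKernel_equal_time (ζ τ : ℝ) {i j : ℤ} (hij : i ≠ j) (t : ℤ) :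
    bulkKernel ζ τ (i, t) (j, t) =
      ((Real.sin (Real.pi * density ζ τ * ((i : ℝ) - j)) / (Real.pi * ((i : ℝ) - j)) : ℝ) : ℂ) := by
  have hπ : (Real.pi : ℂ) ≠ 0 := Complex.ofReal_ne_zero.2 Real.pi_ne_zero
  have hd : ((i : ℂ) - j) ≠ 0 := sub_ne_zero.2 (Int.cast_injective.ne hij)
  have h : ∀ k, bulkWave τ (i, t) (j, t) k = Complex.exp (Complex.I * ((i : ℂ) - j) * k) := fun k => by
    rw [bulkWave]
    congr 1
    push_cast
    ring
  rw [bulkKernel, if_pos le_rfl]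
  simp only [h]
  rw [integral_exp_mul_complex (mul_ne_zero Complex.I_ne_zero hd), Complex.ofReal_div,
    Complex.ofReal_sin, Complex.sin]
  have e : ∀ s : ℂ, Complex.I * ((i : ℂ) - j) * s = s * ((i : ℂ) - j) * Complex.I := fun s => by ring
  rw [e, e]
  push_cast
  rw [neg_mul, neg_mul]
  field_simp
  rw [Complex.I_sq]
  ring_nf

end SineKernel

end FacetedCrystal

/-- Local equilibrium in the rounded part of the crystal: the occupation field seen from a
macroscopic bulk point converges in local distributions to the determinantal space-time field
with kernel `bulkKernel`. -/
theorem theorem3p1 (ζ₀ τ₀ : ℝ) (hτ₀ : τ₀ ≠ 0)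
    (hlower : FacetedCrystal.lowerEdge τ₀ < ζ₀) (hupper : ζ₀ < FacetedCrystal.upperEdge τ₀) :
    (∃ μ : MeasureTheory.Measure FacetedCrystal.Field,
      MeasureTheory.IsProbabilityMeasure μ ∧
      FacetedCrystal.IsDeterminantal (FacetedCrystal.bulkKernel ζ₀ τ₀) μ ∧
      (∀ ν : MeasureTheory.Measure FacetedCrystal.Field,
        MeasureTheory.IsProbabilityMeasure ν →
        FacetedCrystal.IsDeterminantal (FacetedCrystal.bulkKernel ζ₀ τ₀) ν → ν = μ) ∧
      FacetedCrystal.IsTranslationInvariant μ ∧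
      FacetedCrystal.ConvergesLocally (FacetedCrystal.bulkLaw ζ₀ τ₀) μ) ∧
    (∀ i t : ℤ, FacetedCrystal.bulkKernel ζ₀ τ₀ (i, t) (i, t) =
      ((FacetedCrystal.density ζ₀ τ₀ : ℝ) : ℂ)) ∧
    (∀ i j t : ℤ, i ≠ j → FacetedCrystal.bulkKernel ζ₀ τ₀ (i, t) (j, t) =
      ((Real.sin (Real.pi * FacetedCrystal.density ζ₀ τ₀ * ((i : ℝ) - j)) /
        (Real.pi * ((i : ℝ) - j)) : ℝ) : ℂ)) := by
  refine ⟨?_, fun i t => FacetedCrystal.bulkKernel_self _ _ _,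
    fun i j t hij => FacetedCrystal.bulkKernel_equal_time _ _ hij t⟩
  obtain ⟨μ, hμ, hdet, hconv⟩ := FacetedCrystal.exists_isDeterminantal_of_tendsto
    (K := FacetedCrystal.bulkKernel ζ₀ τ₀) (P := FacetedCrystal.bulkLaw ζ₀ τ₀)
    ((eventually_gt_atTop 1).mono fun T hT => FacetedCrystal.isProbabilityMeasure_bulkLaw ζ₀ τ₀ hT)
    fun n p hp => by
      refine (FacetedCrystal.tendsto_det_schurKernel hτ₀ hlower hupper
        (FacetedCrystal.tendsto_floor_div ζ₀) (FacetedCrystal.tendsto_floor_div τ₀) p).congr' ?_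
      filter_upwards [eventually_gt_atTop 1] with T hT
      exact (FacetedCrystal.isDeterminantal_bulkLaw ζ₀ τ₀ hT n p hp).symm
  exact ⟨μ, hμ, hdet, fun ν hν hνdet => hνdet.unique hdet,
    hdet.isTranslationInvariant (FacetedCrystal.bulkKernel_add ζ₀ τ₀), hconv⟩
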